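/- Let $G$ be a compact connected Lie group with Lie algebra $\mathfrak g$. Let $\mathcal A=C^1([0,1],\mathfrak g)^4$, with the $C^1$-norm, and let $\mathcal A_{\rm NS}\subset\mathcal A$ be the set of all $\mathcal T=(T_0,T_1,T_2,T_3)$ that solve the Nahm–Schmid equations $$\dot T_1+[T_0,T_1]=-[T_2,T_3],\qquad \dot T_2+[T_0,T_2]=[T_3,T_1],\qquad \dot T_3+[T_0,T_3]=[T_1,T_2]$$ on $[0,1]$. Let $\mathcal G=C^2([0,1],G)$, let $\mathcal G_{00}=\{u\in\mathcal G : u(0)=1=u(1)\}$ act on $\mathcal A_{\rm NS}$ by $$u.(T_0,T_1,T_2,T_3)=(uT_0u^{-1}-\dot uu^{-1},\,uT_1u^{-1},\,uT_2u^{-1},\,uT_3u^{-1}),$$ and let $\mathcal M=\mathcal A_{\rm NS}/\mathcal G_{00}$ with the quotient topology. Then: (i) For every $\mathcal T\in\mathcal A_{\rm NS}$ there is a unique $u_0\in\mathcal G$ with $T_0=-\dot u_0u_0^{-1}$ and $u_0(0)=1$. (ii) $\mathcal A_{\rm NS}$ is a smooth Banach submanifold of $\mathcal A$ (modelled on $C^1([0,1],\mathfrak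 g)\times\mathfrak g^3$), and $\mathcal M$ is Hausdorff and carries a structure of smooth Banach manifold (modelled on $\mathfrak g^4$) for which the projection $\mathcal A_{\rm NS}\to\mathcal M$ is a smooth submersion. (iii) For this structure, the map $$\Psi:\mathcal M\to G\times\mathfrak g\times\mathfrak g\times\mathfrak g,\qquad [\mathcal T]\mapsto(u_0(1),T_1(0),T_2(0),T_3(0))$$ is a well-defined diffeomorphism. -/

import Mathlib

open scoped Manifold ContDiff

noncomputable section

namespace NahmSchmid

/-! ### The Banach space of `C¹` maps `[0,1] → E` -/

/-- The pairs `(f, f')` of continuous functions on `[0,1]` such that `f'` is the derivative of `f`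
(one-sided at the end points). -/
def C1Submodule (E : Type*) [NormedAddCommGroup E] [NormedSpace ℝ E] :
    Submodule ℝ (C(unitInterval, E) × C(unitInterval, E)) where
  carrier := {p | ∀ t : unitInterval,
    HasDerivWithinAt (Set.IccExtend zero_le_one p.1) (p.2 t) (Set.Icc (0 : ℝ) 1) t}
  add_mem' hp hq t := (hp t).add (hq t)
  zero_mem' t := hasDerivWithinAt_const (t : ℝ) (Set.Icc (0 : ℝ) 1) (0 : E)
  smul_mem' c _ hp t := (hp t).const_smul c

/-- The space `C¹([0,1], E)`. A `C¹` function is recorded together with its (continuous) derivative,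
and the norm is `max (‖f‖_∞) (‖f'‖_∞)`. -/
def C1 (E : Type*) [NormedAddCommGroup E] [NormedSpace ℝ E] : Type _ := C1Submodule E

namespace C1

variable {E : Type*} [NormedAddCommGroup E] [NormedSpace ℝ E]

instance : NormedAddCommGroup (C1 E) := inferInstanceAs (NormedAddCommGroup (C1Submodule E))

instance : NormedSpace ℝ (C1 E) := inferInstanceAs (NormedSpace ℝ (C1Submodule E))

/-- An element of `C¹([0,1], E)` is a function on `[0,1]`. -/
instance : CoeFun (C1 E) (fun _ => unitInterval → E) := ⟨fun f => f.1.1⟩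

/-- The derivative of an element of `C¹([0,1], E)`. -/
def der (f : C1 E) : unitInterval → E := f.1.2

theorem mem_iff_integral [CompleteSpace E] (p : C(unitInterval, E) × C(unitInterval, E)) :
    p ∈ C1Submodule E ↔ ∀ t : unitInterval,
      p.1 t = p.1 0 + ∫ s in (0 : ℝ)..t, Set.IccExtend zero_le_one p.2 s := by
  have hc : Continuous (Set.IccExtend (zero_le_one' ℝ) p.2) := p.2.continuous.Icc_extend'
  have hc1 : Continuous (Set.IccExtend (zero_le_one' ℝ) p.1) := p.1.continuous.Icc_extend'
  have e1 : ∀ t : unitInterval, Set.IccExtend (zero_le_one' ℝ) p.1 t = p.1 t :=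
    fun t => Set.IccExtend_val _ _ t
  have e2 : ∀ t : unitInterval, Set.IccExtend (zero_le_one' ℝ) p.2 t = p.2 t :=
    fun t => Set.IccExtend_val _ _ t
  constructor
  · intro hp t
    have key := intervalIntegral.integral_eq_sub_of_hasDerivAt_of_le (a := (0 : ℝ)) (b := t)
      (f := Set.IccExtend (zero_le_one' ℝ) p.1) (f' := Set.IccExtend (zero_le_one' ℝ) p.2)
      t.2.1 hc1.continuousOn (fun x hx => by
        have hx1 : x < 1 := lt_of_lt_of_le hx.2 t.2.2
        have h := hp ⟨x, hx.1.le, hx1.le⟩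
        have h2 := h.hasDerivAt (Icc_mem_nhds hx.1 hx1)
        rw [← e2] at h2
        exact h2) (hc.intervalIntegrable _ _)
    rw [key, e1]
    have := e1 0
    simp only [Set.Icc.coe_zero] at this
    rw [this]; abel
  · intro h t
    have h2 : HasDerivAt (fun x : ℝ => p.1 0 + ∫ s in (0 : ℝ)..x, Set.IccExtend (zero_le_one' ℝ) p.2 s)
        (p.2 t) t := by
      rw [← e2]
      exact (intervalIntegral.integral_hasDerivAt_right (hc.intervalIntegrable _ _)
        (hc.stronglyMeasurableAtFilter _ _) hc.continuousAt).const_add _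
    refine h2.hasDerivWithinAt.congr (fun x hx => ?_) ?_
    · rw [← h ⟨x, hx⟩]; exact e1 ⟨x, hx⟩
    · rw [← h t]; exact e1 t

/-- `C¹([0,1], E)` is a Banach space when `E` is. -/
instance [CompleteSpace E] : CompleteSpace (C1 E) := by
  have hcl : IsClosed (C1Submodule E : Set (C(unitInterval, E) × C(unitInterval, E))) := by
    have : (C1Submodule E : Set (C(unitInterval, E) × C(unitInterval, E))) =
        ⋂ t : unitInterval, {p | p.1 t = p.1 0 +
          ∫ s in (0 : ℝ)..t, Set.IccExtend zero_le_one p.2 s} := by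
      ext p
      simpa using mem_iff_integral p
    rw [this]
    refine isClosed_iInter fun t => isClosed_eq (by fun_prop) (Continuous.add (by fun_prop) ?_)
    refine intervalIntegral.continuous_parametric_intervalIntegral_of_continuous' ?_ _ _
    have : Continuous fun q : (C(unitInterval, E) × C(unitInterval, E)) × ℝ =>
        q.1.2 (Set.projIcc 0 1 zero_le_one q.2) := by fun_prop
    exact this
  exact hcl.completeSpace_coe

end C1

/-! ### The Lie algebra of `G`, the adjoint action and logarithmic derivatives

`G` is a Lie group modelled on the vector space `E`. Mathlib's Lie algebra
`GroupLieAlgebra 𝓘(ℝ, E) G = T₁G` is, as a vector space, `E` itself; we write its elements as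
elements of `E`, in order to have a norm at hand. -/

variable {E : Type*} [NormedAddCommGroup E] [NormedSpace ℝ E]
  {G : Type*} [TopologicalSpace G] [ChartedSpace E G] [Group G]

variable (G) in
/-- The Lie bracket of the Lie algebra `T₁G = E` of `G`. -/
def bracket (x y : E) : E :=
  (⁅(show GroupLieAlgebra 𝓘(ℝ, E) G from x), (show GroupLieAlgebra 𝓘(ℝ, E) G from y)⁆ :
    GroupLieAlgebra 𝓘(ℝ, E) G)

/-- The adjoint action `x ↦ g x g⁻¹` of `g : G` on the Lie algebra `T₁G = E`: the derivative
at `1` of the conjugation by `g`. -/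
def Ad (g : G) : E →L[ℝ] E :=
  mfderiv 𝓘(ℝ, E) 𝓘(ℝ, E) (fun h : G => g * h * g⁻¹) 1

/-- `u : [0,1] → G` is of class `C²` (up to the boundary). -/
def IsC2 (u : unitInterval → G) : Prop :=
  ContMDiffOn 𝓘(ℝ, ℝ) 𝓘(ℝ, E) 2 (Set.IccExtend zero_le_one u) (Set.Icc (0 : ℝ) 1)

/-- The right logarithmic derivative `u̇ u⁻¹` of `u : [0,1] → G` at time `t`, an element of the
Lie algebra `T₁G = E`: the velocity at `s = t` of the curve `s ↦ u(s) u(t)⁻¹`, which passes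
through `1` at `s = t`. -/
def rlogDeriv (u : unitInterval → G) (t : unitInterval) : E :=
  mfderivWithin 𝓘(ℝ, ℝ) 𝓘(ℝ, E) (fun s : ℝ => Set.IccExtend zero_le_one u s * (u t)⁻¹)
    (Set.Icc (0 : ℝ) 1) (t : ℝ) (1 : ℝ)


section Lemmas

set_option linter.unusedSectionVars false

theorem iccExtend_coe (u : unitInterval → G) (t : unitInterval) :
    Set.IccExtend (zero_le_one' ℝ) u t = u t := Set.IccExtend_val _ _ t

variable [LieGroup 𝓘(ℝ, E) ∞ G]

theorem contMDiff_conj (g : G) :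
    ContMDiff 𝓘(ℝ, E) 𝓘(ℝ, E) ∞ (fun h : G => g * h * g⁻¹) :=
  (contMDiff_const.mul contMDiff_id).mul contMDiff_const

theorem Ad_one (x : E) : Ad (1 : G) x = x := by
  have h : (fun h : G => (1 : G) * h * (1 : G)⁻¹) = id := by ext; simp
  unfold Ad
  rw [h, mfderiv_id]
  rfl

/-- Chain rule for a conjugation composed with a curve through `1`. -/
theorem mfderivWithin_conj_curve (g : G) (c : ℝ → G) {s : Set ℝ} {t : ℝ} (hs : UniqueDiffOn ℝ s)
    (ht : t ∈ s) (h1 : c t = 1) (hc : MDifferentiableWithinAt 𝓘(ℝ, ℝ) 𝓘(ℝ, E) c s t) :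
    (show E from mfderivWithin 𝓘(ℝ, ℝ) 𝓘(ℝ, E) (fun r => g * c r * g⁻¹) s t (1 : ℝ)) =
      Ad g (show E from mfderivWithin 𝓘(ℝ, ℝ) 𝓘(ℝ, E) c s t (1 : ℝ)) := by
  have hd : MDifferentiableAt 𝓘(ℝ, E) 𝓘(ℝ, E) (fun h : G => g * h * g⁻¹) (c t) :=
    (contMDiff_conj g).mdifferentiable (by simp) _
  have := mfderiv_comp_mfderivWithin (I := 𝓘(ℝ, ℝ)) (I' := 𝓘(ℝ, E)) (I'' := 𝓘(ℝ, E))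
    (g := fun h : G => g * h * g⁻¹) (f := c) (s := s) t hd hc
    (hs.uniqueMDiffOn t ht)
  have h2 : (fun r => g * c r * g⁻¹) = (fun h : G => g * h * g⁻¹) ∘ c := rfl
  rw [h2, this]
  unfold Ad
  rw [h1]
  rfl

/-- Product rule for two curves through `1`. -/
theorem mfderivWithin_mul_curve (a c : ℝ → G) {s : Set ℝ} {t : ℝ} (hs : UniqueDiffOn ℝ s)
    (ht : t ∈ s) (ha1 : a t = 1) (hc1 : c t = 1)
    (ha : MDifferentiableWithinAt 𝓘(ℝ, ℝ) 𝓘(ℝ, E) a s t)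
    (hc : MDifferentiableWithinAt 𝓘(ℝ, ℝ) 𝓘(ℝ, E) c s t) :
    (show E from mfderivWithin 𝓘(ℝ, ℝ) 𝓘(ℝ, E) (fun r => a r * c r) s t (1 : ℝ)) =
      (show E from mfderivWithin 𝓘(ℝ, ℝ) 𝓘(ℝ, E) a s t (1 : ℝ)) +
      (show E from mfderivWithin 𝓘(ℝ, ℝ) 𝓘(ℝ, E) c s t (1 : ℝ)) := by
  have hm : MDifferentiableAt (𝓘(ℝ, E).prod 𝓘(ℝ, E)) 𝓘(ℝ, E)
      (fun p : G × G => p.1 * p.2) (a t, c t) :=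
    (contMDiff_mul 𝓘(ℝ, E) ∞).mdifferentiable (by simp) _
  have hu := hs.uniqueMDiffOn t ht
  have h2 : (fun r => a r * c r) = (fun p : G × G => p.1 * p.2) ∘ (fun r => (a r, c r)) := rfl
  have h3 := mfderiv_comp_mfderivWithin (I := 𝓘(ℝ, ℝ)) (I' := 𝓘(ℝ, E).prod 𝓘(ℝ, E))
    (I'' := 𝓘(ℝ, E)) (g := fun p : G × G => p.1 * p.2) (f := fun r => (a r, c r)) (s := s) t hm
    (ha.prodMk hc) hu
  have h4 := (ha.hasMFDerivWithinAt.prodMk hc.hasMFDerivWithinAt).mfderivWithin hu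
  have e1 : (fun z : G => z * (a t, c t).2) = id := by ext z; simp [hc1]
  have e2 : (fun z : G => (a t, c t).1 * z) = id := by ext z; simp [ha1]
  rw [h2, h3, h4]
  have h5 := fun v => mfderiv_prod_eq_add_apply (I := 𝓘(ℝ, E)) (I' := 𝓘(ℝ, E)) (I'' := 𝓘(ℝ, E))
    (f := fun p : G × G => p.1 * p.2) (p := (a t, c t)) (v := v) hm
  have h6 : ∀ v : E × E, (show E from mfderiv (𝓘(ℝ, E).prod 𝓘(ℝ, E)) 𝓘(ℝ, E)
      (fun p : G × G => p.1 * p.2) (a t, c t) v) = v.1 + v.2 := by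
    intro v
    refine (h5 v).trans ?_
    rw [e1, e2]
    simp only [mfderiv_id]
    rfl
  exact h6 _

theorem Ad_mul (g h : G) (x : E) : Ad (g * h) x = Ad g (Ad h x) := by
  have e : (fun k : G => g * h * k * (g * h)⁻¹) =
      (fun k : G => g * k * g⁻¹) ∘ (fun k : G => h * k * h⁻¹) := by
    ext k; simp [mul_assoc]
  have h1 : h * 1 * h⁻¹ = 1 := by simp
  unfold Ad
  rw [e, mfderiv_comp (I' := 𝓘(ℝ, E)) 1 ((contMDiff_conj g).mdifferentiable (by simp) _)
    ((contMDiff_conj h).mdifferentiable (by simp) _), h1]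
  rfl

theorem IsC2.mdifferentiableWithinAt {u : unitInterval → G} (hu : IsC2 (E := E) u)
    (t : unitInterval) (g : G) :
    MDifferentiableWithinAt 𝓘(ℝ, ℝ) 𝓘(ℝ, E) (fun s : ℝ => Set.IccExtend zero_le_one u s * g)
      (Set.Icc (0 : ℝ) 1) t :=
  ((hu t t.2).mul contMDiffWithinAt_const (n := 2)).mdifferentiableWithinAt (by simp)

theorem rlogDeriv_one (t : unitInterval) :
    rlogDeriv (E := E) (1 : unitInterval → G) t = 0 := by
  have h : (fun s : ℝ => Set.IccExtend zero_le_one (1 : unitInterval → G) s *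
      ((1 : unitInterval → G) t)⁻¹) = fun _ => (1 : G) := by ext s; simp [Set.IccExtend]
  unfold rlogDeriv
  rw [h, mfderivWithin_const]
  rfl

/-- The cocycle rule `(uv)˙ (uv)⁻¹ = u̇ u⁻¹ + u (v̇ v⁻¹) u⁻¹`. -/
theorem rlogDeriv_mul {u v : unitInterval → G} (hu : IsC2 (E := E) u) (hv : IsC2 (E := E) v)
    (t : unitInterval) :
    rlogDeriv (E := E) (u * v) t = rlogDeriv u t + Ad (u t) (rlogDeriv (E := E) v t) := by
  have hs : UniqueDiffOn ℝ (Set.Icc (0 : ℝ) 1) := uniqueDiffOn_Icc zero_lt_one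
  have e : (fun s : ℝ => Set.IccExtend (zero_le_one' ℝ) (u * v) s * ((u * v) t)⁻¹) =
      fun s => (Set.IccExtend (zero_le_one' ℝ) u s * (u t)⁻¹) *
        (u t * (Set.IccExtend (zero_le_one' ℝ) v s * (v t)⁻¹) * (u t)⁻¹) := by
    ext s; simp [Set.IccExtend, mul_assoc]
  have h1 := hu.mdifferentiableWithinAt t (u t)⁻¹
  have h2 := hv.mdifferentiableWithinAt t (v t)⁻¹
  have hv1 : Set.IccExtend (zero_le_one' ℝ) v t * (v t)⁻¹ = 1 := by rw [iccExtend_coe]; simp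
  have h3 := mfderivWithin_mul_curve (E := E)
    (fun s => Set.IccExtend (zero_le_one' ℝ) u s * (u t)⁻¹)
    (fun s => u t * (Set.IccExtend (zero_le_one' ℝ) v s * (v t)⁻¹) * (u t)⁻¹) hs t.2
    (by rw [iccExtend_coe]; simp) (by rw [hv1]; simp) h1
    (((contMDiff_conj (u t)).mdifferentiable (by simp) _).comp_mdifferentiableWithinAt _ h2)
  have h4 := mfderivWithin_conj_curve (E := E) (u t)
    (fun s => Set.IccExtend (zero_le_one' ℝ) v s * (v t)⁻¹) hs t.2 hv1 h2
  unfold rlogDeriv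
  rw [e]
  refine h3.trans ?_
  rw [h4]

end Lemmas

/-! ### Gauge transformations -/

section Gauge

variable (E G)
variable [LieGroup 𝓘(ℝ, E) ∞ G]

/-- The group `𝒢 = C²([0,1], G)` of gauge transformations, under pointwise multiplication. -/
def gaugeGroup : Subgroup (unitInterval → G) where
  carrier := {u | IsC2 (E := E) u}
  mul_mem' hu hv := ContMDiffOn.mul hu hv
  one_mem' := contMDiffOn_const (c := (1 : G))
  inv_mem' hu := ContMDiffOn.inv hu

/-- The group `𝒢₀₀ = {u ∈ 𝒢 | u(0) = 1 = u(1)}`. -/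
def gaugeGroup₀₀ : Subgroup (unitInterval → G) where
  carrier := {u | u ∈ gaugeGroup E G ∧ u 0 = 1 ∧ u 1 = 1}
  mul_mem' hu hv := ⟨mul_mem hu.1 hv.1, by simp [hu.2.1, hv.2.1], by simp [hu.2.2, hv.2.2]⟩
  one_mem' := ⟨one_mem _, rfl, rfl⟩
  inv_mem' hu := ⟨inv_mem hu.1, by simp [hu.2.1], by simp [hu.2.2]⟩

end Gauge

/-- `u.T = S`, that is `S = (u T₀ u⁻¹ - u̇ u⁻¹, u T₁ u⁻¹, u T₂ u⁻¹, u T₃ u⁻¹)`. -/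
def IsGaugeTransform (u : unitInterval → G) (T S : Fin 4 → C1 E) : Prop :=
  ∀ t, S 0 t = Ad (u t) (T 0 t) - rlogDeriv u t ∧ S 1 t = Ad (u t) (T 1 t) ∧
    S 2 t = Ad (u t) (T 2 t) ∧ S 3 t = Ad (u t) (T 3 t)

/-! ### The Nahm–Schmid equations and the moduli space -/

variable (G) in
/-- The Nahm–Schmid equations on `[0,1]`. -/
def IsSolution (T : Fin 4 → C1 E) : Prop :=
  ∀ t, (T 1).der t + bracket G (T 0 t) (T 1 t) = - bracket G (T 2 t) (T 3 t) ∧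
    (T 2).der t + bracket G (T 0 t) (T 2 t) = bracket G (T 3 t) (T 1 t) ∧
    (T 3).der t + bracket G (T 0 t) (T 3 t) = bracket G (T 1 t) (T 2 t)

variable (E G) in
/-- The set of `C¹` solutions of the Nahm–Schmid equations, a topological subspace of the Banach
space `C¹([0,1], 𝔤)⁴`. -/
abbrev Sol : Type _ := {T : Fin 4 → C1 E // IsSolution G T}

variable (E G) in
/-- The orbit equivalence relation of `𝒢₀₀` on the solutions of the Nahm–Schmid equations. -/
def gaugeSetoid [LieGroup 𝓘(ℝ, E) ∞ G] : Setoid (Sol E G) where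
  r T S := ∃ u ∈ gaugeGroup₀₀ E G, IsGaugeTransform u T.1 S.1
  iseqv := by
    refine ⟨fun T => ⟨1, one_mem _, fun t => ?_⟩, ?_, ?_⟩
    · simp [rlogDeriv_one, Ad_one]
    · rintro T S ⟨u, hu, h⟩
      refine ⟨u⁻¹, inv_mem hu, fun t => ?_⟩
      have hA : ∀ x : E, Ad (u⁻¹ t) (Ad (u t) x) = x := fun x => by
        rw [← Ad_mul]; simp [Ad_one]
      have hL := rlogDeriv_mul (E := E) (inv_mem hu).1 hu.1 t
      rw [inv_mul_cancel, rlogDeriv_one] at hL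
      obtain ⟨h0, h1, h2, h3⟩ := h t
      refine ⟨?_, by rw [h1, hA], by rw [h2, hA], by rw [h3, hA]⟩
      rw [h0, map_sub, hA, sub_sub, add_comm, ← hL, sub_zero]
    · rintro T S R ⟨u, hu, h⟩ ⟨v, hv, k⟩
      refine ⟨v * u, mul_mem hv hu, fun t => ?_⟩
      obtain ⟨h0, h1, h2, h3⟩ := h t
      obtain ⟨k0, k1, k2, k3⟩ := k t
      refine ⟨?_, ?_, ?_, ?_⟩
      · rw [k0, h0, rlogDeriv_mul hv.1 hu.1, Pi.mul_apply, Ad_mul, map_sub]; abel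
      · rw [k1, h1, Pi.mul_apply, Ad_mul]
      · rw [k2, h2, Pi.mul_apply, Ad_mul]
      · rw [k3, h3, Pi.mul_apply, Ad_mul]

variable (E G) in
/-- The moduli space `ℳ` of solutions of the Nahm–Schmid equations, with the quotient topology. -/
abbrev Moduli [LieGroup 𝓘(ℝ, E) ∞ G] : Type _ := Quotient (gaugeSetoid E G)

/-- The projection of the space of solutions onto the moduli space. -/
def toModuli [LieGroup 𝓘(ℝ, E) ∞ G] (T : Sol E G) : Moduli E G := Quotient.mk _ T

/-- `u` is the gauge transformation in `𝒢` with `T₀ = - u̇ u⁻¹` and `u(0) = 1`. -/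
def IsGaugeFrame [LieGroup 𝓘(ℝ, E) ∞ G] (T : Fin 4 → C1 E) (u : unitInterval → G) : Prop :=
  u ∈ gaugeGroup E G ∧ u 0 = 1 ∧ ∀ t, T 0 t = - rlogDeriv u t

end NahmSchmid

end

/-!
# The moduli space of solutions of the Nahm–Schmid equations on `[0,1]`

The Lie algebra `𝔤 = T₁G` is the model space `E`, by means of the preferred chart at the identity.
Its bracket is the derivative of the adjoint action (`bracketL`, `bracketL_apply`), and averaging over
the compact group `G` yields an `Ad`-invariant inner product (`exists_Ad_invariant_inner`).

*Frames.* The equation `u̇ u⁻¹ = -X`, `u(0) = 1` is solved for small `X` by the inverse function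
theorem in `C⁰([0,1], 𝔤)`, where the unknown is the coordinate velocity of `u`
(`exists_local_frames`). If `u` is a frame for `X` and `w` one for `Ad(u⁻¹)(Y - X)`, then `uw` is a
frame for `Y`; as `Ad(G)` is bounded, finitely many such steps reach any given path
(`exists_isFrame`), and frames are unique (`IsFrame.unique`). This is the first assertion. The same
perturbation argument shows that the holonomy `X ↦ u(1)` is a linear projection in suitable smooth
local coordinates (`exists_hol_straightening`). So it is open, and as its image is an open subgroup
of the connected group `G`, it is surjective (`isOpenQuotientMap_hol`).

*The solution space.* For given `T₀` the Nahm–Schmid equations are a quadratic differential equation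
for `(T₁, T₂, T₃)`, and `2|T₁|² + |T₂|² + |T₃|²` is conserved (`exists_nahm_conserved`), so solutions
exist on all of `[0,1]` (`exists_quadSolution_of_conserved`). They depend smoothly on `T₀` and on the
initial values by the inverse function theorem; the linearized equation is solvable because Volterra
operators are quasi-nilpotent (`isUnit_one_add_volterra`, `exists_contDiff_quadSolution`). Hence the
solution space is the graph of a smooth function of `(T₀, T₁(0), T₂(0), T₃(0))`
(`exists_isSolution_iff_graph`), and as such a submanifold (`exists_manifold_of_graph`).

*The moduli space.* Two solutions are gauge equivalent under `𝒢₀₀` if and only if their holonomies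
and their initial values agree (`gaugeSetoid_iff`): the quotient of their frames is then a gauge
transformation in `𝒢₀₀`, and it maps the one to the other by uniqueness for the initial value
problem. Since the map `period` formed by these invariants is an open quotient map, it induces a
homeomorphism from the moduli space to `G × 𝔤³` (`exists_moduli_homeomorph`), along which the
manifold structure is transported. In the straightening coordinates for the holonomy the projection
becomes linear, so it is a submersion (`isSubmersion_toModuli`).
-/

noncomputable section

namespace NahmSchmid

open Set Topology Filter

universe v

/-! ### Calculus in spaces of continuous functions -/

section Superposition

variable {K : Type*} [TopologicalSpace K] [CompactSpace K]

/-- The pointwise application of a continuous bilinear map to continuous functions. -/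
def liftBilin {X Y Z : Type*} [NormedAddCommGroup X] [NormedSpace ℝ X] [NormedAddCommGroup Y]
    [NormedSpace ℝ Y] [NormedAddCommGroup Z] [NormedSpace ℝ Z] (B : X →L[ℝ] Y →L[ℝ] Z) :
    C(K, X) →L[ℝ] C(K, Y) →L[ℝ] C(K, Z) :=
  LinearMap.mkContinuous₂
    (LinearMap.mk₂ ℝ (fun f g => ⟨fun t => B (f t) (g t), by fun_prop⟩)
      (fun f f' g => by ext t; simp) (fun c f g => by ext t; simp)
      (fun f g g' => by ext t; simp) (fun c f g => by ext t; simp)) ‖B‖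
    (fun f g => by
      refine (ContinuousMap.norm_le _ (by positivity)).2 fun t => ?_
      refine (B.le_opNorm₂ (f t) (g t)).trans ?_
      gcongr
      · exact f.norm_coe_le_norm t
      · exact g.norm_coe_le_norm t)

@[simp] theorem liftBilin_apply {X Y Z : Type*} [NormedAddCommGroup X] [NormedSpace ℝ X]
    [NormedAddCommGroup Y] [NormedSpace ℝ Y] [NormedAddCommGroup Z] [NormedSpace ℝ Z]
    (B : X →L[ℝ] Y →L[ℝ] Z) (f : C(K, X)) (g : C(K, Y)) (t : K) :
    liftBilin B f g t = B (f t) (g t) := rfl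

theorem contDiff_liftBilin {X Y Z : Type*} [NormedAddCommGroup X] [NormedSpace ℝ X]
    [NormedAddCommGroup Y] [NormedSpace ℝ Y] [NormedAddCommGroup Z] [NormedSpace ℝ Z]
    (B : X →L[ℝ] Y →L[ℝ] Z) : ContDiff ℝ ∞ fun f : C(K, X) => liftBilin (K := K) B f :=
  ContinuousLinearMap.contDiff (𝕜 := ℝ) (E := C(K, X)) (F := C(K, Y) →L[ℝ] C(K, Z)) (liftBilin B)

/-- The derivative of superposition with a `C¹` map `f` is pointwise application of the derivative
of `f`: the mean value inequality is uniform in the point because `ξ ↦ f' ∘ ξ` is continuous for the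
supremum norm. -/
theorem hasFDerivAt_superposition {X Y : Type*} [NormedAddCommGroup X] [NormedSpace ℝ X]
    [NormedAddCommGroup Y] [NormedSpace ℝ Y] (f : C(X, Y)) (f' : C(X, X →L[ℝ] Y))
    (hf : ∀ x, HasFDerivAt f (f' x) x) (ξ : C(K, X)) :
    HasFDerivAt (fun ξ : C(K, X) => f.comp ξ)
      (liftBilin (ContinuousLinearMap.id ℝ (X →L[ℝ] Y)) (f'.comp ξ)) ξ := by
  rw [hasFDerivAt_iff_isLittleO_nhds_zero, Asymptotics.isLittleO_iff]
  intro ε hε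
  have hc : ContinuousAt (fun ξ : C(K, X) => f'.comp ξ) ξ :=
    (ContinuousMap.continuous_postcomp f').continuousAt
  obtain ⟨δ, hδ, h⟩ := (Metric.continuousAt_iff (f := fun ξ : C(K, X) => f'.comp ξ) (a := ξ)).1 hc ε hε
  filter_upwards [Metric.ball_mem_nhds (0 : C(K, X)) hδ] with η hη
  rw [mem_ball_zero_iff] at hη
  refine (ContinuousMap.norm_le _ (by positivity)).2 fun t => ?_
  have key := (convex_segment (ξ t) (ξ t + η t)).norm_image_sub_le_of_norm_hasFDerivWithin_le'
    (f := f) (f' := f') (φ := f' (ξ t)) (C := ε)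
    (fun x _ => (hf x).hasFDerivWithinAt) (fun x hx => by
      obtain ⟨s, hs, rfl⟩ := (segment_eq_image' ℝ (ξ t) (ξ t + η t)) ▸ hx
      have h1 : dist (ξ + s • η) ξ < δ := by
        rw [dist_eq_norm, add_sub_cancel_left, norm_smul, Real.norm_of_nonneg hs.1]
        exact (mul_le_of_le_one_left (norm_nonneg _) hs.2).trans_lt hη
      have h2 := (ContinuousMap.dist_apply_le_dist (f := f'.comp (ξ + s • η)) (g := f'.comp ξ) t).trans
        (h h1).le
      simpa [dist_eq_norm] using h2)
    (left_mem_segment ℝ _ _) (right_mem_segment ℝ _ _)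
  simp only [add_sub_cancel_left] at key
  refine key.trans ?_
  gcongr
  exact η.norm_coe_le_norm t

/-- Superposition with a smooth map is a smooth map of spaces of continuous functions. -/
theorem contDiff_superposition {X Y : Type v} [NormedAddCommGroup X] [NormedSpace ℝ X]
    [NormedAddCommGroup Y] [NormedSpace ℝ Y] (f : C(X, Y)) (hf : ContDiff ℝ ∞ f) :
    ContDiff ℝ ∞ (fun ξ : C(K, X) => f.comp ξ) := by
  rw [contDiff_infty]
  intro n
  induction n generalizing Y with
  | zero => exact contDiff_zero.2 (ContinuousMap.continuous_postcomp f)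
  | succ n ih =>
    have h' : ContDiff ℝ ∞ (fderiv ℝ f) := hf.fderiv_right (by simp)
    let f' : C(X, X →L[ℝ] Y) := ⟨fderiv ℝ f, h'.continuous⟩
    refine contDiff_succ_iff_hasFDerivAt.2
      ⟨fun ξ => liftBilin (ContinuousLinearMap.id ℝ (X →L[ℝ] Y)) (f'.comp ξ), ?_, fun ξ =>
        hasFDerivAt_superposition f f' (fun x => (hf.differentiable (by simp) x).hasFDerivAt) ξ⟩
    exact (liftBilin (ContinuousLinearMap.id ℝ (X →L[ℝ] Y))).contDiff.comp (ih f' h')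

end Superposition

/-! ### The space `C¹([0,1], E)` and the Volterra operator -/

namespace C1

variable {E : Type*} [NormedAddCommGroup E] [NormedSpace ℝ E]

/-- The inclusion of `C¹` into `C⁰`. -/
def toC : C1 E →L[ℝ] C(unitInterval, E) :=
  (ContinuousLinearMap.fst ℝ _ _).comp (C1Submodule E).subtypeL

/-- Differentiation as a continuous linear map from `C¹` to `C⁰`. -/
def derL : C1 E →L[ℝ] C(unitInterval, E) :=
  (ContinuousLinearMap.snd ℝ _ _).comp (C1Submodule E).subtypeL

theorem toC_apply (f : C1 E) (t : unitInterval) : toC f t = f t := rfl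

theorem derL_apply (f : C1 E) (t : unitInterval) : derL f t = f.der t := rfl

@[simp] theorem add_apply (f g : C1 E) (t : unitInterval) : (f + g) t = f t + g t := rfl

@[simp] theorem sub_apply (f g : C1 E) (t : unitInterval) : (f - g) t = f t - g t := rfl

@[simp] theorem neg_apply (f : C1 E) (t : unitInterval) : (-f) t = - f t := rfl

@[simp] theorem zero_apply (t : unitInterval) : (0 : C1 E) t = 0 := rfl

@[simp] theorem smul_apply (c : ℝ) (f : C1 E) (t : unitInterval) : (c • f) t = c • f t := rfl

theorem continuous (f : C1 E) : Continuous (fun t => f t) := f.1.1.continuous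

theorem continuous_der (f : C1 E) : Continuous f.der := f.1.2.continuous

theorem hasDerivWithinAt (f : C1 E) (t : unitInterval) :
    HasDerivWithinAt (IccExtend zero_le_one f) (f.der t) (Icc (0 : ℝ) 1) t := f.2 t

theorem norm_apply_le (f : C1 E) (t : unitInterval) : ‖f t‖ ≤ ‖toC f‖ :=
  (toC f).norm_coe_le_norm t

theorem uniqueDiffWithinAt (t : unitInterval) : UniqueDiffWithinAt ℝ (Icc (0 : ℝ) 1) t :=
  uniqueDiffOn_Icc zero_lt_one t t.2

theorem ext_der {f g : C1 E} (h : ∀ t, f t = g t) (h' : ∀ t, f.der t = g.der t) : f = g :=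
  Subtype.ext (Prod.ext (ContinuousMap.ext h) (ContinuousMap.ext h'))

/-- On `[0,1]` the derivative is determined by the function, so that `C¹` functions are equal as
soon as their values are. -/
theorem ext {f g : C1 E} (h : ∀ t, f t = g t) : f = g := by
  refine ext_der h fun t => ?_
  have e : (f : unitInterval → E) = g := funext h
  have h1 := f.hasDerivWithinAt t
  rw [e] at h1
  exact (uniqueDiffWithinAt t).eq_deriv _ h1 (g.hasDerivWithinAt t)

/-- A function on `[0,1]` with a continuous derivative defines an element of `C1 E`. -/
theorem exists_of_hasDerivWithinAt {f f' : ℝ → E}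
    (h : ∀ t ∈ Icc (0 : ℝ) 1, HasDerivWithinAt f (f' t) (Icc 0 1) t)
    (hf' : ContinuousOn f' (Icc 0 1)) :
    ∃ F : C1 E, (∀ t : unitInterval, F t = f t) ∧ ∀ t : unitInterval, F.der t = f' t := by
  have hf : ContinuousOn f (Icc 0 1) := fun t ht => (h t ht).continuousWithinAt
  refine ⟨⟨(⟨fun t => f t, continuousOn_iff_continuous_domRestrict.1 hf⟩,
    ⟨fun t => f' t, continuousOn_iff_continuous_domRestrict.1 hf'⟩), fun t => ?_⟩,
    fun t => rfl, fun t => rfl⟩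
  refine (h t t.2).congr (fun s hs => ?_) ?_
  · exact IccExtend_of_mem _ _ hs
  · exact IccExtend_of_mem _ _ t.2

theorem eq_add_integral [CompleteSpace E] (f : C1 E) (t : unitInterval) :
    f t = f 0 + ∫ s in (0 : ℝ)..t, IccExtend zero_le_one (derL f) s :=
  (mem_iff_integral f.1).1 f.2 t

/-- The constant functions. -/
def const (x : E) : C1 E :=
  ⟨(ContinuousMap.const _ x, 0), fun t => hasDerivWithinAt_const (t : ℝ) (Icc (0 : ℝ) 1) x⟩

variable [CompleteSpace E]

/-- The primitive with prescribed value at `0`. -/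
def prim (x : E) (ζ : C(unitInterval, E)) : C1 E :=
  have hc : Continuous (IccExtend (zero_le_one' ℝ) ζ) := ζ.continuous.Icc_extend'
  ⟨(⟨fun t => x + ∫ s in (0 : ℝ)..t, IccExtend (zero_le_one' ℝ) ζ s, continuous_const.add
    ((intervalIntegral.continuous_primitive (fun a b => hc.intervalIntegrable a b) 0).comp
      continuous_subtype_val)⟩, ζ), (mem_iff_integral _).2 fun t => by simp⟩

@[simp] theorem prim_zero (x : E) (ζ : C(unitInterval, E)) : prim x ζ 0 = x := by
  change x + ∫ s in (0 : ℝ)..0, IccExtend (zero_le_one' ℝ) ζ s = x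
  simp

theorem prim_apply (x : E) (ζ : C(unitInterval, E)) (t : unitInterval) :
    prim x ζ t = x + ∫ s in (0 : ℝ)..t, IccExtend (zero_le_one' ℝ) ζ s := rfl

variable (E) in
/-- A `C¹` function is determined by its initial value and its derivative. -/
def equivProd : C1 E ≃L[ℝ] E × C(unitInterval, E) :=
  LinearEquiv.toContinuousLinearEquivOfContinuous
    { toFun := fun f => (f 0, derL f)
      map_add' := fun _ _ => rfl
      map_smul' := fun _ _ => rfl
      invFun := fun p => prim p.1 p.2
      left_inv := fun f => ext_der (fun t => (eq_add_integral f t).symm) (fun _ => rfl)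
      right_inv := fun _ => Prod.ext (prim_zero _ _) rfl }
    (((ContinuousMap.evalCLM ℝ (0 : unitInterval)).comp toC).prod derL).continuous

end C1

section Volterra

variable {E : Type*} [NormedAddCommGroup E] [NormedSpace ℝ E] [CompleteSpace E]

variable (E) in
/-- The integration operator `ζ ↦ ∫₀ᵗ ζ` on `C⁰([0,1], E)`. -/
def integrate : C(unitInterval, E) →L[ℝ] C(unitInterval, E) :=
  C1.toC.comp ((C1.equivProd E).symm.toContinuousLinearMap.comp (ContinuousLinearMap.inr ℝ _ _))

theorem integrate_eq_prim (ζ : C(unitInterval, E)) : integrate E ζ = C1.toC (C1.prim 0 ζ) := rfl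

theorem integrate_apply (ζ : C(unitInterval, E)) (t : unitInterval) :
    integrate E ζ t = ∫ s in (0 : ℝ)..t, IccExtend (zero_le_one' ℝ) ζ s := by
  rw [integrate_eq_prim, C1.toC_apply, C1.prim_apply, zero_add]

theorem norm_integrate_apply_le {ζ : C(unitInterval, E)} {c : ℝ} {n : ℕ}
    (h : ∀ t : unitInterval, ‖ζ t‖ ≤ c * (t : ℝ) ^ n) (t : unitInterval) :
    ‖integrate E ζ t‖ ≤ c * (t : ℝ) ^ (n + 1) / (n + 1) := by
  rw [integrate_apply]
  have h1 := intervalIntegral.norm_integral_le_of_norm_le (μ := MeasureTheory.volume)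
    (f := IccExtend (zero_le_one' ℝ) ζ) (g := fun s => c * s ^ n) t.2.1
    (Filter.Eventually.of_forall fun s hs => by
      have hs' : s ∈ Icc (0 : ℝ) 1 := ⟨hs.1.le, hs.2.trans t.2.2⟩
      rw [IccExtend_of_mem _ _ hs']
      exact h ⟨s, hs'⟩) ((by fun_prop : Continuous fun s : ℝ => c * s ^ n).intervalIntegrable _ _)
  refine h1.trans (le_of_eq ?_)
  rw [intervalIntegral.integral_const_mul, integral_pow]
  simp [mul_div_assoc]

/-- The Volterra operator with kernel `L(t)`: `ζ ↦ L(t) ∫₀ᵗ ζ`. -/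
def volterra (L : C(unitInterval, E →L[ℝ] E)) : C(unitInterval, E) →L[ℝ] C(unitInterval, E) :=
  (liftBilin (ContinuousLinearMap.id ℝ (E →L[ℝ] E)) L).comp (integrate E)

@[simp] theorem volterra_apply (L : C(unitInterval, E →L[ℝ] E)) (ζ : C(unitInterval, E))
    (t : unitInterval) : volterra L ζ t = L t (integrate E ζ t) := rfl

/-- The bound `‖Vⁿ‖ ≤ ‖L‖ⁿ / n!` for the powers of a Volterra operator, in the pointwise form in
which it is proved by induction. -/
theorem norm_volterra_pow_apply_le (L : C(unitInterval, E →L[ℝ] E)) (ζ : C(unitInterval, E))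
    (n : ℕ) (t : unitInterval) :
    ‖(volterra L ^ n) ζ t‖ ≤ ‖L‖ ^ n / n.factorial * ‖ζ‖ * (t : ℝ) ^ n := by
  induction n generalizing t with
  | zero => simpa using ζ.norm_coe_le_norm t
  | succ n ih =>
    rw [pow_succ', mul_apply_eq_comp, volterra_apply]
    refine ((L t).le_opNorm _).trans ?_
    refine (mul_le_mul (L.norm_coe_le_norm t) (norm_integrate_apply_le ih t) (norm_nonneg _)
      (norm_nonneg _)).trans (le_of_eq ?_)
    rw [Nat.factorial_succ]
    push_cast
    field_simp
    ring

/-- The Volterra operator is quasi-nilpotent, so that `1 + V` is invertible. -/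
theorem isUnit_one_add_volterra (L : C(unitInterval, E →L[ℝ] E)) : IsUnit (1 + volterra L) := by
  obtain ⟨n, hn⟩ := ((FloorSemiring.tendsto_pow_div_factorial_atTop ‖L‖).eventually
    (gt_mem_nhds (zero_lt_one' ℝ))).exists
  set W := volterra (-L) with hW
  have hV : ‖W ^ n‖ < 1 := by
    refine lt_of_le_of_lt (ContinuousLinearMap.opNorm_le_bound _ (by positivity) fun ζ => ?_) hn
    refine (ContinuousMap.norm_le _ (by positivity)).2 fun t => ?_
    refine (norm_volterra_pow_apply_le (-L) ζ n t).trans ?_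
    rw [show ‖-L‖ = ‖L‖ from norm_neg L]
    exact mul_le_of_le_one_right (by positivity) (pow_le_one₀ t.2.1 t.2.2)
  have h2 : IsUnit (1 - W ^ n) :=
    isUnit_one_sub_of_norm_lt_one (R := C(unitInterval, E) →L[ℝ] C(unitInterval, E)) hV
  have h4 : 1 + volterra L = 1 - W := by
    ext ζ t
    simp [hW]
  rw [h4]
  -- `1 - Wⁿ = (1 - W)(1 + W + ⋯ + Wⁿ⁻¹)` with commuting factors.
  rw [← mul_neg_geom_sum W] at h2
  have hcomm : Commute (1 - W) (∑ i ∈ Finset.range n, W ^ i) :=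
    Commute.sum_right _ _ _ fun i _ =>
      Commute.pow_right ((Commute.one_left _).sub_left (Commute.refl _)) _
  exact (hcomm.isUnit_mul_iff.1 h2).1

end Volterra

/-! ### The canonical chart at the identity and the adjoint action -/

section Chart

variable {E : Type*} [NormedAddCommGroup E] [NormedSpace ℝ E]
  {G : Type*} [TopologicalSpace G] [ChartedSpace E G] [Group G]

variable (E G) in
/-- The preferred chart at the identity of `G`. Its derivative at the identity is the
identification of `T₁G` with `E`. -/
def oneChart : PartialEquiv G E := extChartAt 𝓘(ℝ, E) (1 : G)

variable (E G) in
/-- The coordinates of the identity in the preferred chart. -/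
def oneCoord : E := oneChart E G 1

theorem oneCoord_mem_target : oneCoord E G ∈ (oneChart E G).target :=
  mem_extChartAt_target (I := 𝓘(ℝ, E)) (1 : G)

theorem isOpen_oneChart_target : IsOpen (oneChart E G).target :=
  isOpen_extChartAt_target (I := 𝓘(ℝ, E)) (1 : G)

theorem one_mem_oneChart_source : (1 : G) ∈ (oneChart E G).source :=
  mem_extChartAt_source (I := 𝓘(ℝ, E)) (1 : G)

@[simp] theorem oneChart_symm_oneCoord : (oneChart E G).symm (oneCoord E G) = 1 :=
  extChartAt_to_inv (I := 𝓘(ℝ, E)) (1 : G)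

theorem oneChart_one : oneChart E G 1 = oneCoord E G := rfl

/-- For a curve through the identity, the manifold derivative is the derivative in the preferred
chart. -/
theorem mfderivWithin_eq_derivWithin {f : ℝ → G} {s : Set ℝ} {t : ℝ} (h1 : f t = 1)
    (hf : MDifferentiableWithinAt 𝓘(ℝ, ℝ) 𝓘(ℝ, E) f s t) :
    HasFDerivWithinAt (oneChart E G ∘ f) (show ℝ →L[ℝ] E from
      mfderivWithin 𝓘(ℝ, ℝ) 𝓘(ℝ, E) f s t) s t := by
  have h := hf.hasMFDerivWithinAt.2
  simp only [writtenInExtChartAt, h1, extChartAt_model_space_eq_id, PartialEquiv.refl_coe,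
    PartialEquiv.refl_symm, id_eq, Function.comp_id, preimage_id_eq, modelWithCornersSelf_coe,
    range_id, inter_univ] at h
  exact h

variable [LieGroup 𝓘(ℝ, E) ∞ G]

theorem contMDiffAt_oneChart_symm {x : E} (hx : x ∈ (oneChart E G).target) :
    ContMDiffAt 𝓘(ℝ, E) 𝓘(ℝ, E) ∞ (oneChart E G).symm x :=
  haveI : IsManifold 𝓘(ℝ, E) ∞ G := inferInstance
  (contMDiffOn_extChartAt_symm (1 : G)).contMDiffAt (isOpen_oneChart_target.mem_nhds hx)

theorem contMDiffAt_oneChart {g : G} (hg : g ∈ (oneChart E G).source) :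
    ContMDiffAt 𝓘(ℝ, E) 𝓘(ℝ, E) ∞ (oneChart E G) g :=
  haveI : IsManifold 𝓘(ℝ, E) ∞ G := inferInstance
  contMDiffAt_extChartAt' (by rwa [oneChart, extChartAt_source] at hg)

theorem contDiffAt_oneChart_comp {X : Type*} [NormedAddCommGroup X] [NormedSpace ℝ X] {f : X → G}
    {x : X} (hf : ContMDiffAt 𝓘(ℝ, X) 𝓘(ℝ, E) ∞ f x) (hx : f x ∈ (oneChart E G).source) :
    ContDiffAt ℝ ∞ (fun y => oneChart E G (f y)) x :=
  ((contMDiffAt_oneChart hx).comp x hf).contDiffAt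

variable (G) in
/-- The multiplication of `G` in the preferred chart. -/
def chartMul (p : E × E) : E :=
  oneChart E G ((oneChart E G).symm p.1 * (oneChart E G).symm p.2)

variable (G) in
/-- The conjugation of `G` in the preferred chart. -/
def chartConj (x y : E) : E :=
  oneChart E G ((oneChart E G).symm x * (oneChart E G).symm y * ((oneChart E G).symm x)⁻¹)

variable (G) in
/-- The map `(x, y) ↦ y x⁻¹` of `G` in the preferred chart. -/
def chartDiv (x y : E) : E :=
  oneChart E G ((oneChart E G).symm y * ((oneChart E G).symm x)⁻¹)

theorem contMDiffAt_symm_fst {p : E × E} (h : p.1 ∈ (oneChart E G).target) :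
    ContMDiffAt 𝓘(ℝ, E × E) 𝓘(ℝ, E) ∞ (fun p : E × E => (oneChart E G).symm p.1) p :=
  (contMDiffAt_oneChart_symm h).comp p contDiff_fst.contMDiff.contMDiffAt

theorem contMDiffAt_symm_snd {p : E × E} (h : p.2 ∈ (oneChart E G).target) :
    ContMDiffAt 𝓘(ℝ, E × E) 𝓘(ℝ, E) ∞ (fun p : E × E => (oneChart E G).symm p.2) p :=
  (contMDiffAt_oneChart_symm h).comp p contDiff_snd.contMDiff.contMDiffAt

theorem contDiffAt_chartMul {p : E × E} (h1 : p.1 ∈ (oneChart E G).target)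
    (h2 : p.2 ∈ (oneChart E G).target)
    (h : (oneChart E G).symm p.1 * (oneChart E G).symm p.2 ∈ (oneChart E G).source) :
    ContDiffAt ℝ ∞ (chartMul G) p :=
  contDiffAt_oneChart_comp ((contMDiffAt_symm_fst h1).mul (contMDiffAt_symm_snd h2)) h

theorem contDiffAt_chartConj {x : E} (h1 : x ∈ (oneChart E G).target) :
    ContDiffAt ℝ ∞ (Function.uncurry (chartConj G)) (x, oneCoord E G) := by
  refine contDiffAt_oneChart_comp (((contMDiffAt_symm_fst h1).mul
    (contMDiffAt_symm_snd oneCoord_mem_target)).mul (contMDiffAt_symm_fst h1).inv) ?_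
  simpa using one_mem_oneChart_source

theorem contDiffAt_chartDiv {x : E} (h1 : x ∈ (oneChart E G).target) :
    ContDiffAt ℝ ∞ (Function.uncurry (chartDiv G)) (x, x) := by
  refine contDiffAt_oneChart_comp (G := G)
    ((contMDiffAt_symm_snd (p := (x, x)) h1).mul (contMDiffAt_symm_fst (p := (x, x)) h1).inv) ?_
  simpa using one_mem_oneChart_source

/-- The adjoint action is the derivative of the conjugation in the preferred chart. -/
theorem Ad_eq_fderiv (g : G) :
    Ad g = fderiv ℝ (fun y => oneChart E G (g * (oneChart E G).symm y * g⁻¹)) (oneCoord E G) := by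
  have hd : MDifferentiableAt 𝓘(ℝ, E) 𝓘(ℝ, E) (fun h : G => g * h * g⁻¹) 1 :=
    (contMDiff_conj g).mdifferentiable (by simp) _
  have h := hd.hasMFDerivAt.2
  simp only [writtenInExtChartAt, mul_one, mul_inv_cancel, modelWithCornersSelf_coe, range_id] at h
  have h2 : HasFDerivWithinAt (fun y => oneChart E G (g * (oneChart E G).symm y * g⁻¹))
    (Ad g) univ (oneCoord E G) := h
  exact (hasFDerivWithinAt_univ.1 h2).fderiv.symm

theorem Ad_oneChart_symm (x : E) :
    Ad ((oneChart E G).symm x) = fderiv ℝ (chartConj G x) (oneCoord E G) :=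
  Ad_eq_fderiv _

/-- The adjoint action is smooth near the identity. -/
theorem contDiffAt_Ad_oneChart_symm {x : E} (hx : x ∈ (oneChart E G).target) :
    ContDiffAt ℝ ∞ (fun x => Ad (E := E) ((oneChart E G).symm x)) x := by
  simp only [Ad_oneChart_symm]
  exact ContDiffAt.fderiv (g := fun _ => oneCoord E G) (contDiffAt_chartConj hx)
    contDiffAt_const (by simp)

theorem Ad_one_eq : Ad (1 : G) = ContinuousLinearMap.id ℝ E := by
  ext x; exact Ad_one x

theorem contDiffAt_chartMul_one : ContDiffAt ℝ ∞ (chartMul G) (oneCoord E G, oneCoord E G) :=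
  contDiffAt_chartMul oneCoord_mem_target oneCoord_mem_target
    (by simpa using one_mem_oneChart_source)

/-- Left multiplication by `c⁻¹ x`, differentiated at the identity. -/
theorem hasFDerivAt_chartMul_right {x : E} (hx : x ∈ (oneChart E G).target) :
    HasFDerivAt (fun y => chartMul G (x, y))
      ((fderiv ℝ (chartMul G) (x, oneCoord E G)).comp (ContinuousLinearMap.inr ℝ E E))
      (oneCoord E G) := by
  have h1 : ContDiffAt ℝ ∞ (chartMul G) (x, oneCoord E G) :=
    contDiffAt_chartMul hx oneCoord_mem_target (by simpa using (oneChart E G).map_target hx)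
  exact (h1.differentiableAt (by simp)).hasFDerivAt.comp (oneCoord E G)
    ((hasFDerivAt_const x _).prodMk (hasFDerivAt_id _))

/-- Right multiplication by `c⁻¹ x`, differentiated at the identity. -/
theorem hasFDerivAt_chartMul_left {x : E} (hx : x ∈ (oneChart E G).target) :
    HasFDerivAt (fun y => chartMul G (y, x))
      ((fderiv ℝ (chartMul G) (oneCoord E G, x)).comp (ContinuousLinearMap.inl ℝ E E))
      (oneCoord E G) := by
  have h1 : ContDiffAt ℝ ∞ (chartMul G) (oneCoord E G, x) :=
    contDiffAt_chartMul oneCoord_mem_target hx (by simpa using (oneChart E G).map_target hx)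
  exact HasFDerivAt.comp (f := fun y : E => (y, x)) (oneCoord E G)
    (h1.differentiableAt (by simp)).hasFDerivAt
    ((hasFDerivAt_id _).prodMk (hasFDerivAt_const x _))

/-- The relation `g h = (g h g⁻¹) g`, differentiated in `h` at the identity. -/
theorem chartMul_right_eq_left_comp_Ad {x : E} (hx : x ∈ (oneChart E G).target) :
    (fderiv ℝ (chartMul G) (x, oneCoord E G)).comp (ContinuousLinearMap.inr ℝ E E) =
      ((fderiv ℝ (chartMul G) (oneCoord E G, x)).comp (ContinuousLinearMap.inl ℝ E E)).comp
        (Ad ((oneChart E G).symm x)) := by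
  have hk : chartConj G x (oneCoord E G) = oneCoord E G := by
    simp [chartConj, oneChart_one]
  have hc : ContDiffAt ℝ ∞ (chartConj G x) (oneCoord E G) :=
    (contDiffAt_chartConj hx).comp (oneCoord E G) (contDiffAt_const.prodMk contDiffAt_id)
  have h1 := (hc.differentiableAt (by simp)).hasFDerivAt
  have h2 := hasFDerivAt_chartMul_left (G := G) hx
  rw [← hk] at h2
  have h3 := h2.comp (oneCoord E G) h1
  rw [hk, ← Ad_oneChart_symm] at h3
  refine (hasFDerivAt_chartMul_right hx).unique (h3.congr_of_eventuallyEq ?_)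
  have hcont : ContinuousAt (fun y => (oneChart E G).symm x * (oneChart E G).symm y *
      ((oneChart E G).symm x)⁻¹) (oneCoord E G) :=
    ((contMDiffAt_const.mul (contMDiffAt_oneChart_symm oneCoord_mem_target)).mul
      contMDiffAt_const).continuousAt
  have hmem : (oneChart E G).source ∈ 𝓝 ((oneChart E G).symm x * (oneChart E G).symm (oneCoord E G) *
      ((oneChart E G).symm x)⁻¹) := by
    rw [oneChart_symm_oneCoord, mul_one, mul_inv_cancel]
    exact extChartAt_source_mem_nhds (I := 𝓘(ℝ, E)) (1 : G)
  filter_upwards [hcont hmem] with y hy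
  simp only [Function.comp_apply, chartMul, chartConj]
  rw [(oneChart E G).left_inv hy]
  simp

/-- The derivative at the identity of the adjoint action, in terms of the second derivative
of the multiplication. -/
theorem fderiv_Ad_oneChart_symm (v y : E) :
    fderiv ℝ (fun x => Ad (E := E) ((oneChart E G).symm x)) (oneCoord E G) v y =
      fderiv ℝ (fderiv ℝ (chartMul G)) (oneCoord E G, oneCoord E G) (v, 0) (0, y) -
      fderiv ℝ (fderiv ℝ (chartMul G)) (oneCoord E G, oneCoord E G) (y, 0) (0, v) := by
  set e := oneCoord E G with he
  have hm := contDiffAt_chartMul_one (E := E) (G := G)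
  have hF := ((hm.fderiv_right (m := 1) (by norm_cast)).differentiableAt (by simp)).hasFDerivAt
  have hsymm := hm.isSymmSndFDerivAt (by simpa using (by norm_cast : (2 : WithTop ℕ∞) ≤ ∞))
  set F' := fderiv ℝ (fderiv ℝ (chartMul G)) (e, e) with hF'
  have hA := ((contDiffAt_Ad_oneChart_symm (G := G) oneCoord_mem_target).differentiableAt
    (by simp)).hasFDerivAt (x := e)
  set A' := fderiv ℝ (fun x => Ad (E := E) ((oneChart E G).symm x)) e with hA'
  have hM : HasFDerivAt (fun x => (fderiv ℝ (chartMul G) (x, e)).comp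
      (ContinuousLinearMap.inr ℝ E E) y) ((ContinuousLinearMap.apply ℝ E ((0 : E), y)).comp
        (F'.comp (ContinuousLinearMap.inl ℝ E E))) e :=
    (ContinuousLinearMap.apply ℝ E ((0 : E), y)).hasFDerivAt.comp e
      (HasFDerivAt.comp (f := fun x : E => (x, e)) e hF
        ((hasFDerivAt_id e).prodMk (hasFDerivAt_const e e)))
  have hN : HasFDerivAt (fun x => (fderiv ℝ (chartMul G) (e, x)).comp
      (ContinuousLinearMap.inl ℝ E E))
      (((ContinuousLinearMap.compL ℝ E (E × E) E).flip (ContinuousLinearMap.inl ℝ E E)).comp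
        (F'.comp (ContinuousLinearMap.inr ℝ E E))) e :=
    ((ContinuousLinearMap.compL ℝ E (E × E) E).flip
      (ContinuousLinearMap.inl ℝ E E)).hasFDerivAt.comp e
      (HasFDerivAt.comp (f := fun x : E => (e, x)) e hF
        ((hasFDerivAt_const e e).prodMk (hasFDerivAt_id e)))
  have hNA := hN.clm_apply (hA.clm_apply (hasFDerivAt_const y e))
  -- The two sides of `chartMul_right_eq_left_comp_Ad` are differentiated at the identity.
  have hev : (fun x => (fderiv ℝ (chartMul G) (x, e)).comp (ContinuousLinearMap.inr ℝ E E) y) =ᶠ[𝓝 e]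
      fun x => (fderiv ℝ (chartMul G) (e, x)).comp (ContinuousLinearMap.inl ℝ E E)
        (Ad ((oneChart E G).symm x) y) := by
    filter_upwards [isOpen_oneChart_target.mem_nhds (oneCoord_mem_target (E := E) (G := G))] with x hx
    rw [chartMul_right_eq_left_comp_Ad hx]
    rfl
  have key := congrArg (fun L => L v) (hM.unique (hNA.congr_of_eventuallyEq hev))
  have hNe : (fderiv ℝ (chartMul G) (e, e)).comp (ContinuousLinearMap.inl ℝ E E) =
      ContinuousLinearMap.id ℝ E := by
    refine (hasFDerivAt_chartMul_left oneCoord_mem_target).unique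
      ((hasFDerivAt_id _).congr_of_eventuallyEq ?_)
    filter_upwards [isOpen_oneChart_target.mem_nhds (oneCoord_mem_target (E := E) (G := G))] with x hx
    simp only [chartMul, oneChart_symm_oneCoord, mul_one]
    exact (oneChart E G).right_inv hx
  rw [hNe] at key
  simp [he, Ad_one_eq] at key
  have h5 := hsymm (0, v) (y, 0)
  rw [← hF'] at h5
  rw [key, h5]
  simp

end Chart

/-! ### The Lie bracket as the derivative of the adjoint action -/

section AdBracket

variable {E : Type*} [NormedAddCommGroup E] [NormedSpace ℝ E]
  {G : Type*} [TopologicalSpace G] [ChartedSpace E G] [Group G] [LieGroup 𝓘(ℝ, E) ∞ G]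

/-- An invariant vector field in the preferred chart. -/
theorem mpullbackWithin_mulInvariantVectorField (v : E) {x : E} (hx : x ∈ (oneChart E G).target) :
    (show E from VectorField.mpullbackWithin 𝓘(ℝ, E) 𝓘(ℝ, E) (oneChart E G).symm
      (mulInvariantVectorField (I := 𝓘(ℝ, E)) (G := G) v) (range 𝓘(ℝ, E)) x) =
      fderiv ℝ (chartMul G) (x, oneCoord E G) (0, v) := by
  have : IsManifold 𝓘(ℝ, E) ∞ G := inferInstance
  have : IsManifold 𝓘(ℝ, E) 1 G := IsManifold.of_le (n := ∞) (by norm_cast)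
  set g := (oneChart E G).symm x with hg
  have hinv : (mfderivWithin 𝓘(ℝ, E) 𝓘(ℝ, E) (oneChart E G).symm (range 𝓘(ℝ, E)) x).inverse =
      mfderiv 𝓘(ℝ, E) 𝓘(ℝ, E) (oneChart E G) g :=
    ContinuousLinearMap.inverse_eq (mfderivWithin_extChartAt_symm_comp_mfderiv_extChartAt hx)
      (mfderiv_extChartAt_comp_mfderivWithin_extChartAt_symm hx)
  have hgs : g ∈ (oneChart E G).source := (oneChart E G).map_target hx
  have hL : MDifferentiableAt 𝓘(ℝ, E) 𝓘(ℝ, E) (fun h : G => g * h) 1 :=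
    (contMDiff_mul_left (n := ∞)).mdifferentiable (by simp) _
  have hC : MDifferentiableAt 𝓘(ℝ, E) 𝓘(ℝ, E) (oneChart E G) (g * 1) := by
    rw [mul_one]
    exact (contMDiffAt_oneChart hgs).mdifferentiableAt (by simp)
  have hcomp := hC.hasMFDerivAt.comp (1 : G) hL.hasMFDerivAt
  have h2 := hcomp.2
  simp only [writtenInExtChartAt, extChartAt_model_space_eq_id, PartialEquiv.refl_coe,
    modelWithCornersSelf_coe, range_id, Function.id_comp] at h2
  have h3 : HasFDerivWithinAt (fun y => chartMul G (x, y))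
    ((show E →L[ℝ] E from mfderiv 𝓘(ℝ, E) 𝓘(ℝ, E) (oneChart E G) (g * 1)).comp
      (show E →L[ℝ] E from mfderiv 𝓘(ℝ, E) 𝓘(ℝ, E) (fun h : G => g * h) 1)) univ
      (oneCoord E G) := h2
  have h4 := (hasFDerivWithinAt_univ.1 h3).unique (hasFDerivAt_chartMul_right hx)
  have h6 : ∀ g', g' = g → (show E →L[ℝ] E from mfderiv 𝓘(ℝ, E) 𝓘(ℝ, E) (oneChart E G) g') =
      (show E →L[ℝ] E from mfderiv 𝓘(ℝ, E) 𝓘(ℝ, E) (oneChart E G) g) := by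
    rintro _ rfl; rfl
  rw [h6 _ (mul_one g)] at h4
  have h5 := congrArg (fun L => L v) h4
  refine Eq.trans ?_ h5
  simp only [VectorField.mpullbackWithin]
  rw [hinv]
  rfl

/-- The Lie bracket, which is defined by left-invariant vector fields, in terms of the second
derivative of the multiplication in the preferred chart. -/
theorem bracket_eq_fderiv (v w : E) :
    bracket G v w = fderiv ℝ (fderiv ℝ (chartMul G)) (oneCoord E G, oneCoord E G) (v, 0) (0, w) -
      fderiv ℝ (fderiv ℝ (chartMul G)) (oneCoord E G, oneCoord E G) (w, 0) (0, v) := by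
  have : IsManifold 𝓘(ℝ, E) ∞ G := inferInstance
  have : IsManifold 𝓘(ℝ, E) 1 G := IsManifold.of_le (n := ∞) (by norm_cast)
  set e := oneCoord E G with he
  have hm := contDiffAt_chartMul_one (E := E) (G := G)
  have hF := ((hm.fderiv_right (m := 1) (by norm_cast)).differentiableAt (by simp)).hasFDerivAt
  have hd : ∀ v : E, HasFDerivAt (fun x => fderiv ℝ (chartMul G) (x, e) (0, v))
      ((ContinuousLinearMap.apply ℝ E ((0 : E), v)).comp
        ((fderiv ℝ (fderiv ℝ (chartMul G)) (e, e)).comp (ContinuousLinearMap.inl ℝ E E))) e :=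
    fun v => (ContinuousLinearMap.apply ℝ E ((0 : E), v)).hasFDerivAt.comp e
      (HasFDerivAt.comp (f := fun x : E => (x, e)) e hF
        ((hasFDerivAt_id e).prodMk (hasFDerivAt_const e e)))
  have hM : ∀ v : E, fderiv ℝ (chartMul G) (e, e) (0, v) = v := fun v => by
    have h1 : HasFDerivAt (fun y => chartMul G (e, y)) (ContinuousLinearMap.id ℝ E) e := by
      refine (hasFDerivAt_id _).congr_of_eventuallyEq ?_
      filter_upwards [isOpen_oneChart_target.mem_nhds (oneCoord_mem_target (E := E) (G := G))]
        with x hx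
      simp only [chartMul, he, oneChart_symm_oneCoord, one_mul]
      exact (oneChart E G).right_inv hx
    exact congrArg (fun L => L v) ((hasFDerivAt_chartMul_right oneCoord_mem_target).unique h1)
  have hV : ∀ v : E, (fun x => (show E from VectorField.mpullbackWithin 𝓘(ℝ, E) 𝓘(ℝ, E)
      (oneChart E G).symm (mulInvariantVectorField (I := 𝓘(ℝ, E)) (G := G) v)
      (range 𝓘(ℝ, E)) x)) =ᶠ[𝓝 e] fun x => fderiv ℝ (chartMul G) (x, e) (0, v) := fun v => by
    filter_upwards [isOpen_oneChart_target.mem_nhds (oneCoord_mem_target (E := E) (G := G))]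
      with x hx
    exact mpullbackWithin_mulInvariantVectorField v hx
  have h2 : ∀ z : E, (mfderiv 𝓘(ℝ, E) 𝓘(ℝ, E) (extChartAt 𝓘(ℝ, E) (1 : G)) 1).inverse z = z := by
    intro z
    rw [mfderiv_extChartAt_self]
    exact congrArg (fun L : E →L[ℝ] E => L z) ContinuousLinearMap.inverse_id
  refine Eq.trans (h2 (VectorField.lieBracketWithin ℝ
      (fun x => (show E from VectorField.mpullbackWithin 𝓘(ℝ, E) 𝓘(ℝ, E)
      (oneChart E G).symm (mulInvariantVectorField (I := 𝓘(ℝ, E)) (G := G) v)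
      (range 𝓘(ℝ, E)) x)) (fun x => (show E from VectorField.mpullbackWithin 𝓘(ℝ, E) 𝓘(ℝ, E)
      (oneChart E G).symm (mulInvariantVectorField (I := 𝓘(ℝ, E)) (G := G) w)
      (range 𝓘(ℝ, E)) x)) ((oneChart E G).symm ⁻¹' univ ∩ range 𝓘(ℝ, E)) e)) ?_
  have h1 : ((oneChart E G).symm ⁻¹' univ ∩ range 𝓘(ℝ, E)) = (univ : Set E) := by simp
  have key : ∀ (V W : E → E) (s : Set E), s = univ →
      V =ᶠ[𝓝 e] (fun x => fderiv ℝ (chartMul G) (x, e) (0, v)) →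
      W =ᶠ[𝓝 e] (fun x => fderiv ℝ (chartMul G) (x, e) (0, w)) →
      VectorField.lieBracketWithin ℝ V W s e =
        fderiv ℝ (fderiv ℝ (chartMul G)) (e, e) (v, 0) (0, w) -
          fderiv ℝ (fderiv ℝ (chartMul G)) (e, e) (w, 0) (0, v) := by
    rintro V W _ rfl hV hW
    simp only [VectorField.lieBracketWithin, fderivWithin_univ]
    rw [hV.fderiv_eq, hW.fderiv_eq, hV.eq_of_nhds, hW.eq_of_nhds, hM, hM, (hd v).fderiv,
      (hd w).fderiv]
    rfl
  exact key _ _ _ h1 (hV v) (hV w)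

variable (E G) in
/-- The bracket of the Lie algebra of `G` as a continuous bilinear map: the derivative at the
identity of the adjoint action. -/
def bracketL : E →L[ℝ] E →L[ℝ] E :=
  fderiv ℝ (fun x => Ad (E := E) ((oneChart E G).symm x)) (oneCoord E G)

/-- Both sides are the antisymmetrized second derivative of the multiplication at the identity. -/
theorem bracketL_apply (v w : E) : bracketL E G v w = bracket G v w := by
  rw [bracketL, fderiv_Ad_oneChart_symm, bracket_eq_fderiv]

theorem bracketL_swap (v w : E) : bracketL E G v w = - bracketL E G w v := by
  simp only [bracketL_apply, bracket_eq_fderiv, neg_sub]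

/-- `u` has right logarithmic derivative `v` within `s` at `t`, expressed in the preferred chart
at the identity. -/
structure HasRlogWithinAt (u : ℝ → G) (v : E) (s : Set ℝ) (t : ℝ) : Prop where
  continuousWithinAt : ContinuousWithinAt u s t
  hasDerivWithinAt : HasDerivWithinAt (fun r => oneChart E G (u r * (u t)⁻¹)) v s t

theorem HasRlogWithinAt.mdifferentiableWithinAt {u : ℝ → G} {v : E} {s : Set ℝ} {t : ℝ}
    (h : HasRlogWithinAt u v s t) :
    MDifferentiableWithinAt 𝓘(ℝ, ℝ) 𝓘(ℝ, E) (fun r => u r * (u t)⁻¹) s t := by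
  have : ContinuousMul G := continuousMul_of_contMDiffMul 𝓘(ℝ, E) ∞
  rw [mdifferentiableWithinAt_iff]
  refine ⟨h.1.mul continuousWithinAt_const, ?_⟩
  simp only [extChartAt_model_space_eq_id, PartialEquiv.refl_coe,
    PartialEquiv.refl_symm, id_eq, Function.comp_id, preimage_id_eq, modelWithCornersSelf_coe,
    range_id, inter_univ, mul_inv_cancel]
  exact h.2.differentiableWithinAt

/-- The logarithmic derivative in the sense of manifolds is the one computed in the preferred
chart. -/
theorem rlogDeriv_eq {u : unitInterval → G} {v : E} {t : unitInterval}
    (h : HasRlogWithinAt (IccExtend zero_le_one u) v (Icc (0 : ℝ) 1) t) : rlogDeriv u t = v := by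
  have h1 := h.mdifferentiableWithinAt
  have e : IccExtend (zero_le_one' ℝ) u t = u t := iccExtend_coe u t
  have h2 := mfderivWithin_eq_derivWithin (by simp) h1
  have h3 := (C1.uniqueDiffWithinAt t).eq_deriv _ h2.hasDerivWithinAt h.2
  rw [← h3]
  unfold rlogDeriv
  rw [e]
  rfl

theorem hasRlogWithinAt_of_mdifferentiableWithinAt {u : unitInterval → G} {t : unitInterval}
    (h : MDifferentiableWithinAt 𝓘(ℝ, ℝ) 𝓘(ℝ, E)
      (fun s : ℝ => IccExtend zero_le_one u s * (u t)⁻¹) (Icc (0 : ℝ) 1) t) :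
    HasRlogWithinAt (E := E) (IccExtend zero_le_one u) (rlogDeriv u t) (Icc (0 : ℝ) 1) t := by
  have : ContinuousMul G := continuousMul_of_contMDiffMul 𝓘(ℝ, E) ∞
  have e : IccExtend (zero_le_one' ℝ) u t = u t := iccExtend_coe u t
  refine ⟨?_, ?_⟩
  · have := h.continuousWithinAt.mul (continuousWithinAt_const (b := u t))
    exact this.congr (fun r _ => by simp) (by simp)
  · rw [e]
    exact (mfderivWithin_eq_derivWithin (by rw [e]; simp) h).hasDerivWithinAt

theorem IsC2.hasRlogWithinAt {u : unitInterval → G} (hu : IsC2 (E := E) u) (t : unitInterval) :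
    HasRlogWithinAt (E := E) (IccExtend zero_le_one u) (rlogDeriv u t) (Icc (0 : ℝ) 1) t :=
  hasRlogWithinAt_of_mdifferentiableWithinAt (hu.mdifferentiableWithinAt t _)

/-- The derivative of the adjoint action along a curve. -/
theorem HasRlogWithinAt.hasDerivWithinAt_Ad {u : ℝ → G} {v : E} {s : Set ℝ} {t : ℝ}
    (h : HasRlogWithinAt u v s t) :
    HasDerivWithinAt (fun r => Ad (E := E) (u r)) ((bracketL E G v).comp (Ad (u t))) s t := by
  have : ContinuousMul G := continuousMul_of_contMDiffMul 𝓘(ℝ, E) ∞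
  have hA := ((contDiffAt_Ad_oneChart_symm (G := G) oneCoord_mem_target).differentiableAt
    (by simp)).hasFDerivAt (x := oneCoord E G)
  have hcont : ContinuousWithinAt (fun r => u r * (u t)⁻¹) s t :=
    h.1.mul continuousWithinAt_const
  have e1 : oneChart E G (u t * (u t)⁻¹) = oneCoord E G := by rw [mul_inv_cancel]; rfl
  rw [← e1] at hA
  have h1 := hA.comp_hasDerivWithinAt t h.2
  rw [e1] at h1
  have h2 : HasDerivWithinAt (fun r => Ad (E := E) (u r * (u t)⁻¹)) (bracketL E G v) s t := by
    refine h1.congr_of_eventuallyEq ?_ ?_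
    · have : (oneChart E G).source ∈ 𝓝 (u t * (u t)⁻¹) := by
        rw [mul_inv_cancel]
        exact extChartAt_source_mem_nhds (I := 𝓘(ℝ, E)) (1 : G)
      filter_upwards [hcont this] with r hr
      simp only [Function.comp_apply]
      rw [(oneChart E G).left_inv hr]
    · simp only [Function.comp_apply, mul_inv_cancel, oneChart_one, oneChart_symm_oneCoord]
  have h3 : ∀ r, Ad (E := E) (u r) = (Ad (u r * (u t)⁻¹)).comp (Ad (u t)) := fun r => by
    ext y
    rw [ContinuousLinearMap.comp_apply, ← Ad_mul]
    simp
  have h4 := (((ContinuousLinearMap.compL ℝ E E E).flip (Ad (u t))).hasFDerivAt).comp_hasDerivWithinAt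
    t h2
  exact h4.congr (fun r _ => h3 r) (h3 t)

/-- The coordinate line through the identity with velocity `v`. -/
theorem hasRlogWithinAt_line (v : E) :
    HasRlogWithinAt (G := G) (fun r : ℝ => (oneChart E G).symm (oneCoord E G + r • v)) v univ 0 := by
  have hc : ContinuousAt (fun r : ℝ => oneCoord E G + r • v) 0 := by fun_prop
  have hl : HasDerivAt (fun r : ℝ => oneCoord E G + r • v) v 0 := by
    simpa using ((hasDerivAt_id (0 : ℝ)).smul_const v).const_add (oneCoord E G)
  refine ⟨?_, ?_⟩
  · refine ContinuousAt.continuousWithinAt ?_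
    refine ContinuousAt.comp (g := (oneChart E G).symm) ?_ hc
    simpa using (contMDiffAt_oneChart_symm oneCoord_mem_target).continuousAt
  · refine HasDerivAt.hasDerivWithinAt (hl.congr_of_eventuallyEq ?_)
    have : (oneChart E G).target ∈ 𝓝 (oneCoord E G + (0 : ℝ) • v) := by
      simpa using isOpen_oneChart_target.mem_nhds (oneCoord_mem_target (E := E) (G := G))
    filter_upwards [hc this] with r hr
    simp only [zero_smul, add_zero, oneChart_symm_oneCoord, inv_one, mul_one]
    exact (oneChart E G).right_inv hr

/-- Conjugation by `g` acts on logarithmic derivatives through `Ad g`. -/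
theorem HasRlogWithinAt.conj {u : ℝ → G} {v : E} {s : Set ℝ} {t : ℝ}
    (h : HasRlogWithinAt u v s t) (g : G) :
    HasRlogWithinAt (fun r => g * u r * g⁻¹) (Ad g v) s t := by
  have : ContinuousMul G := continuousMul_of_contMDiffMul 𝓘(ℝ, E) ∞
  have hcont : ContinuousWithinAt (fun r => u r * (u t)⁻¹) s t :=
    h.1.mul continuousWithinAt_const
  refine ⟨(continuousWithinAt_const.mul h.1).mul continuousWithinAt_const, ?_⟩
  have hd : ContDiffAt ℝ ∞ (fun y => oneChart E G (g * (oneChart E G).symm y * g⁻¹))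
      (oneCoord E G) := by
    refine contDiffAt_oneChart_comp ((contMDiffAt_const.mul
      (contMDiffAt_oneChart_symm oneCoord_mem_target)).mul contMDiffAt_const) ?_
    simpa using one_mem_oneChart_source
  have hA := (hd.differentiableAt (by simp)).hasFDerivAt
  rw [← Ad_eq_fderiv] at hA
  have e1 : oneChart E G (u t * (u t)⁻¹) = oneCoord E G := by rw [mul_inv_cancel]; rfl
  rw [← e1] at hA
  refine (hA.comp_hasDerivWithinAt t h.2).congr_of_eventuallyEq ?_ ?_
  · have : (oneChart E G).source ∈ 𝓝 (u t * (u t)⁻¹) := by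
      rw [mul_inv_cancel]
      exact extChartAt_source_mem_nhds (I := 𝓘(ℝ, E)) (1 : G)
    filter_upwards [hcont this] with r hr
    simp only [Function.comp_apply]
    rw [(oneChart E G).left_inv hr]
    group
  · simp [oneChart_one]

/-- The adjoint action is by Lie algebra automorphisms. -/
theorem Ad_bracketL (g : G) (v w : E) :
    Ad g (bracketL E G v w) = bracketL E G (Ad g v) (Ad g w) := by
  have h := hasRlogWithinAt_line (G := G) v
  have h1 := h.hasDerivWithinAt_Ad.clm_apply (hasDerivWithinAt_const (0 : ℝ) univ w)
  have h2 := (h.conj g).hasDerivWithinAt_Ad.clm_apply (hasDerivWithinAt_const (0 : ℝ) univ (Ad g w))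
  have h3 := (Ad (E := E) g).hasFDerivAt.comp_hasDerivWithinAt (0 : ℝ) h1
  have h4 := (uniqueDiffOn_univ (0 : ℝ) (mem_univ _)).eq_deriv _ h2 (h3.congr_of_mem (fun r _ => by
    simp [← Ad_mul]) (mem_univ _))
  simpa [Ad_one_eq] using h4.symm

end AdBracket

/-! ### Invariant inner products -/

section AdInvariant

variable {E : Type*} [NormedAddCommGroup E] [NormedSpace ℝ E]
  {G : Type*} [TopologicalSpace G] [ChartedSpace E G] [Group G] [LieGroup 𝓘(ℝ, E) ∞ G]

variable (E G) in
/-- The adjoint action is continuous: it is so near the identity, and multiplicative. -/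
theorem continuous_Ad : Continuous (fun g : G => Ad (E := E) g) := by
  have : ContinuousMul G := continuousMul_of_contMDiffMul 𝓘(ℝ, E) ∞
  rw [continuous_iff_continuousAt]
  intro g
  have h1 : ContinuousAt (fun h : G => Ad (E := E) h) 1 := by
    have h2 : ContinuousAt (fun h : G => Ad (E := E) ((oneChart E G).symm (oneChart E G h))) 1 :=
      ContinuousAt.comp (f := oneChart E G) (x := (1 : G))
        (g := fun x => Ad (E := E) ((oneChart E G).symm x))
        (contDiffAt_Ad_oneChart_symm (oneCoord_mem_target (G := G))).continuousAt
        (contMDiffAt_oneChart one_mem_oneChart_source).continuousAt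
    refine h2.congr ?_
    filter_upwards [extChartAt_source_mem_nhds (I := 𝓘(ℝ, E)) (1 : G)] with h hh
    rw [(oneChart E G).left_inv hh]
  have h3 : (fun h : G => Ad (E := E) h) = fun h => (Ad (h * g⁻¹)).comp (Ad g) := by
    ext h y
    rw [ContinuousLinearMap.comp_apply, ← Ad_mul]
    simp
  rw [h3]
  have h4 : ContinuousAt (fun h : G => h * g⁻¹) g := by fun_prop
  have h5 : ContinuousAt (fun h : G => Ad (E := E) (h * g⁻¹)) g := by
    refine ContinuousAt.comp (g := fun h : G => Ad (E := E) h) ?_ h4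
    simpa using h1
  exact h5.clm_comp continuousAt_const

variable (E G) in
theorem exists_norm_Ad_le [CompactSpace G] : ∃ C : ℝ, 0 < C ∧ ∀ g : G, ‖Ad (E := E) g‖ ≤ C := by
  obtain ⟨C, hC⟩ := (isCompact_univ (X := G)).exists_bound_of_continuousOn
    (continuous_Ad E G).continuousOn
  exact ⟨max C 1, by positivity, fun g => (hC g (mem_univ g)).trans (le_max_left _ _)⟩

variable (E G) in
/-- Averaging over the compact group `G` gives an inner product on the Lie algebra which is
invariant under the adjoint action. -/
theorem exists_Ad_invariant_inner [FiniteDimensional ℝ E] [CompactSpace G] :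
    ∃ B : E →L[ℝ] E →L[ℝ] ℝ, (∀ x y, B x y = B y x) ∧ (∃ c > 0, ∀ x, c * ‖x‖ ^ 2 ≤ B x x) ∧
      ∀ (g : G) x y, B (Ad g x) (Ad g y) = B x y := by
  have : CompleteSpace E := FiniteDimensional.complete ℝ E
  have : IsTopologicalGroup G := topologicalGroup_of_lieGroup 𝓘(ℝ, E) ∞
  let _ : MeasurableSpace G := borel G
  have : BorelSpace G := ⟨rfl⟩
  let μ : MeasureTheory.Measure G := MeasureTheory.Measure.haar
  let b : E →L[ℝ] E →L[ℝ] ℝ :=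
    ((ContinuousLinearMap.compL ℝ E _ ℝ).flip (toEuclidean (E := E)).toContinuousLinearMap).comp
      ((innerSL ℝ).comp (toEuclidean (E := E)).toContinuousLinearMap)
  have hb : ∀ x y, b x y = inner ℝ (toEuclidean x) (toEuclidean y) := fun x y => rfl
  let β : G → E → E → ℝ := fun g x y => b (Ad g⁻¹ x) (Ad g⁻¹ y)
  have hβ : ∀ g x y, β g x y = b (Ad g⁻¹ x) (Ad g⁻¹ y) := fun g x y => rfl
  have hA : Continuous fun g : G => Ad (E := E) g⁻¹ := (continuous_Ad E G).comp continuous_inv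
  have hs : ∀ x y, MeasureTheory.Integrable (fun g => β g x y) μ := fun x y => by
    have hc : Continuous fun g => β g x y :=
      (b.continuous.comp (hA.clm_apply continuous_const)).clm_apply (hA.clm_apply continuous_const)
    exact hc.integrable_of_hasCompactSupport (HasCompactSupport.of_compactSpace _)
  let B₀ : E →ₗ[ℝ] E →ₗ[ℝ] ℝ := LinearMap.mk₂ ℝ (fun x y => ∫ g, β g x y ∂μ)
    (fun x x' y => by
      rw [← MeasureTheory.integral_add (hs x y) (hs x' y)]
      simp [hβ])
    (fun c x y => by
      rw [smul_eq_mul, ← MeasureTheory.integral_const_mul]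
      simp [hβ])
    (fun x y y' => by
      rw [← MeasureTheory.integral_add (hs x y) (hs x y')]
      simp [hβ])
    (fun c x y => by
      rw [smul_eq_mul, ← MeasureTheory.integral_const_mul]
      simp [hβ])
  let B : E →L[ℝ] E →L[ℝ] ℝ := LinearMap.toContinuousLinearMap
    ((LinearMap.toContinuousLinearMap (𝕜 := ℝ) (E := E) (F' := ℝ)).toLinearMap.comp B₀)
  have hB : ∀ x y, B x y = ∫ g, β g x y ∂μ := fun x y => rfl
  refine ⟨B, fun x y => ?_, ?_, fun h x y => ?_⟩
  · simp only [hB, hβ, hb, real_inner_comm]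
  · obtain ⟨C, hC, hCA⟩ := exists_norm_Ad_le E G
    set K := ‖(toEuclidean (E := E)).symm.toContinuousLinearMap‖ + 1 with hK
    have hK0 : 0 < K := by positivity
    have hle : ∀ z : E, ‖z‖ ≤ K * ‖toEuclidean z‖ := fun z => by
      have := (toEuclidean (E := E)).symm.toContinuousLinearMap.le_opNorm (toEuclidean z)
      simp only [ContinuousLinearEquiv.coe_coe, ContinuousLinearEquiv.symm_apply_apply] at this
      refine this.trans ?_
      gcongr
      simp [hK]
    have hμ : 0 < μ.real univ := by
      rw [MeasureTheory.measureReal_def]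
      exact ENNReal.toReal_pos (NeZero.ne _) (MeasureTheory.measure_ne_top _ _)
    refine ⟨μ.real univ * (1 / (C * K) ^ 2), by positivity, fun x => ?_⟩
    rw [hB]
    have h1 : ∫ _ : G, (1 / (C * K) ^ 2 * ‖x‖ ^ 2) ∂μ ≤ ∫ g, β g x x ∂μ := by
      refine MeasureTheory.integral_mono (MeasureTheory.integrable_const _) (hs x x) fun g => ?_
      have h2 : ‖x‖ ≤ (C * K) * ‖toEuclidean (Ad g⁻¹ x)‖ := by
        have h3 : x = Ad g (Ad g⁻¹ x) := by rw [← Ad_mul]; simp [Ad_one]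
        calc ‖x‖ = ‖Ad g (Ad g⁻¹ x)‖ := by rw [← h3]
          _ ≤ ‖Ad (E := E) g‖ * ‖Ad g⁻¹ x‖ := (Ad g).le_opNorm _
          _ ≤ C * (K * ‖toEuclidean (Ad g⁻¹ x)‖) := by
            gcongr
            · exact hCA g
            · exact hle _
          _ = _ := by ring
      simp only [hβ, hb, real_inner_self_eq_norm_sq]
      rw [one_div, inv_mul_le_iff₀ (by positivity), ← mul_pow]
      gcongr
    rw [MeasureTheory.integral_const, smul_eq_mul] at h1
    linarith
  · simp only [hB, hβ]
    rw [← MeasureTheory.integral_mul_left_eq_self (fun g => b (Ad g⁻¹ x) (Ad g⁻¹ y)) h⁻¹]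
    simp only [← Ad_mul, mul_inv_rev, inv_inv]

/-- Infinitesimal invariance of an invariant bilinear form. -/
theorem inner_bracketL {B : E →L[ℝ] E →L[ℝ] ℝ} (hB : ∀ (g : G) x y, B (Ad g x) (Ad g y) = B x y)
    (v x y : E) : B (bracketL E G v x) y + B x (bracketL E G v y) = 0 := by
  have h := (hasRlogWithinAt_line (G := G) v).hasDerivWithinAt_Ad
  have hx := h.clm_apply (hasDerivWithinAt_const (0 : ℝ) univ x)
  have hy := h.clm_apply (hasDerivWithinAt_const (0 : ℝ) univ y)
  have h1 := (B.hasFDerivAt.comp_hasDerivWithinAt (0 : ℝ) hx).clm_apply hy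
  have h2 := (uniqueDiffOn_univ (0 : ℝ) (mem_univ _)).eq_deriv _ h1
    ((hasDerivWithinAt_const (0 : ℝ) univ (B x y)).congr (fun r _ => hB _ _ _) (hB _ _ _))
  simpa [Ad_one_eq] using h2

end AdInvariant

/-! ### Curves in `G` and their logarithmic derivatives -/

section Frames

variable {E : Type*} [NormedAddCommGroup E] [NormedSpace ℝ E]
  {G : Type*} [TopologicalSpace G] [ChartedSpace E G] [Group G] [LieGroup 𝓘(ℝ, E) ∞ G]

theorem IsC2.mul {u v : unitInterval → G} (hu : IsC2 (E := E) u) (hv : IsC2 (E := E) v) :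
    IsC2 (E := E) (u * v) := (gaugeGroup E G).mul_mem hu hv

theorem IsC2.inv {u : unitInterval → G} (hu : IsC2 (E := E) u) : IsC2 (E := E) u⁻¹ :=
  (gaugeGroup E G).inv_mem hu

omit [LieGroup 𝓘(ℝ, E) ∞ G] in
theorem IsC2.continuous {u : unitInterval → G} (hu : IsC2 (E := E) u) : Continuous u := by
  have h : ContinuousOn (IccExtend (zero_le_one' ℝ) u) (Icc 0 1) := fun r hr =>
    (hu r hr).continuousWithinAt
  exact (continuousOn_iff_continuous_domRestrict.1 h).congr fun t => iccExtend_coe u t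

theorem Ad_inv_Ad (g : G) (x : E) : Ad g⁻¹ (Ad g x) = x := by rw [← Ad_mul]; simp [Ad_one]

theorem Ad_Ad_inv (g : G) (x : E) : Ad g (Ad g⁻¹ x) = x := by rw [← Ad_mul]; simp [Ad_one]

theorem rlogDeriv_inv {u : unitInterval → G} (hu : IsC2 (E := E) u) (t : unitInterval) :
    rlogDeriv (E := E) u⁻¹ t = - Ad (u t)⁻¹ (rlogDeriv u t) := by
  have h := rlogDeriv_mul (E := E) hu.inv hu t
  rw [inv_mul_cancel, rlogDeriv_one] at h
  exact eq_neg_of_add_eq_zero_left h.symm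

/-- A curve with vanishing logarithmic derivative is constant. -/
theorem eq_of_rlogDeriv_eq_zero [CompleteSpace E] [T2Space G] {w : unitInterval → G}
    (hw : IsC2 (E := E) w) (h0 : ∀ t, rlogDeriv (E := E) w t = 0) (t : unitInterval) :
    w t = w 0 := by
  have : IsManifold 𝓘(ℝ, E) ∞ G := inferInstance
  have : IsManifold 𝓘(ℝ, E) 1 G := IsManifold.of_le (n := ∞) (by norm_cast)
  have : ContinuousMul G := continuousMul_of_contMDiffMul 𝓘(ℝ, E) ∞
  -- On `(0,1)` both `w` and a constant curve are integral curves of the zero vector field.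
  have hsm : ContMDiff 𝓘(ℝ, E) (𝓘(ℝ, E).prod 𝓘(ℝ, E)) 1
      (fun x : G => (⟨x, 0⟩ : TangentBundle 𝓘(ℝ, E) G)) :=
    Bundle.contMDiff_zeroSection (IB := 𝓘(ℝ, E)) ℝ (TangentSpace 𝓘(ℝ, E) (M := G))
  have hder : IsMIntegralCurveOn (I := 𝓘(ℝ, E)) (IccExtend (zero_le_one' ℝ) w)
      (fun x : G => (0 : TangentSpace 𝓘(ℝ, E) x)) (Ioo 0 1) := by
    intro r hr
    let r' : unitInterval := ⟨r, hr.1.le, hr.2.le⟩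
    have hd : MDifferentiableWithinAt 𝓘(ℝ, ℝ) 𝓘(ℝ, E) (IccExtend (zero_le_one' ℝ) w) (Icc 0 1) r :=
      (hw r r'.2).mdifferentiableWithinAt (by simp)
    have h1 : HasMFDerivWithinAt 𝓘(ℝ, ℝ) 𝓘(ℝ, E) (fun s => IccExtend (zero_le_one' ℝ) w s * (w r')⁻¹)
        (Icc 0 1) r 0 := by
      have h2 := (hw.mdifferentiableWithinAt r' (w r')⁻¹).hasMFDerivWithinAt
      convert h2 using 1
      refine (ContinuousLinearMap.ext_ring ?_).symm
      exact h0 r'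
    have hR : MDifferentiableAt 𝓘(ℝ, E) 𝓘(ℝ, E) (fun h : G => h * w r')
        (IccExtend (zero_le_one' ℝ) w r * (w r')⁻¹) :=
      (contMDiff_mul_right (n := ∞)).mdifferentiable (by simp) _
    have h3 := (hR.hasMFDerivAt.comp_hasMFDerivWithinAt r h1).mono Ioo_subset_Icc_self
    have e : (fun h : G => h * w r') ∘ (fun s => IccExtend (zero_le_one' ℝ) w s * (w r')⁻¹) =
        IccExtend (zero_le_one' ℝ) w := by
      ext s; simp
    rw [e] at h3
    refine h3.congr_mfderiv (ContinuousLinearMap.ext_ring ?_)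
    refine Eq.trans ?_ (one_smul ℝ (0 : E)).symm
    exact (map_zero (mfderiv 𝓘(ℝ, E) 𝓘(ℝ, E) (fun h : G => h * w r')
      (IccExtend (zero_le_one' ℝ) w r * (w r')⁻¹)))
  have hconst : IsMIntegralCurveOn (I := 𝓘(ℝ, E))
      (fun _ : ℝ => IccExtend (zero_le_one' ℝ) w (1 / 2))
      (fun x : G => (0 : TangentSpace 𝓘(ℝ, E) x)) (Ioo 0 1) := by
    intro r _
    refine (hasMFDerivWithinAt_const (I := 𝓘(ℝ, ℝ)) (I' := 𝓘(ℝ, E))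
      (IccExtend (zero_le_one' ℝ) w (1 / 2)) (s := Ioo (0 : ℝ) 1) (x := r)).congr_mfderiv
      (ContinuousLinearMap.ext_ring ?_)
    exact (one_smul ℝ (0 : E)).symm
  have heq := isMIntegralCurveOn_Ioo_eqOn_of_contMDiff_boundaryless (t₀ := 1 / 2)
    (by norm_num) hsm hder hconst rfl
  have hcw : ContinuousOn (IccExtend (zero_le_one' ℝ) w) (Icc 0 1) := fun r hr =>
    (hw r hr).continuousWithinAt
  have heq' : EqOn (IccExtend (zero_le_one' ℝ) w) (fun _ => IccExtend (zero_le_one' ℝ) w (1 / 2))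
      (Icc 0 1) :=
    heq.of_subset_closure hcw continuousOn_const Ioo_subset_Icc_self
      (closure_Ioo (zero_ne_one' ℝ)).ge
  have h1 := heq' t.2
  have h2 := heq' (left_mem_Icc.2 (zero_le_one' ℝ))
  rw [iccExtend_coe] at h1
  have h3 : IccExtend (zero_le_one' ℝ) w 0 = w 0 := iccExtend_coe w 0
  rw [h1, ← h3, h2]

/-- Two curves with the same logarithmic derivative and the same origin agree. -/
theorem eq_of_rlogDeriv_eq [CompleteSpace E] [T2Space G] {u v : unitInterval → G}
    (hu : IsC2 (E := E) u) (hv : IsC2 (E := E) v) (h0 : u 0 = v 0)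
    (h : ∀ t, rlogDeriv (E := E) u t = rlogDeriv v t) : u = v := by
  have hw : ∀ t, rlogDeriv (E := E) (u⁻¹ * v) t = 0 := fun t => by
    rw [rlogDeriv_mul hu.inv hv, rlogDeriv_inv hu, h t, Pi.inv_apply, neg_add_cancel]
  ext t
  have := eq_of_rlogDeriv_eq_zero (hu.inv.mul hv) hw t
  simp only [Pi.mul_apply, Pi.inv_apply, h0, inv_mul_cancel] at this
  exact inv_mul_eq_one.1 this

/-- `u` is a frame for `X`: it solves `u̇ u⁻¹ = -X` with `u(0) = 1`. -/
structure IsFrame (X : C1 E) (u : unitInterval → G) : Prop where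
  isC2 : IsC2 (E := E) u
  map_zero : u 0 = 1
  eq_neg : ∀ t, X t = - rlogDeriv u t

omit [LieGroup 𝓘(ℝ, E) ∞ G] in
theorem IsFrame.rlogDeriv_eq {X : C1 E} {u : unitInterval → G} (h : IsFrame X u)
    (t : unitInterval) : rlogDeriv (E := E) u t = - X t := by rw [h.eq_neg, neg_neg]

omit [LieGroup 𝓘(ℝ, E) ∞ G] in
theorem IsFrame.continuous_rlogDeriv {X : C1 E} {u : unitInterval → G} (h : IsFrame X u) :
    Continuous (rlogDeriv (E := E) u) := by
  rw [funext h.rlogDeriv_eq]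
  exact X.continuous.neg

theorem IsFrame.unique [CompleteSpace E] [T2Space G] {X : C1 E} {u v : unitInterval → G}
    (hu : IsFrame X u) (hv : IsFrame X v) : u = v :=
  eq_of_rlogDeriv_eq hu.isC2 hv.isC2 (hu.map_zero.trans hv.map_zero.symm) fun t => by
    rw [hu.rlogDeriv_eq, hv.rlogDeriv_eq]

/-- The derivative of `Ad(u) f`. -/
theorem hasDerivWithinAt_Ad_apply {u : unitInterval → G} (hu : IsC2 (E := E) u) (f : C1 E)
    (t : unitInterval) :
    HasDerivWithinAt (fun r => Ad (IccExtend zero_le_one u r) (IccExtend zero_le_one f r))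
      (bracketL E G (rlogDeriv u t) (Ad (u t) (f t)) + Ad (u t) (f.der t)) (Icc (0 : ℝ) 1) t := by
  have h := (hu.hasRlogWithinAt t).hasDerivWithinAt_Ad.clm_apply (f.hasDerivWithinAt t)
  simpa [iccExtend_coe] using h

/-- `Ad(u) f` is again `C¹`. -/
theorem exists_Ad_apply {u : unitInterval → G} (hu : IsC2 (E := E) u)
    (hr : Continuous (rlogDeriv (E := E) u)) (f : C1 E) :
    ∃ F : C1 E, ∀ t, F t = Ad (u t) (f t) := by
  have hA : Continuous fun t => Ad (E := E) (u t) := (continuous_Ad E G).comp hu.continuous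
  have hc : Continuous fun t => bracketL E G (rlogDeriv u t) (Ad (u t) (f t)) +
      Ad (u t) (f.der t) :=
    (((bracketL E G).continuous.comp hr).clm_apply (hA.clm_apply f.continuous)).add
      (hA.clm_apply f.continuous_der)
  obtain ⟨F, hF, -⟩ := C1.exists_of_hasDerivWithinAt
    (f := fun r => Ad (IccExtend zero_le_one u r) (IccExtend zero_le_one f r))
    (f' := IccExtend (zero_le_one' ℝ) fun t => bracketL E G (rlogDeriv u t) (Ad (u t) (f t)) +
      Ad (u t) (f.der t))
    (fun t ht => by
      rw [IccExtend_of_mem _ _ ht]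
      exact hasDerivWithinAt_Ad_apply hu f ⟨t, ht⟩) hc.Icc_extend'.continuousOn
  refine ⟨F, fun t => ?_⟩
  rw [hF, iccExtend_coe]
  congr 1
  exact IccExtend_val _ _ t

/-- The pointwise adjoint action of a curve on `C¹([0,1], 𝔤)`. -/
def adC1 [CompleteSpace E] (u : unitInterval → G) (hu : IsC2 (E := E) u)
    (hr : Continuous (rlogDeriv (E := E) u)) : C1 E →L[ℝ] C1 E :=
  let T : C1 E →ₗ[ℝ] C1 E :=
    { toFun := fun f => (exists_Ad_apply hu hr f).choose
      map_add' := fun f g => C1.ext fun t => by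
        rw [C1.add_apply, (exists_Ad_apply hu hr _).choose_spec,
          (exists_Ad_apply hu hr _).choose_spec, (exists_Ad_apply hu hr _).choose_spec,
          C1.add_apply, map_add]
      map_smul' := fun c f => C1.ext fun t => by
        rw [RingHom.id_apply, C1.smul_apply, (exists_Ad_apply hu hr _).choose_spec,
          (exists_Ad_apply hu hr _).choose_spec, C1.smul_apply, map_smul] }
  have hT : ∀ f t, T f t = Ad (u t) (f t) := fun f t => (exists_Ad_apply hu hr f).choose_spec t
  -- Continuity in the `C¹` norm follows from the closed graph theorem.
  ⟨T, T.continuous_of_seq_closed_graph fun f x y hf hTf => C1.ext fun t => by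
    have hev : Continuous fun f : C1 E => f t :=
      ((ContinuousMap.evalCLM ℝ t).comp C1.toC).continuous
    have h1 := (hev.tendsto y).comp hTf
    have h2 := ((Ad (u t)).continuous.tendsto _).comp ((hev.tendsto x).comp hf)
    rw [hT]
    refine tendsto_nhds_unique h1 (h2.congr fun n => ?_)
    exact (hT (f n) t).symm⟩

theorem adC1_apply [CompleteSpace E] {u : unitInterval → G} (hu : IsC2 (E := E) u)
    (hr : Continuous (rlogDeriv (E := E) u)) (f : C1 E) (t : unitInterval) :
    adC1 u hu hr f t = Ad (u t) (f t) := (exists_Ad_apply hu hr f).choose_spec t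

end Frames

/-! ### Local existence of frames -/

section InverseFunction

variable {X Y : Type*} [NormedAddCommGroup X] [NormedSpace ℝ X] [CompleteSpace X]
  [NormedAddCommGroup Y] [NormedSpace ℝ Y]

/-- The inverse function theorem: a smooth map with invertible derivative at `a` restricts to a
smooth diffeomorphism of open sets. -/
theorem exists_openPartialHomeomorph_of_contDiffOn {f : X → Y} {s : Set X} (hs : IsOpen s)
    (hf : ContDiffOn ℝ ∞ f s) {a : X} (ha : a ∈ s) (f' : X ≃L[ℝ] Y)
    (hf' : HasFDerivAt f (f' : X →L[ℝ] Y) a) :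
    ∃ φ : OpenPartialHomeomorph X Y, a ∈ φ.source ∧ φ.source ⊆ s ∧ (∀ x, φ x = f x) ∧
      ContDiffOn ℝ ∞ φ φ.source ∧ ContDiffOn ℝ ∞ φ.symm φ.target := by
  have hfa : ContDiffAt ℝ ∞ f a := hf.contDiffAt (hs.mem_nhds ha)
  set φ₀ := hfa.toOpenPartialHomeomorph f hf' (by simp) with hφ₀
  have hd : ContinuousOn (fderiv ℝ f) s := hf.continuousOn_fderiv_of_isOpen hs (by simp)
  have ho : IsOpen (s ∩ fderiv ℝ f ⁻¹' range ((↑) : (X ≃L[ℝ] Y) → X →L[ℝ] Y)) :=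
    hd.isOpen_inter_preimage hs ContinuousLinearEquiv.isOpen
  set φ := φ₀.restrOpen _ ho with hφ
  have hsrc : φ.source = φ₀.source ∩
      (s ∩ fderiv ℝ f ⁻¹' range ((↑) : (X ≃L[ℝ] Y) → X →L[ℝ] Y)) := φ₀.restrOpen_source _ ho
  have hφf : ∀ x, φ x = f x := fun x => rfl
  have hsub : φ.source ⊆ s := fun x hx => (hsrc ▸ hx).2.1
  refine ⟨φ, ?_, hsub, hφf, hf.mono hsub, ?_⟩
  · rw [hsrc]
    exact ⟨hfa.mem_toOpenPartialHomeomorph_source hf' (by simp), ha, f', hf'.fderiv.symm⟩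
  · intro y hy
    have hx := φ.map_target hy
    obtain ⟨g, hg⟩ := (hsrc ▸ hx).2.2
    have hfx : ContDiffAt ℝ ∞ f (φ.symm y) := hf.contDiffAt (hs.mem_nhds (hsub hx))
    refine (φ.contDiffAt_symm hy (f₀' := g) ?_ hfx).contDiffWithinAt
    rw [hg]
    exact (hfx.differentiableAt (by simp)).hasFDerivAt

end InverseFunction

section ContDiffOnIcc

variable {E : Type*} [NormedAddCommGroup E] [NormedSpace ℝ E]

theorem C1.derivWithin_eq (f : C1 E) (t : unitInterval) :
    derivWithin (IccExtend (zero_le_one' ℝ) f) (Icc 0 1) t = f.der t :=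
  (f.hasDerivWithinAt t).derivWithin (C1.uniqueDiffWithinAt t)

/-- A `C¹` function with a `Cⁿ` derivative is `Cⁿ⁺¹`. -/
theorem C1.contDiffOn_succ {f : C1 E} {n : ℕ}
    (h : ContDiffOn ℝ n (IccExtend (zero_le_one' ℝ) f.der) (Icc 0 1)) :
    ContDiffOn ℝ (n + 1) (IccExtend (zero_le_one' ℝ) f) (Icc 0 1) := by
  rw [contDiffOn_succ_iff_derivWithin (uniqueDiffOn_Icc zero_lt_one)]
  refine ⟨fun t ht => (f.hasDerivWithinAt ⟨t, ht⟩).differentiableWithinAt, by simp, ?_⟩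
  refine h.congr fun t ht => ?_
  rw [IccExtend_of_mem _ _ ht]
  exact f.derivWithin_eq ⟨t, ht⟩

theorem C1.contDiffOn (f : C1 E) : ContDiffOn ℝ 1 (IccExtend (zero_le_one' ℝ) f) (Icc 0 1) := by
  have := C1.contDiffOn_succ (f := f) (n := 0)
    (by simpa using f.continuous_der.Icc_extend'.continuousOn)
  simpa using this

end ContDiffOnIcc

section LocalFrames

variable {E : Type*} [NormedAddCommGroup E] [NormedSpace ℝ E]
  {G : Type*} [TopologicalSpace G] [ChartedSpace E G] [Group G] [LieGroup 𝓘(ℝ, E) ∞ G]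

variable (G) in
/-- The right logarithmic derivative in the preferred chart: a curve with coordinates `x` and
coordinate velocity `v` has right logarithmic derivative `chartRlog x v`. -/
def chartRlog (x : E) : E →L[ℝ] E := fderiv ℝ (chartDiv G x) x

theorem contDiffAt_chartRlog {x : E} (hx : x ∈ (oneChart E G).target) :
    ContDiffAt ℝ ∞ (chartRlog G) x :=
  ContDiffAt.fderiv (g := fun x => x) (contDiffAt_chartDiv hx) contDiffAt_id (by simp)

theorem hasFDerivAt_chartDiv {x : E} (hx : x ∈ (oneChart E G).target) :
    HasFDerivAt (chartDiv G x) (chartRlog G x) x := by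
  have hc : ContDiffAt ℝ ∞ (chartDiv G x) x :=
    (contDiffAt_chartDiv hx).comp x (contDiffAt_const.prodMk contDiffAt_id)
  exact (hc.differentiableAt (by simp)).hasFDerivAt

/-- At the identity the logarithmic derivative is the coordinate velocity. -/
theorem chartRlog_oneCoord :
    chartRlog G (oneCoord E G) = ContinuousLinearMap.id ℝ E := by
  refine (hasFDerivAt_chartDiv oneCoord_mem_target).unique
    ((hasFDerivAt_id _).congr_of_eventuallyEq ?_)
  filter_upwards [isOpen_oneChart_target.mem_nhds (oneCoord_mem_target (E := E) (G := G))] with x hx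
  simp only [chartDiv, oneChart_symm_oneCoord, inv_one, mul_one]
  exact (oneChart E G).right_inv hx

theorem hasRlogWithinAt_oneChart_symm {ξ : ℝ → E} {v : E} {s : Set ℝ} {t : ℝ}
    (ht : ξ t ∈ (oneChart E G).target) (hξ : HasDerivWithinAt ξ v s t) :
    HasRlogWithinAt (fun r => (oneChart E G).symm (ξ r)) (chartRlog G (ξ t) v) s t :=
  ⟨(contMDiffAt_oneChart_symm ht).continuousAt.comp_continuousWithinAt hξ.continuousWithinAt,
    (hasFDerivAt_chartDiv ht).comp_hasDerivWithinAt t hξ⟩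

variable (E G) in
/-- A globally defined smooth function which agrees near `0` with the invertible `chartRlog`. -/
theorem exists_contDiff_eq_chartRlog [FiniteDimensional ℝ E] :
    ∃ (A : E → E →L[ℝ] E) (ρ : ℝ), ContDiff ℝ ∞ A ∧ 0 < ρ ∧ A 0 = ContinuousLinearMap.id ℝ E ∧
      ∀ x, ‖x‖ < ρ → oneCoord E G + x ∈ (oneChart E G).target ∧
        A x = chartRlog G (oneCoord E G + x) ∧ ∃ L : E ≃L[ℝ] E, A x = L := by
  have : CompleteSpace E := FiniteDimensional.complete ℝ E
  set T : Set E := (fun x => oneCoord E G + x) ⁻¹' (oneChart E G).target with hT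
  have hTo : IsOpen T := isOpen_oneChart_target.preimage (by fun_prop)
  have hT0 : (0 : E) ∈ T := by simpa [hT] using oneCoord_mem_target (E := E) (G := G)
  obtain ⟨r, hr, hrT⟩ := Metric.nhds_basis_closedBall.mem_iff.1 (hTo.mem_nhds hT0)
  -- Cutting off makes `A` globally smooth, as `contDiff_superposition` requires.
  let χ : ContDiffBump (0 : E) := ⟨r / 2, r, by positivity, by linarith⟩
  set R : E → E →L[ℝ] E := fun x => chartRlog G (oneCoord E G + x) with hR
  have hRc : ∀ x ∈ T, ContDiffAt ℝ ∞ R x := fun x hx =>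
    ContDiffAt.comp (g := chartRlog G) x (contDiffAt_chartRlog hx)
      (contDiffAt_const.add contDiffAt_id)
  set A : E → E →L[ℝ] E := fun x => χ x • R x with hA
  have hAc : ContDiff ℝ ∞ A := by
    rw [contDiff_iff_contDiffAt]
    intro x
    by_cases hx : x ∈ T
    · exact χ.contDiff.contDiffAt.smul (hRc x hx)
    · have hx' : x ∉ tsupport χ := by
        rw [χ.tsupport_eq]
        exact fun h => hx (hrT h)
      have : A =ᶠ[𝓝 x] fun _ => 0 := by
        filter_upwards [(isClosed_tsupport χ).isOpen_compl.mem_nhds hx'] with y hy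
        simp [hA, image_eq_zero_of_notMem_tsupport hy]
      exact contDiffAt_const.congr_of_eventuallyEq this
  have hA0 : A 0 = ContinuousLinearMap.id ℝ E := by
    have : χ 0 = 1 := χ.one_of_mem_closedBall (by simpa using χ.rIn_pos.le)
    simp [hA, hR, this, chartRlog_oneCoord]
  have hinv : ∀ᶠ x in 𝓝 (0 : E), A x ∈ range ((↑) : (E ≃L[ℝ] E) → E →L[ℝ] E) :=
    hAc.continuous.continuousAt.eventually_mem (ContinuousLinearEquiv.isOpen.mem_nhds
      ⟨ContinuousLinearEquiv.refl ℝ E, hA0.symm⟩)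
  obtain ⟨ρ, hρ, hρA⟩ := Metric.eventually_nhds_iff_ball.1 hinv
  refine ⟨A, min ρ (r / 2), hAc, by positivity, hA0, fun x hx => ?_⟩
  have hx1 : ‖x‖ < ρ := hx.trans_le (min_le_left _ _)
  have hx2 : ‖x‖ < r / 2 := hx.trans_le (min_le_right _ _)
  refine ⟨hrT (by simpa using (hx2.trans (by linarith)).le), ?_, ?_⟩
  · have : χ x = 1 := χ.one_of_mem_closedBall (by simpa using hx2.le)
    simp [hA, hR, this]
  · obtain ⟨L, hL⟩ := hρA x (by simpa using hx1)
    exact ⟨L, hL.symm⟩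

variable (E G) in
/-- The frame equation near `0`. In the preferred chart, a curve `c⁻¹(c(1) + ∫ζ)` is a frame for
`X` when `A(∫ζ) ζ = -X`, and the left side is a local diffeomorphism of `C⁰([0,1], E)` by the
inverse function theorem. In particular the end point of the frame depends smoothly on `X`. -/
theorem exists_local_frames [FiniteDimensional ℝ E] [CompleteSpace E] :
    ∃ (V : Set C(unitInterval, E)) (η : C(unitInterval, E) → E), IsOpen V ∧ 0 ∈ V ∧
      ContDiffOn ℝ ∞ η V ∧ η 0 = 0 ∧
      HasFDerivAt η (-(ContinuousMap.evalCLM ℝ (1 : unitInterval)).comp (integrate E)) 0 ∧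
      (∀ X ∈ V, oneCoord E G + η X ∈ (oneChart E G).target) ∧
      ∀ X : C1 E, C1.toC X ∈ V → ∃ w : unitInterval → G, IsFrame X w ∧
        w 1 = (oneChart E G).symm (oneCoord E G + η (C1.toC X)) := by
  obtain ⟨A, ρ, hA, hρ, hA0, hAρ⟩ := exists_contDiff_eq_chartRlog E G
  let Ac : C(E, E →L[ℝ] E) := ⟨A, hA.continuous⟩
  let P := liftBilin (K := unitInterval) (ContinuousLinearMap.id ℝ (E →L[ℝ] E))
  let Φ : C(unitInterval, E) → C(unitInterval, E) := fun ζ => P (Ac.comp (integrate E ζ)) ζ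
  have hΦt : ∀ ζ t, Φ ζ t = A (integrate E ζ t) (ζ t) := fun ζ t => rfl
  have hS : ContDiff ℝ ∞ fun ζ : C(unitInterval, E) => P (Ac.comp (integrate E ζ)) :=
    (contDiff_liftBilin (ContinuousLinearMap.id ℝ (E →L[ℝ] E))).comp
      ((contDiff_superposition Ac hA).comp (integrate E).contDiff)
  have hΦ : ContDiff ℝ ∞ Φ := hS.clm_apply contDiff_id
  have hΦ' : HasFDerivAt Φ (ContinuousLinearEquiv.refl ℝ C(unitInterval, E) :
      C(unitInterval, E) →L[ℝ] C(unitInterval, E)) 0 := by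
    have h := ((hS.differentiable (by simp)) 0).hasFDerivAt.clm_apply (hasFDerivAt_id 0)
    refine h.congr_fderiv ?_
    ext ζ t
    simp [P, Ac, hA0]
  obtain ⟨φ, hφ0, hφs, hφΦ, -, hφc⟩ := exists_openPartialHomeomorph_of_contDiffOn
    (Metric.isOpen_ball (x := (0 : C(unitInterval, E))) (ε := ρ)) hΦ.contDiffOn
    (Metric.mem_ball_self hρ) _ hΦ'
  have hΦ0 : φ 0 = 0 := by
    rw [hφΦ]
    ext t
    simp [hΦt]
  have h0t : (0 : C(unitInterval, E)) ∈ φ.target := hΦ0 ▸ φ.map_source hφ0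
  have hφs0 : φ.symm 0 = 0 := by
    have := φ.left_inv hφ0
    rwa [hΦ0] at this
  let J := (ContinuousMap.evalCLM ℝ (1 : unitInterval)).comp (integrate E)
  have hJ : ∀ (ζ : C(unitInterval, E)) t, ‖integrate E ζ t‖ ≤ ‖ζ‖ := fun ζ t => by
    have := norm_integrate_apply_le (ζ := ζ) (c := ‖ζ‖) (n := 0)
      (fun t => by simpa using ζ.norm_coe_le_norm t) t
    simp only [zero_add, pow_one, CharP.cast_eq_zero, div_one] at this
    exact this.trans (mul_le_of_le_one_right (norm_nonneg _) t.2.2)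
  have hζρ : ∀ X ∈ φ.target, ∀ t, ‖integrate E (φ.symm X) t‖ < ρ := fun X hX t =>
    (hJ _ t).trans_lt (by simpa using hφs (φ.map_target hX))
  have hn : ContDiff ℝ ∞ fun X : C(unitInterval, E) => -X := contDiff_neg
  refine ⟨(fun X => -X) ⁻¹' φ.target, fun X => J (φ.symm (-X)), φ.open_target.preimage hn.continuous,
    by simpa using h0t, J.contDiff.comp_contDiffOn (hφc.comp hn.contDiffOn fun X hX => hX),
    by simp [hφs0], ?_, fun X hX => (hAρ _ (hζρ _ hX 1)).1, ?_⟩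
  · have h1 : HasFDerivAt φ.symm (ContinuousLinearEquiv.refl ℝ C(unitInterval, E) :
        C(unitInterval, E) →L[ℝ] C(unitInterval, E)) 0 := by
      have := φ.hasFDerivAt_symm (f' := ContinuousLinearEquiv.refl ℝ C(unitInterval, E)) h0t
        (by rw [hφs0, funext hφΦ]; exact hΦ')
      simpa using this
    have h2 : HasFDerivAt (fun X : C(unitInterval, E) => -X)
        (-ContinuousLinearMap.id ℝ C(unitInterval, E)) 0 := (hasFDerivAt_id _).neg
    have e0 : (fun X : C(unitInterval, E) => -X) 0 = 0 := neg_zero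
    rw [← e0] at h1
    refine (J.hasFDerivAt.comp (0 : C(unitInterval, E)) (h1.comp 0 h2)).congr_fderiv ?_
    ext ζ
    simp [J]
  · intro X hX
    set ζ := φ.symm (-C1.toC X) with hζ
    have hζX : ∀ t, A (integrate E ζ t) (ζ t) = - X t := fun t => by
      have := congrArg (fun f => f t) (φ.right_inv hX)
      simp only [hφΦ] at this
      exact this
    set ξ : C1 E := C1.prim 0 ζ with hξ
    have hξt : ∀ t, ξ t = integrate E ζ t := fun t => rfl
    have hξd : ∀ t, ξ.der t = ζ t := fun t => rfl
    have hin : ∀ t, ‖ξ t‖ < ρ := fun t => hζρ _ hX t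
    let w : unitInterval → G := fun t => (oneChart E G).symm (oneCoord E G + ξ t)
    have hw : IccExtend (zero_le_one' ℝ) w =
        fun r => (oneChart E G).symm (oneCoord E G + IccExtend (zero_le_one' ℝ) ξ r) := rfl
    have hlog : ∀ t : unitInterval, rlogDeriv (E := E) w t = - X t := fun t => by
      have hd : HasDerivWithinAt (fun r => oneCoord E G + IccExtend (zero_le_one' ℝ) ξ r) (ζ t)
        (Icc 0 1) t := (ξ.hasDerivWithinAt t).const_add _
      have e : IccExtend (zero_le_one' ℝ) ξ t = ξ t := IccExtend_val _ _ t
      have h := hasRlogWithinAt_oneChart_symm (G := G) (by rw [e]; exact (hAρ _ (hin t)).1) hd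
      rw [e, ← (hAρ _ (hin t)).2.1, hξt, hζX] at h
      exact rlogDeriv_eq (by rw [hw]; exact h)
    -- Regularity: `ζ = -A(ξ)⁻¹ X` is `C¹`, hence its primitive `ξ` is `C²`.
    have hζ1 : ContDiffOn ℝ 1 (IccExtend (zero_le_one' ℝ) ξ.der) (Icc 0 1) := by
      have h1 : ContDiffOn ℝ 1 (fun r => (A (IccExtend (zero_le_one' ℝ) ξ r)).inverse
          (-IccExtend (zero_le_one' ℝ) X r)) (Icc 0 1) := by
        refine ContDiffOn.clm_apply (fun r hr => ?_) X.contDiffOn.neg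
        obtain ⟨L, hL⟩ := (hAρ _ (hin (projIcc 0 1 zero_le_one r))).2.2
        have h2 : ContDiffAt ℝ 1 ContinuousLinearMap.inverse
          (A (IccExtend (zero_le_one' ℝ) ξ r)) := by
          have h3 := contDiffAt_map_inverse (𝕜 := ℝ) (n := 1) L
          rw [← hL] at h3
          exact h3
        exact h2.comp_contDiffWithinAt r
          ((hA.of_le (by norm_cast)).contDiffAt.comp_contDiffWithinAt r (ξ.contDiffOn r hr))
      refine h1.congr fun r hr => ?_
      obtain ⟨L, hL⟩ := (hAρ _ (hin ⟨r, hr⟩)).2.2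
      rw [IccExtend_of_mem _ _ hr, IccExtend_of_mem _ _ hr, IccExtend_of_mem _ _ hr, hξd,
        ← hζX ⟨r, hr⟩, ← hξt, hL, ContinuousLinearMap.inverse_equiv]
      simp
    have hξ2 : ContDiffOn ℝ 2 (IccExtend (zero_le_one' ℝ) ξ) (Icc 0 1) := by
      have := C1.contDiffOn_succ (f := ξ) (n := 1) (by exact_mod_cast hζ1)
      norm_num at this
      exact this
    refine ⟨w, ⟨?_, ?_, fun t => by rw [hlog, neg_neg]⟩, rfl⟩
    · intro r hr
      rw [hw]
      refine ContMDiffAt.comp_contMDiffWithinAt (I' := 𝓘(ℝ, E)) (g := (oneChart E G).symm)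
        (f := fun r => oneCoord E G + IccExtend (zero_le_one' ℝ) ξ r) r ?_ ?_
      · exact (contMDiffAt_oneChart_symm (hAρ _ (hin (projIcc 0 1 zero_le_one r))).1).of_le
          (by norm_cast)
      · exact (contDiffOn_const.add hξ2).contMDiffOn r hr
    · have : ξ 0 = 0 := C1.prim_zero _ _
      simp [w, this]

end LocalFrames

/-! ### Global frames and the holonomy -/

section Holonomy

variable {E : Type*} [NormedAddCommGroup E] [NormedSpace ℝ E] [CompleteSpace E]
  {G : Type*} [TopologicalSpace G] [ChartedSpace E G] [Group G] [LieGroup 𝓘(ℝ, E) ∞ G]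

omit [CompleteSpace E] in
theorem IsFrame.continuous_rlogDeriv_inv {X : C1 E} {u : unitInterval → G} (h : IsFrame X u) :
    Continuous (rlogDeriv (E := E) u⁻¹) := by
  have e : rlogDeriv (E := E) u⁻¹ = fun t => Ad (u⁻¹ t) (X t) := by
    ext t
    rw [rlogDeriv_inv h.isC2, h.rlogDeriv_eq, map_neg, neg_neg, Pi.inv_apply]
  rw [e]
  exact ((continuous_Ad E G).comp h.isC2.inv.continuous).clm_apply X.continuous

omit [CompleteSpace E] in
theorem C1.contDiff_toC : ContDiff ℝ ∞ fun X : C1 E => C1.toC X :=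
  ContinuousLinearMap.contDiff (𝕜 := ℝ) (E := C1 E) (F := C(unitInterval, E)) C1.toC

omit [CompleteSpace E] in
theorem C1.hasFDerivAt_toC (X : C1 E) : HasFDerivAt (fun X : C1 E => C1.toC X) C1.toC X :=
  ContinuousLinearMap.hasFDerivAt (𝕜 := ℝ) (E := C1 E) (F := C(unitInterval, E)) C1.toC

/-- The pointwise action of `Ad(u⁻¹)` on `C¹([0,1], 𝔤)` for a frame `u`. -/
def IsFrame.adInv {X : C1 E} {u : unitInterval → G} (h : IsFrame X u) : C1 E ≃L[ℝ] C1 E :=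
  ContinuousLinearEquiv.equivOfInverse (adC1 u⁻¹ h.isC2.inv h.continuous_rlogDeriv_inv)
    (adC1 u h.isC2 h.continuous_rlogDeriv)
    (fun f => C1.ext fun t => by rw [adC1_apply, adC1_apply, Pi.inv_apply, Ad_Ad_inv])
    (fun f => C1.ext fun t => by rw [adC1_apply, adC1_apply, Pi.inv_apply, Ad_inv_Ad])

theorem IsFrame.adInv_apply {X : C1 E} {u : unitInterval → G} (h : IsFrame X u) (f : C1 E)
    (t : unitInterval) : h.adInv f t = Ad (u t)⁻¹ (f t) :=
  adC1_apply h.isC2.inv h.continuous_rlogDeriv_inv f t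

theorem IsFrame.adInv_symm_apply {X : C1 E} {u : unitInterval → G} (h : IsFrame X u) (f : C1 E)
    (t : unitInterval) : h.adInv.symm f t = Ad (u t) (f t) :=
  adC1_apply h.isC2 h.continuous_rlogDeriv f t

/-- The product of frames for `X` and `Y` is a frame for `X + Ad(u) Y`. -/
theorem IsFrame.mul {X Y : C1 E} {u w : unitInterval → G} (hu : IsFrame X u) (hw : IsFrame Y w) :
    IsFrame (X + hu.adInv.symm Y) (u * w) where
  isC2 := hu.isC2.mul hw.isC2
  map_zero := by simp [hu.map_zero, hw.map_zero]
  eq_neg t := by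
    rw [rlogDeriv_mul hu.isC2 hw.isC2, hu.rlogDeriv_eq, hw.rlogDeriv_eq, C1.add_apply,
      hu.adInv_symm_apply, map_neg, neg_add, neg_neg, neg_neg]

theorem IsFrame.inv {X : C1 E} {u : unitInterval → G} (hu : IsFrame X u) :
    IsFrame (-hu.adInv X) u⁻¹ where
  isC2 := hu.isC2.inv
  map_zero := by simp [hu.map_zero]
  eq_neg t := by
    rw [rlogDeriv_inv hu.isC2, hu.rlogDeriv_eq, C1.neg_apply, hu.adInv_apply, map_neg, neg_neg]

/-- Perturbing a frame: if `u` is a frame for `X` and `w` one for `Ad(u⁻¹)(Y - X)`, then `uw` is a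
frame for `Y`. -/
theorem IsFrame.mul_of_sub {X Y : C1 E} {u w : unitInterval → G} (hu : IsFrame X u)
    (hw : IsFrame (hu.adInv (Y - X)) w) : IsFrame Y (u * w) := by
  have h := hu.mul hw
  rwa [ContinuousLinearEquiv.symm_apply_apply, add_sub_cancel] at h

omit [CompleteSpace E] in
theorem isFrame_zero_one : IsFrame (0 : C1 E) (1 : unitInterval → G) where
  isC2 := contMDiffOn_const (c := (1 : G))
  map_zero := rfl
  eq_neg t := by rw [rlogDeriv_one, C1.zero_apply, neg_zero]

variable [FiniteDimensional ℝ E] [CompactSpace G]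

/-- Every `C¹` path in the Lie algebra has a frame: since `Ad(G)` is bounded, a frame for `Y` can
be perturbed to frames for all `X` within a uniform distance of `Y`. -/
theorem exists_isFrame (X : C1 E) : ∃ u : unitInterval → G, IsFrame X u := by
  obtain ⟨V, η, hVo, hV0, -, -, -, -, hV⟩ := exists_local_frames E G
  obtain ⟨ε, hε, hball⟩ := Metric.isOpen_iff.1 hVo 0 hV0
  obtain ⟨C, hC, hCA⟩ := exists_norm_Ad_le E G
  -- For this `n`, every `Ad(u⁻¹)(X / n)` lies in the ball in which local frames exist.
  obtain ⟨n, hn⟩ := exists_nat_gt (C * ‖C1.toC X‖ / ε)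
  have hn0 : (0 : ℝ) < n := lt_of_le_of_lt (by positivity) hn
  have key : ∀ k : ℕ, ∃ u : unitInterval → G, IsFrame ((k / n : ℝ) • X) u := by
    intro k
    induction k with
    | zero => exact ⟨1, by simpa using isFrame_zero_one⟩
    | succ k ih =>
      obtain ⟨u, hu⟩ := ih
      have hsub : ((k + 1 : ℕ) / n : ℝ) • X - (k / n : ℝ) • X = (1 / n : ℝ) • X := by
        rw [← sub_smul]; congr 1; push_cast; ring
      obtain ⟨w, hw, -⟩ := hV (hu.adInv (((k + 1 : ℕ) / n : ℝ) • X - (k / n : ℝ) • X)) (by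
        refine hball ?_
        rw [mem_ball_zero_iff, hsub]
        refine lt_of_le_of_lt ((ContinuousMap.norm_le _ (by positivity)).2 fun t => ?_)
          (show C * ‖C1.toC X‖ / n < ε by
            rw [div_lt_iff₀ hε] at hn; rw [div_lt_iff₀ hn0]; linarith)
        rw [C1.toC_apply, hu.adInv_apply, C1.smul_apply, map_smul, norm_smul,
          Real.norm_of_nonneg (by positivity)]
        have h1 : ‖Ad (u t)⁻¹ (X t)‖ ≤ C * ‖C1.toC X‖ :=
          ((Ad (u t)⁻¹).le_opNorm _).trans
            (mul_le_mul (hCA _) (X.norm_apply_le t) (norm_nonneg _) hC.le)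
        calc 1 / (n : ℝ) * ‖Ad (u t)⁻¹ (X t)‖ ≤ 1 / n * (C * ‖C1.toC X‖) := by gcongr
          _ = C * ‖C1.toC X‖ / n := by ring)
      exact ⟨u * w, hu.mul_of_sub hw⟩
  obtain ⟨u, hu⟩ := key n
  rw [div_self hn0.ne', one_smul] at hu
  exact ⟨u, hu⟩

variable (G) in
/-- The frame of a `C¹` path in the Lie algebra. -/
def frame (X : C1 E) : unitInterval → G := (exists_isFrame (G := G) X).choose

theorem isFrame_frame (X : C1 E) : IsFrame X (frame G X) := (exists_isFrame (G := G) X).choose_spec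

variable (G) in
/-- The holonomy of a `C¹` path in the Lie algebra: the end point of its frame. -/
def hol (X : C1 E) : G := frame G X 1

theorem hol_eq [T2Space G] {X : C1 E} {u : unitInterval → G} (h : IsFrame X u) :
    hol G X = u 1 := congrFun ((isFrame_frame X).unique h) 1

variable (E) in
/-- The mean value `∫₀¹ X` of a `C¹` path. -/
def meanL : C1 E →L[ℝ] E :=
  ((ContinuousMap.evalCLM ℝ (1 : unitInterval)).comp (integrate E)).comp C1.toC

omit [FiniteDimensional ℝ E] in
theorem meanL_const (x : E) : meanL E (C1.const x) = x := by
  have : meanL E (C1.const x) = ∫ s in (0 : ℝ)..1,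
      IccExtend (zero_le_one' ℝ) (C1.toC (C1.const x)) s := integrate_apply _ _
  rw [this]
  have h2 : ∀ s, IccExtend (zero_le_one' ℝ) (C1.toC (C1.const x)) s = x := fun s => rfl
  simp [h2]

variable (E) in
/-- The constant functions, as a continuous linear map. -/
def constL : E →L[ℝ] C1 E :=
  (C1.equivProd E).symm.toContinuousLinearMap.comp (ContinuousLinearMap.inl ℝ E _)

omit [FiniteDimensional ℝ E] in
theorem constL_apply (x : E) : constL E x = C1.const x := by
  rw [constL]
  refine (C1.equivProd E).injective ?_
  simp only [ContinuousLinearMap.comp_apply, ContinuousLinearEquiv.coe_coe,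
    ContinuousLinearEquiv.apply_symm_apply]
  rfl

omit [FiniteDimensional ℝ E] in
theorem meanL_constL (x : E) : meanL E (constL E x) = x := by rw [constL_apply, meanL_const]

variable (E) in
/-- The `C¹` paths with mean value zero. -/
abbrev MeanZero : Submodule ℝ (C1 E) := (meanL E).ker

variable (E) in
/-- The splitting of a path into the negative of its mean and its oscillation. -/
def meanSplit : C1 E ≃L[ℝ] E × MeanZero E :=
  ContinuousLinearEquiv.equivOfInverse
    ((-meanL E).prod ((ContinuousLinearMap.id ℝ (C1 E) - (constL E).comp (meanL E)).codRestrict _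
      (fun X => by simp [meanL_constL])))
    ((MeanZero E).subtypeL.comp (ContinuousLinearMap.snd ℝ _ _) -
      (constL E).comp (ContinuousLinearMap.fst ℝ _ _))
    (fun X => by simp)
    (fun p => by
      have h : meanL E (p.2 : C1 E) = 0 := p.2.2
      ext
      · simp [meanL_constL, h]
      · simp [meanL_constL, h])

/-- The holonomy is, in suitable smooth local coordinates, a linear projection. -/
theorem exists_hol_straightening [T2Space G] (T : C1 E) :
    ∃ φ : OpenPartialHomeomorph (C1 E) (E × MeanZero E), T ∈ φ.source ∧ (φ T).1 = 0 ∧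
      ContDiffOn ℝ ∞ φ φ.source ∧ ContDiffOn ℝ ∞ φ.symm φ.target ∧
      ∀ S ∈ φ.source, oneCoord E G + (φ S).1 ∈ (oneChart E G).target ∧
        hol G S = hol G T * (oneChart E G).symm (oneCoord E G + (φ S).1) := by
  obtain ⟨V, η, hVo, hV0, hη, hη0, hη', hηt, hV⟩ := exists_local_frames E G
  have hu := isFrame_frame (G := G) T
  let α : C1 E → C1 E := fun S => hu.adInv (S - T)
  have hα : ContDiff ℝ ∞ α := hu.adInv.contDiff.comp (contDiff_id.sub contDiff_const)
  have hα' : HasFDerivAt α (hu.adInv : C1 E →L[ℝ] C1 E) T :=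
    hu.adInv.toContinuousLinearMap.hasFDerivAt.comp T ((hasFDerivAt_id T).sub_const T)
  have hαT : α T = 0 := by simp [α]
  let W : Set (C1 E) := (fun S => C1.toC (α S)) ⁻¹' V
  have hWo : IsOpen W := hVo.preimage (C1.toC.continuous.comp hα.continuous)
  have hTW : T ∈ W := by simpa [W, hαT] using hV0
  -- As a function of `α S`, the first component has the derivative `-meanL` at `0`, and `meanSplit`
  -- completes it to an isomorphism.
  let f : C1 E → E × MeanZero E := fun S => (η (C1.toC (α S)), (meanSplit E (α S)).2)
  have hf : ContDiffOn ℝ ∞ f W := by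
    refine ContDiffOn.prodMk ?_ ?_
    · exact hη.comp (ContDiff.comp (g := fun S : C1 E => C1.toC S) C1.contDiff_toC hα).contDiffOn
        fun S hS => hS
    · exact (contDiff_snd.comp ((meanSplit E).contDiff.comp hα)).contDiffOn
  have hf' : HasFDerivAt f ((hu.adInv.trans (meanSplit E) : C1 E ≃L[ℝ] E × MeanZero E) :
      C1 E →L[ℝ] E × MeanZero E) T := by
    have h1 : HasFDerivAt (fun S => η (C1.toC (α S)))
        ((-(ContinuousMap.evalCLM ℝ (1 : unitInterval)).comp (integrate E)).comp
          (C1.toC.comp (hu.adInv : C1 E →L[ℝ] C1 E))) T := by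
      refine HasFDerivAt.comp (g := η) T ?_
        (HasFDerivAt.comp (g := fun S : C1 E => C1.toC S) T (C1.hasFDerivAt_toC _) hα')
      simpa [hαT] using hη'
    have h2 : HasFDerivAt (fun S => (meanSplit E (α S)).2)
        ((ContinuousLinearMap.snd ℝ E (MeanZero E)).comp
          ((meanSplit E).toContinuousLinearMap.comp (hu.adInv : C1 E →L[ℝ] C1 E))) T :=
      (ContinuousLinearMap.snd ℝ E (MeanZero E)).hasFDerivAt.comp T
        ((meanSplit E).toContinuousLinearMap.hasFDerivAt.comp T hα')
    exact h1.prodMk h2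
  obtain ⟨φ, hTφ, hφW, hφf, hφ1, hφ2⟩ := exists_openPartialHomeomorph_of_contDiffOn hWo hf hTW _ hf'
  refine ⟨φ, hTφ, by simp [hφf, f, hαT, hη0], hφ1, hφ2, fun S hS => ?_⟩
  obtain ⟨w, hw, hw1⟩ := hV (α S) (hφW hS)
  have h1 : (φ S).1 = η (C1.toC (α S)) := by rw [hφf]
  refine ⟨by rw [h1]; exact hηt _ (hφW hS), ?_⟩
  rw [hol_eq (hu.mul_of_sub hw), Pi.mul_apply, hw1, h1]
  rfl

/-- The holonomy has local sections. -/
theorem exists_hol_section [T2Space G] (X : C1 E) : ∃ j : G → C1 E,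
    ContinuousAt j (hol G X) ∧ j (hol G X) = X ∧ ∀ᶠ g in 𝓝 (hol G X), hol G (j g) = g := by
  have : IsTopologicalGroup G := topologicalGroup_of_lieGroup 𝓘(ℝ, E) ∞
  obtain ⟨φ, hX, hX0, -, -, hφ⟩ := exists_hol_straightening (G := G) X
  let i : G → E × MeanZero E := fun g =>
    (oneChart E G ((hol G X)⁻¹ * g) - oneCoord E G, (φ X).2)
  have h1 : (hol G X)⁻¹ * hol G X = 1 := inv_mul_cancel _
  have hm : ContinuousAt (fun g => (hol G X)⁻¹ * g) (hol G X) := by fun_prop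
  have hi : ContinuousAt i (hol G X) := by
    refine ContinuousAt.prodMk (ContinuousAt.sub ?_ continuousAt_const) continuousAt_const
    refine ContinuousAt.comp (g := oneChart E G) ?_ hm
    rw [h1]
    exact (contMDiffAt_oneChart one_mem_oneChart_source).continuousAt
  have hi1 : i (hol G X) = φ X := Prod.ext (by simp [i, oneChart_one, hX0]) rfl
  have htgt : φ X ∈ φ.target := φ.map_source hX
  refine ⟨fun g => φ.symm (i g), ?_, (congrArg φ.symm hi1).trans (φ.left_inv hX), ?_⟩
  · refine ContinuousAt.comp (g := φ.symm) ?_ hi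
    rw [hi1]
    exact φ.continuousAt_symm htgt
  · have h2 : ∀ᶠ g in 𝓝 (hol G X), i g ∈ φ.target :=
      hi.eventually_mem (by rw [hi1]; exact φ.open_target.mem_nhds htgt)
    have h3 : ∀ᶠ g in 𝓝 (hol G X), (hol G X)⁻¹ * g ∈ (oneChart E G).source :=
      hm.eventually_mem (by rw [h1]; exact extChartAt_source_mem_nhds (I := 𝓘(ℝ, E)) (1 : G))
    filter_upwards [h2, h3] with g hg hgs
    rw [(hφ _ (φ.map_target hg)).2, φ.right_inv hg]
    simp only [i, add_sub_cancel]
    rw [(oneChart E G).left_inv hgs, mul_inv_cancel_left]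

/-- In the coordinates of `exists_hol_straightening` the holonomy is visibly continuous. -/
theorem continuous_hol [T2Space G] : Continuous (hol (E := E) G) := by
  have : IsTopologicalGroup G := topologicalGroup_of_lieGroup 𝓘(ℝ, E) ∞
  refine continuous_iff_continuousAt.2 fun X => ?_
  obtain ⟨φ, hX, hX0, -, -, hφ⟩ := exists_hol_straightening (G := G) X
  have h1 : ContinuousAt (fun S => oneCoord E G + (φ S).1) X :=
    continuousAt_const.add (φ.continuousAt hX).fst
  have h2 : ContinuousAt (fun S => (oneChart E G).symm (oneCoord E G + (φ S).1)) X :=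
    ContinuousAt.comp (g := (oneChart E G).symm)
      (contMDiffAt_oneChart_symm (hφ X hX).1).continuousAt h1
  refine ((continuousAt_const (y := hol G X)).mul h2).congr ?_
  filter_upwards [φ.open_source.mem_nhds hX] with S hS
  exact ((hφ S hS).2).symm

/-- The holonomy is open because it has continuous local sections. -/
theorem isOpenMap_hol [T2Space G] : IsOpenMap (hol (E := E) G) := by
  refine IsOpenMap.of_nhds_le fun X => ?_
  obtain ⟨j, hj, hjX, hjs⟩ := exists_hol_section (G := G) X
  have hj' : Tendsto j (𝓝 (hol G X)) (𝓝 X) := by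
    have := hj.tendsto
    rwa [hjX] at this
  refine le_trans ?_ (map_mono hj')
  have hjs' : hol G ∘ j =ᶠ[𝓝 (hol G X)] id := hjs
  rw [map_map, map_congr hjs', map_id]

/-- As `G` is connected, every group element is the holonomy of a path in the Lie algebra: the
holonomies form an open subgroup. -/
theorem hol_surjective [T2Space G] [ConnectedSpace G] : Function.Surjective (hol (E := E) G) := by
  have : IsTopologicalGroup G := topologicalGroup_of_lieGroup 𝓘(ℝ, E) ∞
  let H : Subgroup G :=
    { carrier := range (hol (E := E) G)
      mul_mem' := by
        rintro _ _ ⟨X, rfl⟩ ⟨Y, rfl⟩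
        exact ⟨_, hol_eq ((isFrame_frame X).mul (isFrame_frame Y))⟩
      one_mem' := ⟨0, hol_eq isFrame_zero_one⟩
      inv_mem' := by
        rintro _ ⟨X, rfl⟩
        exact ⟨_, hol_eq (isFrame_frame X).inv⟩ }
  have ho : IsOpen (H : Set G) := isOpenMap_hol.isOpen_range
  exact range_eq_univ.1 (IsClopen.eq_univ ⟨H.isClosed_of_isOpen ho, ho⟩ ⟨1, H.one_mem⟩)

end Holonomy

/-! ### Quadratic differential equations with a `C¹` parameter -/

section LinearODE

variable {Y : Type*} [NormedAddCommGroup Y] [NormedSpace ℝ Y] [CompleteSpace Y]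

theorem C1.eq_add_integrate (f : C1 Y) (t : unitInterval) :
    f t = f 0 + integrate Y (C1.derL f) t := by
  rw [integrate_apply]
  exact f.eq_add_integral t

/-- Inhomogeneous linear equations have unique global solutions. -/
theorem existsUnique_linear (L : C(unitInterval, Y →L[ℝ] Y)) (b : Y) (h : C(unitInterval, Y)) :
    ∃! z : C1 Y, z 0 = b ∧ ∀ t, z.der t = L t (z t) + h t := by
  obtain ⟨U, hU⟩ := isUnit_one_add_volterra (-L)
  have hUa : ∀ (ζ : C(unitInterval, Y)) t, (U : C(unitInterval, Y) →L[ℝ] C(unitInterval, Y)) ζ t =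
      ζ t - L t (integrate Y ζ t) := fun ζ t => by
    rw [hU]
    simp [sub_eq_add_neg]
  have hU1 : ∀ ζ, (U : C(unitInterval, Y) →L[ℝ] C(unitInterval, Y)) (U.inv ζ) = ζ := fun ζ =>
    congrArg (fun T : C(unitInterval, Y) →L[ℝ] C(unitInterval, Y) => T ζ) U.val_inv
  have hU2 : ∀ ζ, U.inv ((U : C(unitInterval, Y) →L[ℝ] C(unitInterval, Y)) ζ) = ζ := fun ζ =>
    congrArg (fun T : C(unitInterval, Y) →L[ℝ] C(unitInterval, Y) => T ζ) U.inv_val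
  let k : C(unitInterval, Y) := ⟨fun t => h t + L t b, by fun_prop⟩
  -- The derivative `ζ` of the solution satisfies `ζ - L ∫ζ = h + L b`.
  refine ⟨C1.prim b (U.inv k), ⟨C1.prim_zero _ _, fun t => ?_⟩, fun z hz => ?_⟩
  · have h1 : (C1.prim b (U.inv k)).der t = U.inv k t := rfl
    have h2 : h t + L t b = U.inv k t - L t (integrate Y (U.inv k) t) := by
      rw [← hUa, hU1]; rfl
    rw [h1, C1.prim_apply, ← integrate_apply, map_add, eq_add_of_sub_eq h2.symm]
    abel
  · have h1 : C1.derL z = U.inv k := by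
      rw [← hU2 (C1.derL z)]
      congr 1
      ext t
      rw [hUa, C1.derL_apply, hz.2 t, C1.eq_add_integrate z t, hz.1, map_add]
      simp only [k, ContinuousMap.coe_mk]
      abel
    refine C1.ext fun t => ?_
    rw [C1.eq_add_integrate z t, hz.1, h1, C1.prim_apply, ← integrate_apply]

end LinearODE

section Quadratic

variable {X Y Z : Type*} [NormedAddCommGroup X] [NormedSpace ℝ X]
  [NormedAddCommGroup Y] [NormedSpace ℝ Y] [NormedAddCommGroup Z] [NormedSpace ℝ Z]

/-- The pointwise application of a bilinear map to two `C¹` functions. -/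
def C1.bilin (A : X →L[ℝ] Y →L[ℝ] Z) : C1 X →L[ℝ] C1 Y →L[ℝ] C(unitInterval, Z) :=
  (liftBilin A).bilinearComp C1.toC C1.toC

@[simp] theorem C1.bilin_apply (A : X →L[ℝ] Y →L[ℝ] Z) (f : C1 X) (g : C1 Y) (t : unitInterval) :
    C1.bilin A f g t = A (f t) (g t) := rfl

variable [CompleteSpace X] [CompleteSpace Y] (A : X →L[ℝ] Y →L[ℝ] Y) (Q : Y →L[ℝ] Y →L[ℝ] Y)

/-- Solutions of the quadratic equation `y' = A(τ, y) + Q(y, y)` with parameter `τ`. -/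
def IsQuadSolution (τ : C1 X) (y : C1 Y) : Prop :=
  ∀ t, y.der t = A (τ t) (y t) + Q (y t) (y t)

/-- The difference of the two sides of the equation, together with parameter and initial value. -/
def quadResidual (p : C1 X × C1 Y) : (C1 X × Y) × C(unitInterval, Y) :=
  ((p.1, p.2 0), C1.derL p.2 - C1.bilin A p.1 p.2 - C1.bilin Q p.2 p.2)

omit [CompleteSpace X] [CompleteSpace Y] in
theorem C1.contDiff_bilin (A : X →L[ℝ] Y →L[ℝ] Z) :
    ContDiff ℝ ∞ fun p : C1 X × C1 Y => C1.bilin A p.1 p.2 :=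
  (C1.bilin A).isBoundedBilinearMap.contDiff

variable (Y) in
/-- The initial value of a `C¹` function, as a continuous linear map. -/
def C1.evalZero : C1 Y →L[ℝ] Y := (ContinuousLinearMap.fst ℝ Y C(unitInterval, Y)).comp
  (C1.equivProd Y).toContinuousLinearMap

omit [CompleteSpace Y] in
theorem C1.contDiff_derL : ContDiff ℝ ∞ fun f : C1 Y => C1.derL f :=
  ContinuousLinearMap.contDiff (𝕜 := ℝ) (E := C1 Y) (F := C(unitInterval, Y)) C1.derL

/-- The linearization of the quadratic equation at any curve is an inhomogeneous linear
equation, so the inverse function theorem applies to `quadResidual`. -/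
theorem hasFDerivAt_quadResidual (p : C1 X × C1 Y) :
    ∃ D : (C1 X × C1 Y) ≃L[ℝ] (C1 X × Y) × C(unitInterval, Y),
      HasFDerivAt (quadResidual A Q) (D : (C1 X × C1 Y) →L[ℝ] (C1 X × Y) × C(unitInterval, Y)) p := by
  let π₁ := ContinuousLinearMap.fst ℝ (C1 X) (C1 Y)
  let π₂ := ContinuousLinearMap.snd ℝ (C1 X) (C1 Y)
  let ev := C1.evalZero Y
  let D : (C1 X × C1 Y) →L[ℝ] (C1 X × Y) × C(unitInterval, Y) :=
    (π₁.prod (ev.comp π₂)).prod (C1.derL.comp π₂ -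
      ((C1.bilin A p.1).comp π₂ + ((C1.bilin A).flip p.2).comp π₁) -
      ((C1.bilin Q p.2).comp π₂ + ((C1.bilin Q).flip p.2).comp π₂))
  have hD : HasFDerivAt (quadResidual A Q) D p := by
    have hA : HasFDerivAt (fun p : C1 X × C1 Y => C1.bilin A p.1 p.2) _ p :=
      (C1.bilin A).isBoundedBilinearMap.hasFDerivAt p
    have hQ' : HasFDerivAt (fun r : C1 Y × C1 Y => C1.bilin Q r.1 r.2) _ (p.2, p.2) :=
      (C1.bilin Q).isBoundedBilinearMap.hasFDerivAt (p.2, p.2)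
    have h0 : HasFDerivAt (fun p : C1 X × C1 Y => (p.2, p.2)) (π₂.prod π₂) p :=
      (π₂.prod π₂).hasFDerivAt
    have hQ := hQ'.comp p h0
    have h1 : HasFDerivAt (fun p : C1 X × C1 Y => (p.1, p.2 0)) (π₁.prod (ev.comp π₂)) p :=
      (π₁.prod (ev.comp π₂)).hasFDerivAt
    have h2 : HasFDerivAt (fun p : C1 X × C1 Y => C1.derL p.2) (C1.derL.comp π₂) p :=
      (C1.derL.comp π₂).hasFDerivAt
    refine (h1.prodMk ((h2.sub hA).sub hQ)).congr_fderiv ?_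
    exact ContinuousLinearMap.ext fun q => rfl
  let L : C(unitInterval, Y →L[ℝ] Y) := ⟨fun t => A (p.1 t) + Q (p.2 t) + Q.flip (p.2 t),
    ((A.continuous.comp p.1.continuous).add (Q.continuous.comp p.2.continuous)).add
      (Q.flip.continuous.comp p.2.continuous)⟩
  have hsol : ∀ (σ : C1 X) (b : Y) (g : C(unitInterval, Y)) (z : C1 Y),
      D (σ, z) = ((σ, b), g) ↔ z 0 = b ∧ ∀ t, z.der t = L t (z t) +
        (g + C1.bilin A σ p.2) t := by
    intro σ b g z
    have : D (σ, z) = ((σ, z 0), C1.derL z - (C1.bilin A p.1 z + C1.bilin A σ p.2) -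
      (C1.bilin Q p.2 z + C1.bilin Q z p.2)) := rfl
    rw [this, Prod.mk.injEq, Prod.mk.injEq, ContinuousMap.ext_iff]
    refine and_congr (by simp) (forall_congr' fun t => ?_)
    rw [sub_sub, ContinuousMap.sub_apply, sub_eq_iff_eq_add, C1.derL_apply]
    have : g t + (C1.bilin A p.1 z + C1.bilin A σ p.2 + (C1.bilin Q p.2 z + C1.bilin Q z p.2)) t =
        L t (z t) + (g + C1.bilin A σ p.2) t := by
      simp [L]
      abel
    rw [this]
  have hbij : Function.Bijective D := by
    rw [Function.bijective_iff_existsUnique]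
    rintro ⟨⟨σ, b⟩, g⟩
    obtain ⟨z, hz, hu⟩ := existsUnique_linear L b (g + C1.bilin A σ p.2)
    refine ⟨(σ, z), (hsol σ b g z).2 hz, ?_⟩
    rintro ⟨σ', z'⟩ h
    have hσ : σ' = σ := congrArg (fun q => q.1.1) h
    subst hσ
    rw [hu z' ((hsol _ b g z').1 h)]
  exact ⟨ContinuousLinearEquiv.ofBijective D (LinearMap.ker_eq_bot.2 hbij.1)
    (LinearMap.range_eq_top.2 hbij.2), hD⟩

omit [CompleteSpace X] in
theorem contDiff_quadResidual : ContDiff ℝ ∞ (quadResidual A Q) := by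
  have hA : ContDiff ℝ ∞ fun p : C1 X × C1 Y => C1.bilin A p.1 p.2 := C1.contDiff_bilin A
  have h0 : ContDiff ℝ ∞ fun p : C1 X × C1 Y => (p.2, p.2) := contDiff_snd.prodMk contDiff_snd
  have hQ := (C1.contDiff_bilin Q).comp h0
  have h1 : ContDiff ℝ ∞ fun p : C1 X × C1 Y => (p.1, p.2 0) :=
    contDiff_fst.prodMk ((C1.evalZero Y).contDiff.comp contDiff_snd)
  have h2 : ContDiff ℝ ∞ fun p : C1 X × C1 Y => C1.derL p.2 :=
    ContDiff.comp (g := fun f : C1 Y => C1.derL f) C1.contDiff_derL contDiff_snd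
  exact h1.prodMk ((h2.sub hA).sub hQ)

omit [CompleteSpace X] [CompleteSpace Y] in
/-- Solving the initial value problem means inverting `quadResidual` at `(τ, a, 0)`. -/
theorem quadResidual_eq_iff (p : C1 X × C1 Y) (q : C1 X × Y) :
    quadResidual A Q p = (q, 0) ↔ p.1 = q.1 ∧ p.2 0 = q.2 ∧ IsQuadSolution A Q p.1 p.2 := by
  rw [quadResidual, Prod.mk.injEq, Prod.ext_iff, ContinuousMap.ext_iff, and_assoc]
  refine and_congr Iff.rfl (and_congr Iff.rfl (forall_congr' fun t => ?_))
  rw [sub_sub, ContinuousMap.sub_apply, ContinuousMap.zero_apply, sub_eq_zero]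
  rfl

variable {A Q}

omit [CompleteSpace X] in
/-- The difference of two solutions solves a linear equation. -/
theorem IsQuadSolution.unique {τ : C1 X} {y z : C1 Y} (hy : IsQuadSolution A Q τ y)
    (hz : IsQuadSolution A Q τ z) (h0 : y 0 = z 0) : y = z := by
  -- `Q(y, y) - Q(z, z) = Q(y, y - z) + Q(y - z, z)`.
  let L : C(unitInterval, Y →L[ℝ] Y) := ⟨fun t => A (τ t) + Q (y t) + Q.flip (z t),
    ((A.continuous.comp τ.continuous).add (Q.continuous.comp y.continuous)).add
      (Q.flip.continuous.comp z.continuous)⟩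
  refine sub_eq_zero.1 ((existsUnique_linear L 0 0).unique ⟨?_, fun t => ?_⟩ ⟨rfl, fun t => ?_⟩)
  · rw [C1.sub_apply, h0, sub_self]
  · have h1 : (y - z).der t = y.der t - z.der t := rfl
    rw [h1, hy t, hz t, C1.sub_apply]
    simp [L]
    abel
  · have h1 : (0 : C1 Y).der t = 0 := rfl
    rw [h1]
    simp

/-- If the quadratic equation has global solutions for all parameters and initial values, these
depend smoothly on the parameter and the initial value. -/
theorem exists_contDiff_quadSolution
    (hex : ∀ (τ : C1 X) (a : Y), ∃ y : C1 Y, y 0 = a ∧ IsQuadSolution A Q τ y) :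
    ∃ s : C1 X × Y → C1 Y, ContDiff ℝ ∞ s ∧
      ∀ q, s q 0 = q.2 ∧ IsQuadSolution A Q q.1 (s q) := by
  choose s hs using fun q : C1 X × Y => hex q.1 q.2
  refine ⟨s, contDiff_iff_contDiffAt.2 fun q => ?_, hs⟩
  obtain ⟨D, hD⟩ := hasFDerivAt_quadResidual A Q (q.1, s q)
  obtain ⟨φ, hφ0, -, hφ, -, hφs⟩ := exists_openPartialHomeomorph_of_contDiffOn isOpen_univ
    (contDiff_quadResidual A Q).contDiffOn (mem_univ _) D hD
  have hq : φ (q.1, s q) = (q, 0) := by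
    rw [hφ, quadResidual_eq_iff]
    exact ⟨rfl, hs q⟩
  have hqt : (q, (0 : C(unitInterval, Y))) ∈ φ.target := hq ▸ φ.map_source hφ0
  have hi : ContDiff ℝ ∞ fun q : C1 X × Y => (q, (0 : C(unitInterval, Y))) :=
    contDiff_id.prodMk contDiff_const
  have h1 : ContDiffAt ℝ ∞ (fun q : C1 X × Y => (φ.symm (q, 0)).2) q :=
    contDiff_snd.contDiffAt.comp q
      (((hφs.contDiffAt (φ.open_target.mem_nhds hqt)).comp q hi.contDiffAt))
  refine h1.congr_of_eventuallyEq ?_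
  filter_upwards [hi.continuous.continuousAt.preimage_mem_nhds (φ.open_target.mem_nhds hqt)]
    with r hr
  have h2 := (quadResidual_eq_iff A Q _ _).1 ((hφ _).symm.trans (φ.right_inv hr))
  exact IsQuadSolution.unique (hs r).2 (h2.1 ▸ h2.2.2) ((hs r).1.trans h2.2.1.symm)

omit [CompleteSpace X] in
/-- Global existence from a conserved positive definite quadratic form. The vector field is cut off
outside of a large ball; the form is still conserved, so it keeps the solution of the cut-off
equation inside the ball. -/
theorem exists_quadSolution_of_conserved [FiniteDimensional ℝ Y] (H : Y →L[ℝ] Y →L[ℝ] ℝ)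
    (hsymm : ∀ x y, H x y = H y x) {c : ℝ} (hc : 0 < c) (hpos : ∀ y, c * ‖y‖ ^ 2 ≤ H y y)
    (hH : ∀ x y, H y (A x y + Q y y) = 0) (τ : C1 X) (a : Y) :
    ∃ y : C1 Y, y 0 = a ∧ IsQuadSolution A Q τ y := by
  -- Wherever `H y y = H a a`, one has `‖y‖ ≤ √(H a a / c) < R`.
  set R : ℝ := Real.sqrt (H a a / c) + 1 with hR
  have hR0 : 0 < R := by positivity
  let χ : ContDiffBump (0 : Y) := ⟨R, R + 1, hR0, by linarith⟩
  let f₁ : Y → Y := fun x => χ x • x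
  let f₂ : Y → Y := fun x => χ x • Q x x
  have hf₁ : ContDiff ℝ 1 f₁ := χ.contDiff.smul contDiff_id
  have hf₂ : ContDiff ℝ 1 f₂ := χ.contDiff.smul (Q.contDiff.clm_apply contDiff_id)
  have hs₁ : HasCompactSupport f₁ := χ.hasCompactSupport.smul_right
  have hs₂ : HasCompactSupport f₂ := χ.hasCompactSupport.smul_right
  obtain ⟨K₁, hK₁⟩ := hf₁.lipschitzWith_of_hasCompactSupport hs₁ one_ne_zero
  obtain ⟨K₂, hK₂⟩ := hf₂.lipschitzWith_of_hasCompactSupport hs₂ one_ne_zero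
  obtain ⟨M₁, hM₁⟩ := hs₁.exists_bound_of_continuous hf₁.continuous
  obtain ⟨M₂, hM₂⟩ := hs₂.exists_bound_of_continuous hf₂.continuous
  have hτc : Continuous (IccExtend (zero_le_one' ℝ) τ) := τ.continuous.Icc_extend'
  let v : ℝ → Y → Y := fun t x => A (IccExtend (zero_le_one' ℝ) τ t) (f₁ x) + f₂ x
  have hAτ : ∀ t, ‖A (IccExtend (zero_le_one' ℝ) τ t)‖₊ ≤ ‖A‖₊ * ‖C1.toC τ‖₊ := fun t =>
    (A.le_opNNNorm _).trans (by gcongr; exact τ.norm_apply_le _)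
  have hvc : ∀ x, Continuous fun t => v t x := fun x =>
    ((A.continuous.comp hτc).clm_apply continuous_const).add continuous_const
  -- The cut-off field is bounded by a constant `M`, so that on `[0,1]` solutions stay in the ball of
  -- radius `M` about `a` and the Picard–Lindelöf theorem covers the whole interval.
  have hPL : IsPicardLindelof v (tmin := 0) (tmax := 1) (⟨0, by simp⟩ : Icc (0 : ℝ) 1) a
      (‖A‖₊ * ‖C1.toC τ‖₊ * Real.toNNReal M₁ + Real.toNNReal M₂) 0
      (‖A‖₊ * ‖C1.toC τ‖₊ * Real.toNNReal M₁ + Real.toNNReal M₂)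
      (‖A‖₊ * ‖C1.toC τ‖₊ * K₁ + K₂) := by
    refine ⟨fun t _ => ?_, fun x _ => (hvc x).continuousOn, fun t _ x _ => ?_, by simp⟩
    · refine LipschitzWith.lipschitzOnWith (LipschitzWith.add ?_ hK₂)
      refine ((A (IccExtend (zero_le_one' ℝ) τ t)).lipschitz.comp hK₁).weaken ?_
      gcongr
      exact hAτ t
    · refine (norm_add_le _ _).trans ?_
      push_cast
      gcongr
      · refine ((A _).le_opNorm _).trans ?_
        exact mul_le_mul (hAτ t) ((hM₁ x).trans (Real.le_coe_toNNReal _)) (norm_nonneg _)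
          (by positivity)
      · exact (hM₂ x).trans (Real.le_coe_toNNReal _)
  obtain ⟨α, hα0, hα⟩ := hPL.exists_eq_forall_mem_Icc_hasDerivWithinAt₀
  have hαc : ContinuousOn α (Icc 0 1) := fun t ht => (hα t ht).continuousWithinAt
  have hv : ∀ t x, v t x = χ x • (A (IccExtend (zero_le_one' ℝ) τ t) x + Q x x) := fun t x => by
    simp [v, f₁, f₂]
  have hE : ∀ t ∈ Icc (0 : ℝ) 1,
      HasDerivWithinAt (fun t => H (α t) (α t)) 0 (Icc 0 1) t := fun t ht => by
    have h1 : HasDerivWithinAt (fun t => H (α t)) (H (v t (α t))) (Icc 0 1) t :=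
      H.hasFDerivAt.comp_hasDerivWithinAt t (hα t ht)
    have h2 := h1.clm_apply (hα t ht)
    have h3 : H (α t) (v t (α t)) = 0 := by rw [hv, map_smul, hH, smul_zero]
    rwa [hsymm, h3, add_zero] at h2
  have hconst : ∀ t ∈ Icc (0 : ℝ) 1, H (α t) (α t) = H a a := fun t ht => by
    have h := constant_of_derivWithin_zero (f := fun t => H (α t) (α t))
      (fun t ht => (hE t ht).differentiableWithinAt)
      (fun t ht => (hE t ⟨ht.1, ht.2.le⟩).derivWithin
        (uniqueDiffOn_Icc zero_lt_one t ⟨ht.1, ht.2.le⟩)) t ht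
    simpa only [show α 0 = a from hα0] using h
  have hbound : ∀ t ∈ Icc (0 : ℝ) 1, χ (α t) = 1 := fun t ht => by
    refine χ.one_of_mem_closedBall (mem_closedBall_zero_iff.2 ?_)
    have h1 : ‖α t‖ ^ 2 ≤ H a a / c := by
      rw [le_div_iff₀ hc, mul_comm, ← hconst t ht]
      exact hpos _
    exact (Real.le_sqrt_of_sq_le h1).trans (by simp [χ, hR])
  obtain ⟨y, hy, hy'⟩ := C1.exists_of_hasDerivWithinAt (f' := fun t => v t (α t)) hα
    (((A.continuous.comp hτc).continuousOn.clm_apply (hf₁.continuous.comp_continuousOn hαc)).add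
      (hf₂.continuous.comp_continuousOn hαc))
  refine ⟨y, (hy 0).trans hα0, fun t => ?_⟩
  rw [hy', hy, hv, hbound t t.2, one_smul, IccExtend_val]

end Quadratic

/-! ### The Nahm–Schmid equations as a quadratic differential equation -/

section PostComp

variable {X Y : Type*} [NormedAddCommGroup X] [NormedSpace ℝ X]
  [NormedAddCommGroup Y] [NormedSpace ℝ Y]

/-- Composition of `C¹` functions with a continuous linear map. -/
def C1.map (ℓ : X →L[ℝ] Y) : C1 X →L[ℝ] C1 Y where
  toFun f := ⟨(⟨fun t => ℓ (f t), ℓ.continuous.comp f.continuous⟩,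
    ⟨fun t => ℓ (f.der t), ℓ.continuous.comp f.continuous_der⟩), fun t =>
      ℓ.hasFDerivAt.comp_hasDerivWithinAt (t : ℝ) (f.hasDerivWithinAt t)⟩
  map_add' f g := C1.ext fun t => map_add ℓ _ _
  map_smul' c f := C1.ext fun t => map_smul ℓ _ _
  cont := by
    have h : Continuous fun f : C1 X => (f.1 : C(unitInterval, X) × C(unitInterval, X)) :=
      continuous_subtype_val
    exact Continuous.subtype_mk
      (((ContinuousMap.continuous_postcomp (⟨ℓ, ℓ.continuous⟩ : C(X, Y))).comp
        (continuous_fst.comp h)).prodMk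
      ((ContinuousMap.continuous_postcomp (⟨ℓ, ℓ.continuous⟩ : C(X, Y))).comp
        (continuous_snd.comp h))) _

@[simp] theorem C1.map_apply (ℓ : X →L[ℝ] Y) (f : C1 X) (t : unitInterval) :
    C1.map ℓ f t = ℓ (f t) := rfl

@[simp] theorem C1.der_map (ℓ : X →L[ℝ] Y) (f : C1 X) (t : unitInterval) :
    (C1.map ℓ f).der t = ℓ (f.der t) := rfl

end PostComp

section System

variable (E : Type*) [NormedAddCommGroup E] [NormedSpace ℝ E]

/-- The quadruple `(T₀, T₁, T₂, T₃)` as the pair of `T₀` and `(T₁, T₂, T₃)`. -/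
def quadrupleEquiv : (Fin 4 → C1 E) ≃L[ℝ] C1 E × C1 (E × E × E) :=
  ContinuousLinearEquiv.equivOfInverse
    ((ContinuousLinearMap.proj 0).prod
      ((C1.map (ContinuousLinearMap.inl ℝ E (E × E))).comp (ContinuousLinearMap.proj 1) +
        (C1.map ((ContinuousLinearMap.inr ℝ E (E × E)).comp
          (ContinuousLinearMap.inl ℝ E E))).comp (ContinuousLinearMap.proj 2) +
        (C1.map ((ContinuousLinearMap.inr ℝ E (E × E)).comp
          (ContinuousLinearMap.inr ℝ E E))).comp (ContinuousLinearMap.proj 3)))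
    (ContinuousLinearMap.pi ![ContinuousLinearMap.fst ℝ _ _,
      (C1.map (ContinuousLinearMap.fst ℝ E (E × E))).comp (ContinuousLinearMap.snd ℝ _ _),
      (C1.map ((ContinuousLinearMap.fst ℝ E E).comp (ContinuousLinearMap.snd ℝ E (E × E)))).comp
        (ContinuousLinearMap.snd ℝ _ _),
      (C1.map ((ContinuousLinearMap.snd ℝ E E).comp (ContinuousLinearMap.snd ℝ E (E × E)))).comp
        (ContinuousLinearMap.snd ℝ _ _)])
    (fun T => by
      ext i
      fin_cases i
      · rfl
      all_goals exact C1.ext fun t => by simp)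
    (fun p => by
      refine Prod.ext rfl (C1.ext fun t => ?_)
      simp)

variable {E}

theorem quadrupleEquiv_snd_apply (T : Fin 4 → C1 E) (t : unitInterval) :
    (quadrupleEquiv E T).2 t = (T 1 t, T 2 t, T 3 t) := by
  simp [quadrupleEquiv]

theorem quadrupleEquiv_snd_der (T : Fin 4 → C1 E) (t : unitInterval) :
    (quadrupleEquiv E T).2.der t = ((T 1).der t, (T 2).der t, (T 3).der t) := by
  have h : ∀ f g : C1 (E × E × E), (f + g).der t = f.der t + g.der t := fun _ _ => rfl
  simp [quadrupleEquiv, h]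

variable (E) (G : Type*) [TopologicalSpace G] [ChartedSpace E G] [Group G] [LieGroup 𝓘(ℝ, E) ∞ G]

/-- The linear part `(τ, y) ↦ (-[τ, y₁], -[τ, y₂], -[τ, y₃])` of the Nahm–Schmid equations. -/
def nahmLinear : E →L[ℝ] (E × E × E) →L[ℝ] (E × E × E) :=
  let p₂ := ContinuousLinearMap.snd ℝ E (E × E)
  let i₂ := ContinuousLinearMap.inr ℝ E (E × E);
  -((ContinuousLinearMap.compL ℝ _ _ _ (ContinuousLinearMap.inl ℝ E (E × E))).comp
      ((bracketL E G).bilinearComp (.id ℝ E) (.fst ℝ E (E × E))) +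
    (ContinuousLinearMap.compL ℝ _ _ _ (i₂.comp (.inl ℝ E E))).comp
      ((bracketL E G).bilinearComp (.id ℝ E) ((ContinuousLinearMap.fst ℝ E E).comp p₂)) +
    (ContinuousLinearMap.compL ℝ _ _ _ (i₂.comp (.inr ℝ E E))).comp
      ((bracketL E G).bilinearComp (.id ℝ E) ((ContinuousLinearMap.snd ℝ E E).comp p₂)))

/-- The quadratic part `(x, y) ↦ (-[x₂, y₃], [x₃, y₁], [x₁, y₂])` of the Nahm–Schmid equations. -/
def nahmQuadratic : (E × E × E) →L[ℝ] (E × E × E) →L[ℝ] (E × E × E) :=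
  let p₂ := ContinuousLinearMap.snd ℝ E (E × E)
  let i₂ := ContinuousLinearMap.inr ℝ E (E × E);
  -(ContinuousLinearMap.compL ℝ _ _ _ (ContinuousLinearMap.inl ℝ E (E × E))).comp
      ((bracketL E G).bilinearComp ((ContinuousLinearMap.fst ℝ E E).comp p₂)
        ((ContinuousLinearMap.snd ℝ E E).comp p₂)) +
    (ContinuousLinearMap.compL ℝ _ _ _ (i₂.comp (.inl ℝ E E))).comp
      ((bracketL E G).bilinearComp ((ContinuousLinearMap.snd ℝ E E).comp p₂)
        (.fst ℝ E (E × E))) +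
    (ContinuousLinearMap.compL ℝ _ _ _ (i₂.comp (.inr ℝ E E))).comp
      ((bracketL E G).bilinearComp (.fst ℝ E (E × E)) ((ContinuousLinearMap.fst ℝ E E).comp p₂))

omit [LieGroup 𝓘(ℝ, E) ∞ G] in
theorem nahmLinear_apply (τ : E) (y : E × E × E) : nahmLinear E G τ y =
    (-bracketL E G τ y.1, -bracketL E G τ y.2.1, -bracketL E G τ y.2.2) := by
  simp [nahmLinear]

omit [LieGroup 𝓘(ℝ, E) ∞ G] in
theorem nahmQuadratic_apply (x y : E × E × E) : nahmQuadratic E G x y =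
    (-bracketL E G x.2.1 y.2.2, bracketL E G x.2.2 y.1, bracketL E G x.1 y.2.1) := by
  simp [nahmQuadratic]

variable {E G}

/-- The Nahm–Schmid equations are the quadratic equation for `(T₁, T₂, T₃)` with parameter `T₀`. -/
theorem isSolution_iff (T : Fin 4 → C1 E) : IsSolution G T ↔
    IsQuadSolution (nahmLinear E G) (nahmQuadratic E G) (T 0) (quadrupleEquiv E T).2 := by
  refine forall_congr' fun t => ?_
  rw [quadrupleEquiv_snd_apply, quadrupleEquiv_snd_der, nahmLinear_apply, nahmQuadratic_apply]
  simp only [Prod.mk_add_mk, Prod.mk.injEq, bracketL_apply]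
  rw [← eq_sub_iff_add_eq, ← eq_sub_iff_add_eq, ← eq_sub_iff_add_eq]
  refine and_congr ?_ (and_congr ?_ ?_) <;> rw [sub_eq_neg_add]

variable (E G)

/-- The Nahm–Schmid flow conserves `2|T₁|² + |T₂|² + |T₃|²` for an invariant inner product. -/
theorem exists_nahm_conserved [FiniteDimensional ℝ E] [CompactSpace G] :
    ∃ (H : (E × E × E) →L[ℝ] (E × E × E) →L[ℝ] ℝ) (c : ℝ), (∀ x y, H x y = H y x) ∧ 0 < c ∧
      (∀ y, c * ‖y‖ ^ 2 ≤ H y y) ∧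
      ∀ τ y, H y (nahmLinear E G τ y + nahmQuadratic E G y y) = 0 := by
  obtain ⟨B, hsymm, ⟨c, hc, hpos⟩, hinv⟩ := exists_Ad_invariant_inner E G
  let p₁ := ContinuousLinearMap.fst ℝ E (E × E)
  let p₂ := (ContinuousLinearMap.fst ℝ E E).comp (ContinuousLinearMap.snd ℝ E (E × E))
  let p₃ := (ContinuousLinearMap.snd ℝ E E).comp (ContinuousLinearMap.snd ℝ E (E × E))
  let H := (2 : ℝ) • B.bilinearComp p₁ p₁ + B.bilinearComp p₂ p₂ + B.bilinearComp p₃ p₃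
  have hH : ∀ x y, H x y = 2 * B x.1 y.1 + B x.2.1 y.2.1 + B x.2.2 y.2.2 := fun x y => by
    simp [H, p₁, p₂, p₃]
  have h0 : ∀ x, 0 ≤ B x x := fun x => (by positivity : 0 ≤ c * ‖x‖ ^ 2).trans (hpos x)
  refine ⟨H, c, fun x y => ?_, hc, fun y => ?_, fun τ y => ?_⟩
  · rw [hH, hH, hsymm x.1, hsymm x.2.1, hsymm x.2.2]
  · have h1 := hpos y.1
    have h2 := hpos y.2.1
    have h3 := hpos y.2.2
    have k1 := h0 y.1
    have k2 := h0 y.2.1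
    have k3 := h0 y.2.2
    rw [hH, Prod.norm_def, Prod.norm_def]
    rcases max_choice ‖y.1‖ (max ‖y.2.1‖ ‖y.2.2‖) with h | h <;> rw [h]
    · linarith
    · rcases max_choice ‖y.2.1‖ ‖y.2.2‖ with h | h <;> rw [h] <;> linarith
  -- The linear part is skew. The cubic terms `B y₁ [y₂, y₃]`, `B y₂ [y₃, y₁]`, `B y₃ [y₁, y₂]` are
  -- equal by invariance and occur with the coefficients `-2, 1, 1`.
  · have hτ : ∀ x, B x (bracketL E G τ x) = 0 := fun x => by
      have := inner_bracketL hinv τ x x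
      rw [hsymm] at this
      linarith
    have h2 := inner_bracketL hinv y.2.2 y.1 y.2.1
    have h3 := inner_bracketL hinv y.2.1 y.2.2 y.1
    rw [bracketL_swap y.2.2 y.1, bracketL_swap y.2.2 y.2.1] at h2
    rw [bracketL_swap y.2.1 y.1] at h3
    rw [hH, nahmLinear_apply, nahmQuadratic_apply]
    simp only [Prod.fst_add, Prod.snd_add, map_add, map_neg, hτ]
    rw [bracketL_swap y.2.2 y.1]
    simp only [map_neg, neg_apply] at *
    rw [hsymm (bracketL E G y.1 y.2.2), hsymm (bracketL E G y.2.1 y.2.2)] at *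
    linarith

/-- Linear coordinates on quadruples: `T₀`, the initial values and the derivatives of
`T₁, T₂, T₃`. -/
def nahmCoord [CompleteSpace E] :
    (Fin 4 → C1 E) ≃L[ℝ] (C1 E × E × E × E) × C(unitInterval, E × E × E) :=
  ((quadrupleEquiv E).trans
    ((ContinuousLinearEquiv.refl ℝ (C1 E)).prodCongr (C1.equivProd (E × E × E)))).trans
    (ContinuousLinearEquiv.prodAssoc ℝ _ _ _).symm

variable {E}

theorem nahmCoord_fst [CompleteSpace E] (T : Fin 4 → C1 E) :
    (nahmCoord E T).1 = (T 0, T 1 0, T 2 0, T 3 0) := by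
  have h : (nahmCoord E T).1 = (T 0, (quadrupleEquiv E T).2 0) := rfl
  rw [h, quadrupleEquiv_snd_apply]

theorem nahmCoord_snd [CompleteSpace E] (T : Fin 4 → C1 E) :
    (nahmCoord E T).2 = C1.derL (quadrupleEquiv E T).2 := rfl

/-- The solution space of the Nahm–Schmid equations is the graph of a smooth function. -/
theorem exists_isSolution_iff_graph [CompleteSpace E] [FiniteDimensional ℝ E] [CompactSpace G] :
    ∃ k : C1 E × E × E × E → C(unitInterval, E × E × E), ContDiff ℝ ∞ k ∧
      ∀ T, IsSolution G T ↔ (nahmCoord E T).2 = k (nahmCoord E T).1 := by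
  obtain ⟨H, c, hsymm, hc, hpos, hH⟩ := exists_nahm_conserved E G
  obtain ⟨s, hs, hsol⟩ := exists_contDiff_quadSolution
    (exists_quadSolution_of_conserved (X := E) H hsymm hc hpos hH)
  refine ⟨fun q => C1.derL (s q), ?_, fun T => ?_⟩
  · have := C1.contDiff_derL.comp hs
    exact this
  · rw [isSolution_iff, nahmCoord_snd]
    have h := hsol (nahmCoord E T).1
    constructor
    · intro hT
      rw [IsQuadSolution.unique hT h.2 h.1.symm]
    · intro hT
      have : (quadrupleEquiv E T).2 = s (nahmCoord E T).1 :=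
        (C1.equivProd _).injective (Prod.ext h.1.symm hT)
      rw [this]
      exact h.2

/-- Solutions of the Nahm–Schmid equations are determined by `T₀` and the initial values of
`T₁, T₂, T₃`. -/
theorem IsSolution.eq_of_eq [CompleteSpace E] {S T : Fin 4 → C1 E} (hS : IsSolution G S)
    (hT : IsSolution G T) (h0 : S 0 = T 0) (h1 : S 1 0 = T 1 0) (h2 : S 2 0 = T 2 0)
    (h3 : S 3 0 = T 3 0) : S = T := by
  rw [isSolution_iff] at hS hT
  rw [h0] at hS
  refine (quadrupleEquiv E).injective (Prod.ext h0 (hS.unique hT ?_))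
  rw [quadrupleEquiv_snd_apply, quadrupleEquiv_snd_apply, h1, h2, h3]

end System

/-! ### Transport of manifold structures -/

section Transport

variable {V H : Type*} [NormedAddCommGroup V] [NormedSpace ℝ V] [TopologicalSpace H]
  {J : ModelWithCorners ℝ V H} {M N : Type*} [TopologicalSpace M] [TopologicalSpace N]

/-- A manifold structure can be transported along a homeomorphism. -/
theorem exists_chartedSpace_diffeomorph [ChartedSpace H N] [IsManifold J ∞ N] (e : M ≃ₜ N) :
    ∃ (_ : ChartedSpace H M), IsManifold J ∞ M ∧
      ∃ Φ : M ≃ₘ^∞⟮J, J⟯ N, ∀ x, Φ x = e x := by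
  let cs : ChartedSpace H M :=
    { atlas := (fun c => e.toOpenPartialHomeomorph.trans c) '' atlas H N
      chartAt := fun x => e.toOpenPartialHomeomorph.trans (chartAt H (e x))
      mem_chart_source := fun x => by simp
      chart_mem_atlas := fun x => mem_image_of_mem _ (chart_mem_atlas H (e x)) }
  have hg : HasGroupoid M (contDiffGroupoid ∞ J) := ⟨by
    rintro _ _ ⟨c, hc, rfl⟩ ⟨c', hc', rfl⟩
    have h : (e.toOpenPartialHomeomorph.trans c).symm.trans (e.toOpenPartialHomeomorph.trans c') =
        c.symm.trans c' := by
      rw [OpenPartialHomeomorph.trans_symm_eq_symm_trans_symm, OpenPartialHomeomorph.trans_assoc,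
        ← OpenPartialHomeomorph.trans_assoc _ _ c', ← Homeomorph.symm_toOpenPartialHomeomorph,
        ← Homeomorph.trans_toOpenPartialHomeomorph, Homeomorph.symm_trans_self,
        Homeomorph.refl_toOpenPartialHomeomorph, OpenPartialHomeomorph.refl_trans]
    rw [h]
    exact HasGroupoid.compatible hc hc'⟩
  have hm : IsManifold J ∞ M := IsManifold.mk' J ∞ M
  have hid : ∀ x : M, ∀ᶠ z in 𝓝[range J] (extChartAt J x x),
      extChartAt J (e x) ((extChartAt J (e x)).symm z) = z := fun x => by
    filter_upwards [extChartAt_target_mem_nhdsWithin (I := J) (e x)] with z hz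
    exact (extChartAt J (e x)).right_inv hz
  have hx : ∀ x : M, extChartAt J (e x) ((extChartAt J (e x)).symm (extChartAt J x x)) =
    extChartAt J x x := fun x => (extChartAt J (e x)).right_inv (mem_extChartAt_target (e x))
  refine ⟨cs, hm, ⟨e.toEquiv, fun x => ?_, fun y => ?_⟩, fun x => rfl⟩
  · refine contMDiffAt_iff.2 ⟨e.continuous.continuousAt, ?_⟩
    refine contDiffWithinAt_id.congr_of_eventuallyEq ?_ ?_
    · filter_upwards [hid x] with z hz
      change extChartAt J (e x) (e (e.symm ((extChartAt J (e x)).symm z))) = z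
      rw [e.apply_symm_apply, hz]
    · change extChartAt J (e x) (e (e.symm ((extChartAt J (e x)).symm _))) = _
      rw [e.apply_symm_apply, hx, id]
  · obtain ⟨x, rfl⟩ := e.surjective y
    refine contMDiffAt_iff.2 ⟨e.symm.continuous.continuousAt, ?_⟩
    have hs : e.toEquiv.symm (e x) = x := e.symm_apply_apply x
    rw [hs]
    refine contDiffWithinAt_id.congr_of_eventuallyEq ?_ ?_
    · filter_upwards [hid x] with z hz
      change extChartAt J (e x) (e (e.symm ((extChartAt J (e x)).symm z))) = z
      rw [e.apply_symm_apply, hz]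
    · change extChartAt J (e x) (e (e.symm ((extChartAt J (e x)).symm (extChartAt J x x)))) =
        extChartAt J x x
      rw [e.apply_symm_apply, hx]

/-- Transport of a product structure; the product of the model spaces is regarded as a single
model space. -/
theorem exists_chartedSpace_prod_diffeomorph {F : Type*} [NormedAddCommGroup F] [NormedSpace ℝ F]
    [ChartedSpace V N] [IsManifold 𝓘(ℝ, V) ∞ N] (e : M ≃ₜ N × F) :
    ∃ (_ : ChartedSpace (V × F) M), IsManifold 𝓘(ℝ, V × F) ∞ M ∧
      ∃ Φ : M ≃ₘ^∞⟮𝓘(ℝ, V × F), 𝓘(ℝ, V).prod 𝓘(ℝ, F)⟯ (N × F), ∀ x, Φ x = e x := by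
  rw [modelWithCornersSelf_prod]
  exact exists_chartedSpace_diffeomorph (J := 𝓘(ℝ, V).prod 𝓘(ℝ, F)) e

end Transport

/-! ### Graphs and submersions -/

section Graph

variable {U W C : Type*} [NormedAddCommGroup U] [NormedSpace ℝ U] [NormedAddCommGroup W]
  [NormedSpace ℝ W] [NormedAddCommGroup C] [NormedSpace ℝ C]

/-- The shear `(w, c) ↦ (w, c - k(w))`, which moves the graph of `k` to `W × {0}`. -/
def shear (k : W → C) (hk : Continuous k) : W × C ≃ₜ W × C where
  toFun q := (q.1, q.2 - k q.1)
  invFun q := (q.1, q.2 + k q.1)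
  left_inv q := by simp
  right_inv q := by simp
  continuous_toFun := by fun_prop
  continuous_invFun := by fun_prop

/-- The projection of a graph to the domain of the function. -/
def graphHomeo {p : U → Prop} (L : U ≃L[ℝ] W × C) {k : W → C} (hk : Continuous k)
    (hp : ∀ T, p T ↔ (L T).2 = k (L T).1) : {T // p T} ≃ₜ W where
  toFun T := (L T.1).1
  invFun w := ⟨L.symm (w, k w), (hp _).2 (by simp)⟩
  left_inv T := Subtype.ext (L.symm_apply_eq.2 (Prod.ext rfl ((hp T.1).1 T.2).symm))
  right_inv w := by simp
  continuous_toFun := by fun_prop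
  continuous_invFun := Continuous.subtype_mk (L.symm.continuous.comp (continuous_id.prodMk hk)) _

/-- A subset which, in linear coordinates, is the graph of a smooth function is a smooth embedded
submanifold, globally parametrized by the domain of the function. -/
theorem exists_manifold_of_graph {p : U → Prop} (L : U ≃L[ℝ] W × C) {k : W → C}
    (hk : ContDiff ℝ ∞ k) (hp : ∀ T, p T ↔ (L T).2 = k (L T).1) :
    ∃ (_ : ChartedSpace W {T // p T}), IsManifold 𝓘(ℝ, W) ∞ {T // p T} ∧
      Manifold.IsSmoothEmbedding 𝓘(ℝ, W) 𝓘(ℝ, U) ∞ (Subtype.val : {T // p T} → U) ∧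
      ∃ Θ : {T // p T} ≃ₘ^∞⟮𝓘(ℝ, W), 𝓘(ℝ, W)⟯ W, ∀ T, Θ T = (L T).1 := by
  obtain ⟨cs, hm, Θ, hΘ⟩ :=
    exists_chartedSpace_diffeomorph (J := 𝓘(ℝ, W)) (graphHomeo L hk.continuous hp)
  have hΘ : ∀ T, Θ T = (L T).1 := hΘ
  suffices him : Manifold.IsImmersionOfComplement C 𝓘(ℝ, W) 𝓘(ℝ, U) ∞
      (Subtype.val : {T // p T} → U) from
    ⟨cs, hm, ⟨him.isImmersion, Topology.IsEmbedding.subtypeVal⟩, Θ, hΘ⟩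
  intro x
  -- In the chart `ψ`, which straightens the graph, the inclusion is `w ↦ L⁻¹(w, 0)`.
  let ψ : U ≃ₜ U := (L.toHomeomorph.trans (shear k hk.continuous)).trans L.symm.toHomeomorph
  have hψ : ContDiff ℝ ∞ ψ := by
    have : ContDiff ℝ ∞ fun q : W × C => (q.1, q.2 - k q.1) :=
      contDiff_fst.prodMk (contDiff_snd.sub (hk.comp contDiff_fst))
    exact L.symm.contDiff.comp (this.comp L.contDiff)
  have hψs : ContDiff ℝ ∞ ψ.symm := by
    have : ContDiff ℝ ∞ fun q : W × C => (q.1, q.2 + k q.1) :=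
      contDiff_fst.prodMk (contDiff_snd.add (hk.comp contDiff_fst))
    exact L.symm.contDiff.comp (this.comp L.contDiff)
  refine Manifold.IsImmersionAtOfComplement.mk_of_charts L.symm Θ.toHomeomorph.toOpenPartialHomeomorph
    ψ.toOpenPartialHomeomorph ?_ ?_ ?_ ?_ ?_ ?_
  · exact mem_univ x
  · exact mem_univ x.1
  · exact OpenPartialHomeomorph.mem_maximalAtlas_of_contMDiffOn _ Θ.contMDiff.contMDiffOn
      Θ.symm.contMDiff.contMDiffOn
  · exact OpenPartialHomeomorph.mem_maximalAtlas_of_contMDiffOn _ hψ.contMDiff.contMDiffOn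
      hψs.contMDiff.contMDiffOn
  · exact fun y _ => mem_univ y.1
  · intro w _
    obtain ⟨T, rfl⟩ := Θ.surjective w
    have h1 : Θ.symm (Θ T) = T := Θ.symm_apply_apply T
    change L.symm ((L (Θ.symm (Θ T)).1).1, (L (Θ.symm (Θ T)).1).2 - k (L (Θ.symm (Θ T)).1).1) =
      L.symm (Θ T, 0)
    rw [h1, hΘ, (hp T).1 T.2, sub_self]

end Graph

section Submersion

variable {W V K M N P HP VP : Type*} [NormedAddCommGroup W] [NormedSpace ℝ W]
  [NormedAddCommGroup V] [NormedSpace ℝ V] [NormedAddCommGroup K] [NormedSpace ℝ K]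
  [NormedAddCommGroup VP] [NormedSpace ℝ VP] [TopologicalSpace HP]
  {J : ModelWithCorners ℝ VP HP} [TopologicalSpace P] [ChartedSpace HP P]
  [TopologicalSpace M] [ChartedSpace W M] [IsManifold 𝓘(ℝ, W) ∞ M]
  [TopologicalSpace N] [ChartedSpace V N] [IsManifold 𝓘(ℝ, V) ∞ N]

/-- A criterion for submersions in terms of coordinates with values in manifolds diffeomorphic to
the domain and the codomain. -/
theorem isSubmersionAtOfComplement_of_diffeomorph (Θ : M ≃ₘ^∞⟮𝓘(ℝ, W), 𝓘(ℝ, W)⟯ W)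
    (Ψ : N ≃ₘ^∞⟮𝓘(ℝ, V), J⟯ P) {f : M → N} {x : M} (φ : OpenPartialHomeomorph W W)
    (hφ : ContDiffOn ℝ ∞ φ φ.source) (hφs : ContDiffOn ℝ ∞ φ.symm φ.target)
    (hx : Θ x ∈ φ.source) (ψ : OpenPartialHomeomorph P V)
    (hψ : ContMDiffOn J 𝓘(ℝ, V) ∞ ψ ψ.source) (hψs : ContMDiffOn 𝓘(ℝ, V) J ∞ ψ.symm ψ.target)
    (ℓ : W ≃L[ℝ] V × K)
    (h : ∀ y, Θ y ∈ φ.source → Ψ (f y) ∈ ψ.source ∧ ψ (Ψ (f y)) = (ℓ (φ (Θ y))).1) :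
    Manifold.IsSubmersionAtOfComplement K 𝓘(ℝ, W) 𝓘(ℝ, V) ∞ f x := by
  refine Manifold.IsSubmersionAtOfComplement.mk_of_charts ℓ
    (Θ.toHomeomorph.toOpenPartialHomeomorph.trans φ)
    (Ψ.toHomeomorph.toOpenPartialHomeomorph.trans ψ) ?_ ?_ ?_ ?_ ?_ ?_
  · simpa using hx
  · simpa using (h x hx).1
  · refine OpenPartialHomeomorph.mem_maximalAtlas_of_contMDiffOn _ ?_ ?_
    · exact hφ.contMDiffOn.comp Θ.contMDiff.contMDiffOn fun y hy => by simpa using hy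
    · exact Θ.symm.contMDiff.comp_contMDiffOn (hφs.contMDiffOn.mono fun y hy => by simpa using hy)
  · refine OpenPartialHomeomorph.mem_maximalAtlas_of_contMDiffOn _ ?_ ?_
    · exact hψ.comp Ψ.contMDiff.contMDiffOn fun y hy => by simpa using hy
    · exact Ψ.symm.contMDiff.comp_contMDiffOn (hψs.mono fun y hy => by simpa using hy)
  · intro y hy
    simpa using (h y (by simpa using hy)).1
  · intro w hw
    have hw' : w ∈ φ.target := by simpa using hw
    have h1 := (h (Θ.symm (φ.symm w)) (by simpa using φ.map_target hw')).2
    rw [Θ.apply_symm_apply, φ.right_inv hw'] at h1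
    exact h1

end Submersion

/-! ### Gauge equivalence and the moduli space -/

section Moduli

variable {E : Type*} [NormedAddCommGroup E] [NormedSpace ℝ E]
  {G : Type*} [TopologicalSpace G] [ChartedSpace E G] [Group G] [LieGroup 𝓘(ℝ, E) ∞ G]

theorem isGaugeFrame_iff {T : Fin 4 → C1 E} {u : unitInterval → G} :
    IsGaugeFrame T u ↔ IsFrame (T 0) u :=
  ⟨fun h => ⟨h.1, h.2.1, h.2.2⟩, fun h => ⟨h.1, h.2, h.3⟩⟩

/-- Gauge transformations preserve the Nahm–Schmid equations. -/
theorem IsSolution.gaugeTransform {u : unitInterval → G} (hu : IsC2 (E := E) u)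
    {T S : Fin 4 → C1 E} (hT : IsSolution G T) (h : IsGaugeTransform u T S) : IsSolution G S := by
  have hder : ∀ i, (∀ t, S i t = Ad (u t) (T i t)) → ∀ t,
      (S i).der t + bracketL E G (S 0 t) (S i t) =
        Ad (u t) ((T i).der t + bracketL E G (T 0 t) (T i t)) := by
    intro i hi t
    have h1 : (S i).der t =
        bracketL E G (rlogDeriv u t) (Ad (u t) (T i t)) + Ad (u t) ((T i).der t) := by
      refine (C1.uniqueDiffWithinAt t).eq_deriv _ ((S i).hasDerivWithinAt t) ?_
      refine (hasDerivWithinAt_Ad_apply hu (T i) t).congr_of_mem (fun r hr => ?_) t.2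
      simp only [IccExtend_of_mem _ _ hr]
      exact hi ⟨r, hr⟩
    rw [h1, hi, (h t).1, map_sub, sub_apply, map_add, Ad_bracketL]
    abel
  intro t
  obtain ⟨e1, e2, e3⟩ := hT t
  have k1 := hder 1 (fun t => (h t).2.1) t
  have k2 := hder 2 (fun t => (h t).2.2.1) t
  have k3 := hder 3 (fun t => (h t).2.2.2) t
  simp only [← bracketL_apply] at e1 e2 e3 ⊢
  rw [k1, k2, k3, e1, e2, e3, (h t).2.1, (h t).2.2.1, (h t).2.2.2]
  simp only [map_neg, Ad_bracketL, and_self]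

variable [CompleteSpace E] [FiniteDimensional ℝ E] [CompactSpace G]

variable (E G) in
/-- The holonomy of `T₀` and the initial values of `T₁, T₂, T₃`. -/
def period (T : Sol E G) : G × (E × E × E) := (hol G (T.1 0), (T.1 1 0, T.1 2 0, T.1 3 0))

variable [T2Space G]

/-- The holonomy and the initial values are a complete set of invariants for the gauge group
`𝒢₀₀`. If they agree, the quotient of the two frames is the required gauge transformation, by
uniqueness for the initial value problem. -/
theorem gaugeSetoid_iff (T S : Sol E G) :
    (gaugeSetoid E G).r T S ↔ period E G T = period E G S := by
  have hv := isFrame_frame (G := G) (T.1 0)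
  have hw := isFrame_frame (G := G) (S.1 0)
  constructor
  · rintro ⟨u, ⟨hu, hu0, hu1⟩, h⟩
    have huv : IsFrame (S.1 0) (u * frame G (T.1 0)) :=
      { isC2 := IsC2.mul hu hv.isC2
        map_zero := by simp [hu0, hv.map_zero]
        eq_neg := fun t => by
          rw [rlogDeriv_mul hu hv.isC2, hv.rlogDeriv_eq, (h t).1, map_neg]
          abel }
    have h1 : hol G (S.1 0) = hol G (T.1 0) := by
      rw [hol_eq huv, Pi.mul_apply, hu1, one_mul]
      rfl
    obtain ⟨-, h2, h3, h4⟩ := h 0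
    rw [hu0, Ad_one] at h2 h3 h4
    rw [period, period, h1, h2, h3, h4]
  · intro h
    obtain ⟨h1, h2, h3, h4⟩ : hol G (T.1 0) = hol G (S.1 0) ∧ T.1 1 0 = S.1 1 0 ∧
        T.1 2 0 = S.1 2 0 ∧ T.1 3 0 = S.1 3 0 := by
      simpa [period] using h
    set v := frame G (T.1 0)
    set w := frame G (S.1 0)
    have hu : IsC2 (E := E) (w * v⁻¹) := hw.isC2.mul hv.isC2.inv
    have hu0 : (w * v⁻¹) 0 = 1 := by simp [hw.map_zero, hv.map_zero]
    have hu1 : (w * v⁻¹) 1 = 1 := by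
      change hol G (S.1 0) * (hol G (T.1 0))⁻¹ = 1
      rw [h1, mul_inv_cancel]
    have hr : ∀ t, rlogDeriv (E := E) (w * v⁻¹) t = Ad ((w * v⁻¹) t) (T.1 0 t) - S.1 0 t := by
      intro t
      rw [rlogDeriv_mul hw.isC2 hv.isC2.inv, rlogDeriv_inv hv.isC2, hw.rlogDeriv_eq,
        hv.rlogDeriv_eq]
      simp only [map_neg, neg_neg, Pi.mul_apply, Pi.inv_apply, Ad_mul]
      exact neg_add_eq_sub _ _
    have hrc : Continuous (rlogDeriv (E := E) (w * v⁻¹)) := by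
      rw [funext hr]
      exact (((continuous_Ad E G).comp hu.continuous).clm_apply (T.1 0).continuous).sub
        (S.1 0).continuous
    choose R hR using fun i => exists_Ad_apply hu hrc (T.1 i)
    have hg : IsGaugeTransform (w * v⁻¹) T.1 ![S.1 0, R 1, R 2, R 3] := fun t =>
      ⟨by rw [hr, sub_sub_cancel]; rfl, hR 1 t, hR 2 t, hR 3 t⟩
    have h0 : ∀ i, R i 0 = T.1 i 0 := fun i => by rw [hR, hu0, Ad_one]
    have hRS : ![S.1 0, R 1, R 2, R 3] = S.1 :=
      IsSolution.eq_of_eq G (T.2.gaugeTransform hu hg) S.2 rfl ((h0 1).trans h2)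
        ((h0 2).trans h3) ((h0 3).trans h4)
    exact ⟨w * v⁻¹, ⟨hu, hu0, hu1⟩, hRS ▸ hg⟩

variable [ConnectedSpace G]

theorem isOpenQuotientMap_hol : IsOpenQuotientMap (hol (E := E) G) :=
  ⟨hol_surjective, continuous_hol, isOpenMap_hol⟩

variable (E G) in
/-- In the global coordinates `Θ` of the solution space, the period map is the product of the
holonomy and an identity map. -/
theorem isOpenQuotientMap_period (Θ : Sol E G ≃ₜ C1 E × E × E × E)
    (hΘ : ∀ T, Θ T = (T.1 0, T.1 1 0, T.1 2 0, T.1 3 0)) :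
    IsOpenQuotientMap (period E G) := by
  have h1 : IsOpenQuotientMap (Prod.map (hol (E := E) G) (id : E × E × E → E × E × E)) :=
    isOpenQuotientMap_hol.prodMap .id
  have h2 : period E G = Prod.map (hol (E := E) G) id ∘ Θ := funext fun T => by
    rw [Function.comp_apply, hΘ]
    rfl
  rw [h2]
  exact h1.comp Θ.isOpenQuotientMap

variable (E G) in
/-- The moduli space is homeomorphic to `G × 𝔤³`: the period map is an open quotient map whose
fibres are the gauge orbits. -/
theorem exists_moduli_homeomorph (Θ : Sol E G ≃ₜ C1 E × E × E × E)
    (hΘ : ∀ T, Θ T = (T.1 0, T.1 1 0, T.1 2 0, T.1 3 0)) :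
    ∃ e : Moduli E G ≃ₜ G × (E × E × E), ∀ T, e (toModuli T) = period E G T := by
  have hp := isOpenQuotientMap_period E G Θ hΘ
  let f : Moduli E G → G × (E × E × E) :=
    Quotient.lift (period E G) fun T S h => (gaugeSetoid_iff T S).1 h
  have hf : Function.Bijective f := by
    refine ⟨?_, fun y => ?_⟩
    · rintro ⟨T⟩ ⟨S⟩ h
      exact Quotient.sound ((gaugeSetoid_iff T S).2 h)
    · obtain ⟨T, rfl⟩ := hp.surjective y
      exact ⟨toModuli T, rfl⟩
  have ho : IsOpenMap f := fun U hU => by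
    have : f '' U = period E G '' (Quotient.mk _ ⁻¹' U) := by
      ext y
      constructor
      · rintro ⟨⟨T⟩, hT, rfl⟩
        exact ⟨T, hT, rfl⟩
      · rintro ⟨T, hT, rfl⟩
        exact ⟨toModuli T, hT, rfl⟩
    rw [this]
    exact hp.isOpenMap _ (hU.preimage continuous_quotient_mk')
  exact ⟨(Equiv.ofBijective f hf).toHomeomorphOfContinuousOpen (hp.continuous.quotient_lift _) ho,
    fun T => rfl⟩

end Moduli

/-! ### The projection onto the moduli space -/

section Projection

variable {E : Type*} [NormedAddCommGroup E] [NormedSpace ℝ E]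
  {G : Type*} [TopologicalSpace G] [ChartedSpace E G] [Group G] [LieGroup 𝓘(ℝ, E) ∞ G]

/-- Coordinates on `G` centred at `g`: the translate of the preferred chart at the identity. -/
def translatedChart (g : G) : OpenPartialHomeomorph G E :=
  have : IsTopologicalGroup G := topologicalGroup_of_lieGroup 𝓘(ℝ, E) ∞
  ((Homeomorph.mulLeft g⁻¹).toOpenPartialHomeomorph.trans (chartAt E (1 : G))).trans
    (Homeomorph.addLeft (-oneCoord E G)).toOpenPartialHomeomorph

theorem translatedChart_apply (g h : G) :
    translatedChart (E := E) g h = -oneCoord E G + oneChart E G (g⁻¹ * h) := by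
  simp [translatedChart, oneChart]

theorem translatedChart_symm_apply (g : G) (x : E) :
    (translatedChart (E := E) g).symm x = g * (oneChart E G).symm (oneCoord E G + x) := by
  simp [translatedChart, oneChart, Homeomorph.addLeft_symm, Homeomorph.mulLeft_symm]

theorem mem_translatedChart_source {g h : G} :
    h ∈ (translatedChart (E := E) g).source ↔ g⁻¹ * h ∈ (oneChart E G).source := by
  simp [translatedChart, oneChart]

theorem mem_translatedChart_target {g : G} {x : E} :
    x ∈ (translatedChart (E := E) g).target ↔ oneCoord E G + x ∈ (oneChart E G).target := by
  simp [translatedChart, oneChart, Homeomorph.addLeft_symm]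

theorem contMDiffOn_translatedChart (g : G) :
    ContMDiffOn 𝓘(ℝ, E) 𝓘(ℝ, E) ∞ (translatedChart (E := E) g)
      (translatedChart (E := E) g).source := by
  intro h hh
  rw [mem_translatedChart_source] at hh
  have h1 : ContMDiffAt 𝓘(ℝ, E) 𝓘(ℝ, E) ∞ (fun h : G => g⁻¹ * h) h :=
    contMDiffAt_const.mul contMDiffAt_id
  have h2 : ContMDiffAt 𝓘(ℝ, E) 𝓘(ℝ, E) ∞ (fun h : G => oneChart E G (g⁻¹ * h)) h :=
    ContMDiffAt.comp (g := oneChart E G) h (contMDiffAt_oneChart hh) h1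
  have h3 := (contMDiffAt_const (c := -oneCoord E G)).add h2
  refine ContMDiffAt.contMDiffWithinAt ?_
  rwa [funext (translatedChart_apply g)]

theorem contMDiffOn_translatedChart_symm (g : G) :
    ContMDiffOn 𝓘(ℝ, E) 𝓘(ℝ, E) ∞ (translatedChart (E := E) g).symm
      (translatedChart (E := E) g).target := by
  intro x hx
  rw [mem_translatedChart_target] at hx
  have h1 : ContMDiffAt 𝓘(ℝ, E) 𝓘(ℝ, E) ∞ (fun x : E => oneCoord E G + x) x :=
    contMDiffAt_const.add contMDiffAt_id
  have h2 : ContMDiffAt 𝓘(ℝ, E) 𝓘(ℝ, E) ∞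
      (fun x : E => (oneChart E G).symm (oneCoord E G + x)) x :=
    ContMDiffAt.comp (g := (oneChart E G).symm) x (contMDiffAt_oneChart_symm hx) h1
  have h3 := (contMDiffAt_const (c := g)).mul h2
  refine ContMDiffAt.contMDiffWithinAt ?_
  rwa [funext (translatedChart_symm_apply g)]

variable (A B C : Type*) [NormedAddCommGroup A] [NormedSpace ℝ A] [NormedAddCommGroup B]
  [NormedSpace ℝ B] [NormedAddCommGroup C] [NormedSpace ℝ C]

/-- The interchange of the last two factors in a product of three spaces. -/
def prodRightComm : ((A × B) × C) ≃L[ℝ] (A × C) × B :=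
  ContinuousLinearEquiv.equivOfInverse
    ((((ContinuousLinearMap.fst ℝ A B).comp (.fst ℝ (A × B) C)).prod (.snd ℝ (A × B) C)).prod
      ((ContinuousLinearMap.snd ℝ A B).comp (.fst ℝ (A × B) C)))
    ((((ContinuousLinearMap.fst ℝ A C).comp (.fst ℝ (A × C) B)).prod (.snd ℝ (A × C) B)).prod
      ((ContinuousLinearMap.snd ℝ A C).comp (.fst ℝ (A × C) B)))
    (fun _ => rfl) (fun _ => rfl)

variable [CompleteSpace E] [FiniteDimensional ℝ E] [CompactSpace G] [T2Space G]

/-- The projection onto the moduli space is a submersion: by `exists_hol_straightening`, in smooth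
coordinates of the solution space and of `G × 𝔤³`, it is the linear projection which forgets the
oscillation of `T₀`. -/
theorem isSubmersion_toModuli [ChartedSpace (C1 E × E × E × E) (Sol E G)]
    [ChartedSpace (E × E × E × E) (Moduli E G)]
    [IsManifold 𝓘(ℝ, C1 E × E × E × E) ∞ (Sol E G)]
    [IsManifold 𝓘(ℝ, E × E × E × E) ∞ (Moduli E G)]
    (Θ : Sol E G ≃ₘ^∞⟮𝓘(ℝ, C1 E × E × E × E), 𝓘(ℝ, C1 E × E × E × E)⟯ (C1 E × E × E × E))
    (hΘ : ∀ T, Θ T = (T.1 0, T.1 1 0, T.1 2 0, T.1 3 0))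
    (Ψ : Moduli E G ≃ₘ^∞⟮𝓘(ℝ, E × E × E × E), 𝓘(ℝ, E).prod 𝓘(ℝ, E × E × E)⟯ (G × (E × E × E)))
    (hΨ : ∀ T, Ψ (toModuli T) = period E G T) :
    Manifold.IsSubmersion 𝓘(ℝ, C1 E × E × E × E) 𝓘(ℝ, E × E × E × E) ∞
      (toModuli : Sol E G → Moduli E G) := by
  refine ⟨MeanZero E, inferInstance, inferInstance, fun T => ?_⟩
  obtain ⟨φ, hT, -, hφ, hφs, hφh⟩ := exists_hol_straightening (G := G) (T.1 0)
  let m := (meanSplit E).prodCongr (ContinuousLinearEquiv.refl ℝ (E × E × E))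
  let φ' : OpenPartialHomeomorph (C1 E × E × E × E) (C1 E × E × E × E) :=
    (φ.prod (OpenPartialHomeomorph.refl (E × E × E))).trans
      m.symm.toHomeomorph.toOpenPartialHomeomorph
  let c := translatedChart (E := E) (hol G (T.1 0))
  refine isSubmersionAtOfComplement_of_diffeomorph (K := MeanZero E) Θ Ψ φ' ?_ ?_ ?_
    (c.prod (OpenPartialHomeomorph.refl (E × E × E))) ?_ ?_ (m.trans (prodRightComm E _ _)) ?_
  · refine m.symm.contDiff.comp_contDiffOn ?_
    refine ContDiffOn.prodMk (hφ.comp contDiff_fst.contDiffOn fun q hq => ?_) contDiff_snd.contDiffOn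
    simpa [φ'] using hq
  · have : ContDiffOn ℝ ∞ (fun q : (E × MeanZero E) × (E × E × E) => (φ.symm q.1, q.2))
        (φ.target ×ˢ univ) :=
      (hφs.comp contDiff_fst.contDiffOn fun q hq => hq.1).prodMk contDiff_snd.contDiffOn
    refine this.comp m.contDiff.contDiffOn fun q hq => ?_
    simpa [φ'] using hq
  · simpa [φ', hΘ] using hT
  · refine ContMDiffOn.prodMk_space ?_ contMDiff_snd.contMDiffOn
    exact (contMDiffOn_translatedChart _).comp contMDiff_fst.contMDiffOn fun q hq => hq.1
  · refine ContMDiffOn.prodMk ?_ contDiff_snd.contMDiff.contMDiffOn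
    exact (contMDiffOn_translatedChart_symm _).comp contDiff_fst.contMDiff.contMDiffOn
      fun q hq => hq.1
  · intro S hS
    have hS' : S.1 0 ∈ φ.source := by simpa [φ', hΘ] using hS
    obtain ⟨h1, h2⟩ := hφh _ hS'
    have h3 : (hol G (T.1 0))⁻¹ * hol G (S.1 0) =
        (oneChart E G).symm (oneCoord E G + (φ (S.1 0)).1) := by rw [h2, inv_mul_cancel_left]
    have h4 : hol G (S.1 0) ∈ c.source := by
      rw [mem_translatedChart_source, h3]
      exact (oneChart E G).map_target h1
    have h5 : c (hol G (S.1 0)) = (φ (S.1 0)).1 := by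
      rw [translatedChart_apply, h3, (oneChart E G).right_inv h1, neg_add_cancel_left]
    rw [hΨ, hΘ]
    refine ⟨⟨h4, mem_univ _⟩, ?_⟩
    change (c (hol G (S.1 0)), _) =
      (prodRightComm E (MeanZero E) (E × E × E) (m (m.symm (φ (S.1 0), _)))).1
    rw [m.apply_symm_apply, h5]
    rfl

end Projection

end NahmSchmid

end

theorem mainTheorem1 {E : Type*} [NormedAddCommGroup E] [NormedSpace ℝ E] [FiniteDimensional ℝ E]
    {G : Type*} [TopologicalSpace G] [ChartedSpace E G] [Group G] [LieGroup 𝓘(ℝ, E) ∞ G]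
    [T2Space G] [CompactSpace G] [ConnectedSpace G] :
    (∀ T : NahmSchmid.Sol E G, ∃! u : unitInterval → G, NahmSchmid.IsGaugeFrame T.1 u) ∧
    ∃ (_ : ChartedSpace (NahmSchmid.C1 E × E × E × E) (NahmSchmid.Sol E G))
      (_ : ChartedSpace (E × E × E × E) (NahmSchmid.Moduli E G)),
      -- the solutions form a smooth Banach submanifold of `C¹([0,1], 𝔤)⁴`
      IsManifold 𝓘(ℝ, NahmSchmid.C1 E × E × E × E) ∞ (NahmSchmid.Sol E G) ∧
      Manifold.IsSmoothEmbedding 𝓘(ℝ, NahmSchmid.C1 E × E × E × E)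
        𝓘(ℝ, Fin 4 → NahmSchmid.C1 E) ∞
        (Subtype.val : NahmSchmid.Sol E G → (Fin 4 → NahmSchmid.C1 E)) ∧
      -- the moduli space is its smooth quotient manifold
      T2Space (NahmSchmid.Moduli E G) ∧
      IsManifold 𝓘(ℝ, E × E × E × E) ∞ (NahmSchmid.Moduli E G) ∧
      Manifold.IsSubmersion 𝓘(ℝ, NahmSchmid.C1 E × E × E × E) 𝓘(ℝ, E × E × E × E) ∞
        (NahmSchmid.toModuli : NahmSchmid.Sol E G → NahmSchmid.Moduli E G) ∧
      -- and it is diffeomorphic to `G × 𝔤 × 𝔤 × 𝔤`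
      ∃ Ψ : NahmSchmid.Moduli E G
          ≃ₘ^∞⟮𝓘(ℝ, E × E × E × E), 𝓘(ℝ, E).prod 𝓘(ℝ, E × E × E)⟯ (G × (E × E × E)),
        ∀ (T : NahmSchmid.Sol E G) (u : unitInterval → G), NahmSchmid.IsGaugeFrame T.1 u →
          Ψ (NahmSchmid.toModuli T) = (u 1, (T.1 1 0, T.1 2 0, T.1 3 0)) := by
  have : CompleteSpace E := FiniteDimensional.complete ℝ E
  have : IsManifold 𝓘(ℝ, E) ∞ G := inferInstance
  refine ⟨fun T => ?_, ?_⟩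
  · obtain ⟨u, hu⟩ := NahmSchmid.exists_isFrame (G := G) (T.1 0)
    refine ⟨u, NahmSchmid.isGaugeFrame_iff.2 hu, fun v hv => ?_⟩
    exact (NahmSchmid.isGaugeFrame_iff.1 hv).unique hu
  · obtain ⟨k, hk, hsol⟩ := NahmSchmid.exists_isSolution_iff_graph (E := E) G
    obtain ⟨cs, hm, hemb, Θ, hΘ⟩ :=
      NahmSchmid.exists_manifold_of_graph (NahmSchmid.nahmCoord E) hk hsol
    have hΘ' : ∀ T : NahmSchmid.Sol E G, Θ T = (T.1 0, T.1 1 0, T.1 2 0, T.1 3 0) := fun T =>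
      (hΘ T).trans (NahmSchmid.nahmCoord_fst T.1)
    obtain ⟨e, he⟩ := NahmSchmid.exists_moduli_homeomorph E G Θ.toHomeomorph hΘ'
    obtain ⟨cs', hm', Ψ, hΨ⟩ := NahmSchmid.exists_chartedSpace_prod_diffeomorph (V := E) e
    have hΨ' : ∀ T, Ψ (NahmSchmid.toModuli T) = NahmSchmid.period E G T := fun T =>
      (hΨ _).trans (he T)
    refine ⟨cs, cs', hm, hemb, e.symm.t2Space, hm',
      NahmSchmid.isSubmersion_toModuli Θ hΘ' Ψ hΨ', Ψ, fun T u hu => ?_⟩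
    rw [hΨ', NahmSchmid.period, NahmSchmid.hol_eq (NahmSchmid.isGaugeFrame_iff.1 hu)]
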